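/- **Setting.** Let $\Sigma$ be a finite alphabet. A *pomset* is an isomorphism class of finite $\Sigma$-labelled strict partial orders; $\varepsilon$ is the empty one; $\mathrm{SP}$ is the least class containing $\varepsilon$ and the singletons $a\in\Sigma$ and closed under sequential composition $\cdot$ and parallel composition $\parallel$ (below $\circ$ is either of them). A *context* $c$ is a series-parallel pomset over $\Sigma\cup\{\square\}$ with exactly one element labelled $\square$; $c[w]$ is obtained by replacing $\square$ by $w$. A *pomset recognizer* (PR) is a finite set with two associative operations, the second one commutative, having a common neutral element, together with an interpretation of the letters and a set of accepting states; $\mathrm{eval}(w)$ is the state $w\in\mathrm{SP}$ evaluates to. Let $L\subseteq\mathrm{SP}$ be the language of a PR $\mathcal M$; write $\mathcal M(w)=1$ if $w\in L$, else $0$. **Data.** The learner stores a finite set $S\subset\mathrm{SP}$ of access sequences; a finite pack $\mathcal B$ of components (finite sets of pomsets); and a discrimination tree $\mathcal D$, binary, with inner nodes labelled by contexts (their set is $\mathcal C$) and with leaves that are unlabelled or labelled by components. *Sifting* $w$ through $\mathcal D$ goes, at a node labelled $c$, to the right if $c[w]\in L$ and to the left otherwise; $\mathcal D(w)$ is the label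 of the leaf reached, if there is one. For $s$ in a component, $\mathcal B_s$ is that component; $\mathrm{as}(B)=S\cap B$ and $\mathrm{as}(s)=\mathrm{as}(\mathcal B_s)$. The *hypothesis* $\mathcal H$ induced by $(S,\mathcal B)$ is the PR with set of states $\mathcal B$, operations $\mathcal B_u\circ\mathcal B_v=\mathcal B_{u\circ v}$ for $u,v\in S$, neutral element $\mathcal B_\varepsilon$, letters $a\mapsto\mathcal B_a$, and with accepting states those components whose members lie in $L$. Put $\mathrm{as}_{\mathcal H}(z)=S\cap\mathrm{eval}_{\mathcal H}(z)$, and let $\mathrm{agree}(c,z)$ mean that $\mathcal H(c[p])=\mathcal M(c[p])$ for all $p\in\mathrm{as}_{\mathcal H}(z)$. **Procedures** (every choice is arbitrary). * $\mathtt{Expand}(w)$: add $w$ to $S$; then visit first $w$ and then, in any order, the pomsets $p\circ w$, $w\circ p$ ($p\in S$, both operators) and the letters. Visiting $p$: nothing is done if $p$ lies in a component; if $\mathcal D(p)=B$, add $p$ to $B$; if the leaf reached is unlabelled, create the component $\{p\}$, label the leaf with it, and call $\mathtt{Expand}(p)$. * $\mathtt{Refine}(B,c)$, which requires $B\in\mathcal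 B$ and $\mathcal M(c[z_1])\ne\mathcal M(c[z_2])$ for some $z_1,z_2\in B$: replace $B$ by $B_i=\{w\in B:\mathcal M(c[w])=i\}$, $i=0,1$, and the leaf $B$ of $\mathcal D$ by a node $c$ with left leaf $B_0$ and right leaf $B_1$; for $i=0$ and then $i=1$, if $S\cap B_i=\emptyset$, call $\mathtt{Expand}(p)$ for some $p\in B_i$. * $\mathtt{MakeConsistent}$: while there are $\circ$, $B\in\mathcal B$, $p_1,p_2\in\mathrm{as}(B)$ and $p\in S$ with $\mathcal D(p_1\circ p)\ne\mathcal D(p_2\circ p)$ [resp. $\mathcal D(p\circ p_1)\neq\mathcal D(p\circ p_2)$], choose $c\in\mathcal C$ with different values of $\mathcal M$ at $c[p_1\circ p]$ and $c[p_2\circ p]$ [resp. $c[p\circ p_1]$ and $c[p\circ p_2]$] and call $\mathtt{Refine}(B,c[\square\circ p])$ [resp. $\mathtt{Refine}(B,c[p\circ\square])$]. Return $\top$ if and only if no iteration took place. * $\mathtt{MakeAssoc}$: while there are $\circ$, $s_1,s_2,s_3\in S$, $s_l\in\mathrm{as}(s_1\circ s_2)$ and $s_r\in\mathrm{as}(s_2\circ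 s_3)$ with $\mathcal D(s_1\circ s_r)\ne\mathcal D(s_l\circ s_3)$, choose $c\in\mathcal C$ with $\mathcal M(c[s_1\circ s_r])\ne\mathcal M(c[s_l\circ s_3])$; if $\mathcal M(c[s_l\circ s_3])\ne\mathcal M(c[s_1\circ s_2\circ s_3])$, call $\mathtt{Refine}(\mathcal B_{s_1\circ s_2},c[\square\circ s_3])$, otherwise call $\mathtt{Refine}(\mathcal B_{s_2\circ s_3},c[s_1\circ\square])$. Return $\top$ if and only if no iteration took place. * $\mathtt{FindEBP}(c,z)$, which requires $\mathcal H(c[z])\ne\mathcal M(c[z])$ and $\mathrm{agree}(c,z)$: if $z\in\Sigma$, return $(c,z)$. Otherwise take a canonical decomposition $z=z_1\circ z_2$ (given by the root of an $\varepsilon$-free term of $z$ of minimal depth). If $\mathrm{agree}(c[\square\circ z_2],z_1)$, return $\mathtt{FindEBP}(c[\square\circ z_2],z_1)$. Otherwise choose $p_1\in\mathrm{as}_{\mathcal H}(z_1)$ with $\mathcal H(c[p_1\circ z_2])\ne\mathcal M(c[p_1\circ z_2])$; if $\mathrm{agree}(c[p_1\circ\square],z_2)$, return $\mathtt{FindEBP}(c[p_1\circ\square],z_2)$;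 otherwise choose $p_2\in\mathrm{as}_{\mathcal H}(z_2)$ with $\mathcal H(c[p_1\circ p_2])\ne\mathcal M(c[p_1\circ p_2])$ and return $(c,p_1\circ p_2)$. * $\mathtt{HandleCE}(w)$: set $ce=\{w\}$; while some $u\in ce$ has $\mathcal M(u)\ne\mathcal H(u)$: let $(c,p)=\mathtt{FindEBP}(\square,u)$; add $c[p]$ and all $c[p']$, $p'\in\mathrm{as}_{\mathcal H}(p)$, to $ce$; call $\mathtt{Expand}(p)$; repeat $\mathtt{MakeConsistent}$ and $\mathtt{MakeAssoc}$ until both return $\top$; let $\mathcal H$ be the hypothesis induced by the current $(S,\mathcal B)$. The learner starts with $S=\mathcal B=\emptyset$ and $\mathcal D$ a root labelled $\square$ with two unlabelled leaves, calls $\mathtt{Expand}(\varepsilon)$, and builds the first hypothesis; after that it calls $\mathtt{HandleCE}$ on counter-examples any number of times. **Theorem.** Consider a state $(S,\mathcal B,\mathcal D,\mathcal H)$ of the learner after the initialisation and any number of completed calls of $\mathtt{HandleCE}$, and let $w\in\mathrm{SP}\setminus\{\varepsilon\}$ satisfy $\mathcal H(w)\ne\mathcal M(w)$. Then: 1. $\mathtt{HandleCE}(w)$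 terminates: whatever choices are made, its execution is finite and never gets stuck (each required object exists, each requirement of a called procedure holds, and each hypothesis to be built exists). 2. It strictly refines the pack of components: if $\mathcal B'$ is the final pack, every pomset classified by $\mathcal B$ is still classified by $\mathcal B'$, no two pomsets in different components of $\mathcal B$ are in a common component of $\mathcal B'$, and $|\mathcal B'|>|\mathcal B|$. Consequently the final hypothesis has more states than $\mathcal H$. -/

import Mathlib

universe u v

noncomputable section

namespace PomsetLearning

/-! ### Pomsets -/

/-- A finite strict partial order whose elements are labelled in `A`. -/
structure LabPoset (A : Type u) where
  carrier : Type
  finite : Finite carrier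
  lt : carrier → carrier → Prop
  irrefl : ∀ x, ¬ lt x x
  trans : ∀ x y z, lt x y → lt y z → lt x z
  label : carrier → A

namespace LabPoset

variable {A : Type u} {B : Type v}

/-- Isomorphism of labelled posets. -/
def Iso (P Q : LabPoset A) : Prop :=
  ∃ e : P.carrier ≃ Q.carrier,
    (∀ x y, Q.lt (e x) (e y) ↔ P.lt x y) ∧ ∀ x, Q.label (e x) = P.label x

theorem Iso.refl (P : LabPoset A) : Iso P P :=
  ⟨Equiv.refl _, fun _ _ => Iff.rfl, fun _ => rfl⟩

theorem Iso.symm {P Q : LabPoset A} : Iso P Q → Iso Q P := by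
  rintro ⟨e, h, hl⟩
  refine ⟨e.symm, fun x y => ?_, fun x => ?_⟩
  · rw [← h]; simp
  · rw [← hl]; simp

theorem Iso.trans {P Q R : LabPoset A} : Iso P Q → Iso Q R → Iso P R := by
  rintro ⟨e, h, hl⟩ ⟨f, k, kl⟩
  exact ⟨e.trans f, fun x y => (k _ _).trans (h _ _), fun x => (kl _).trans (hl _)⟩

instance setoid (A : Type u) : Setoid (LabPoset A) :=
  ⟨Iso, Iso.refl, Iso.symm, Iso.trans⟩

/-- The empty poset. -/
def empty : LabPoset A where
  carrier := Empty
  finite := inferInstance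
  lt _ _ := False
  irrefl _ h := h
  trans _ _ _ h _ := h
  label x := x.elim

/-- The one-element poset labelled by `a`. -/
def single (a : A) : LabPoset A where
  carrier := Unit
  finite := inferInstance
  lt _ _ := False
  irrefl _ h := h
  trans _ _ _ h _ := h
  label _ := a

/-- Sequential composition: every element of `P` is below every element of `Q`. -/
def seq (P Q : LabPoset A) : LabPoset A where
  carrier := P.carrier ⊕ Q.carrier
  finite := by have := P.finite; have := Q.finite; infer_instance
  lt := Sum.Lex P.lt Q.lt
  irrefl := by
    rintro (x | x) h
    · exact P.irrefl x (by simpa using h)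
    · exact Q.irrefl x (by simpa using h)
  trans := by
    rintro (x | x) (y | y) (z | z) h k <;> simp at h k ⊢
    · exact P.trans _ _ _ h k
    · exact Q.trans _ _ _ h k
  label := Sum.elim P.label Q.label

/-- Parallel composition: the elements of `P` and of `Q` are incomparable. -/
def par (P Q : LabPoset A) : LabPoset A where
  carrier := P.carrier ⊕ Q.carrier
  finite := by have := P.finite; have := Q.finite; infer_instance
  lt := Sum.LiftRel P.lt Q.lt
  irrefl := by
    rintro (x | x) h
    · exact P.irrefl x (by simpa using h)
    · exact Q.irrefl x (by simpa using h)
  trans := by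
    rintro (x | x) (y | y) (z | z) h k <;> simp at h k ⊢
    · exact P.trans _ _ _ h k
    · exact Q.trans _ _ _ h k
  label := Sum.elim P.label Q.label

/-- Substitution: every element `x` of `P` is replaced by the poset `f (label x)`. -/
def subst (P : LabPoset A) (f : A → LabPoset B) : LabPoset B where
  carrier := Σ x : P.carrier, (f (P.label x)).carrier
  finite := by
    have := P.finite
    have := fun x => (f (P.label x)).finite
    infer_instance
  lt := Sigma.Lex P.lt fun x => (f (P.label x)).lt
  irrefl := by
    rintro ⟨x, y⟩ h
    rcases Sigma.lex_iff.1 h with h | ⟨_, h⟩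
    · exact P.irrefl _ h
    · exact (f _).irrefl _ h
  trans := by
    rintro ⟨x, y⟩ ⟨x', y'⟩ ⟨x'', y''⟩ h k
    cases h with
    | left _ _ h =>
      cases k with
      | left _ _ k => exact .left _ _ (P.trans _ _ _ h k)
      | right _ _ k => exact .left _ _ h
    | right _ _ h =>
      cases k with
      | left _ _ k => exact .left _ _ k
      | right _ _ k => exact .right _ _ ((f _).trans _ _ _ h k)
  label p := (f (P.label p.1)).label p.2

theorem Iso.seq {P P' Q Q' : LabPoset A} : Iso P P' → Iso Q Q' → Iso (P.seq Q) (P'.seq Q') := by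
  rintro ⟨e, h, hl⟩ ⟨f, k, kl⟩
  refine ⟨Equiv.sumCongr e f, ?_, ?_⟩
  · rintro (x | x) (y | y)
    · exact Sum.lex_inl_inl.trans ((h _ _).trans Sum.lex_inl_inl.symm)
    · exact iff_of_true (Sum.Lex.sep _ _) (Sum.Lex.sep _ _)
    · exact iff_of_false Sum.lex_inr_inl Sum.lex_inr_inl
    · exact Sum.lex_inr_inr.trans ((k _ _).trans Sum.lex_inr_inr.symm)
  · rintro (x | x)
    · exact hl x
    · exact kl x

theorem Iso.par {P P' Q Q' : LabPoset A} : Iso P P' → Iso Q Q' → Iso (P.par Q) (P'.par Q') := by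
  rintro ⟨e, h, hl⟩ ⟨f, k, kl⟩
  refine ⟨Equiv.sumCongr e f, ?_, ?_⟩
  · rintro (x | x) (y | y)
    · exact Sum.liftRel_inl_inl.trans ((h _ _).trans Sum.liftRel_inl_inl.symm)
    · exact iff_of_false Sum.not_liftRel_inl_inr Sum.not_liftRel_inl_inr
    · exact iff_of_false Sum.not_liftRel_inr_inl Sum.not_liftRel_inr_inl
    · exact Sum.liftRel_inr_inr.trans ((k _ _).trans Sum.liftRel_inr_inr.symm)
  · rintro (x | x)
    · exact hl x
    · exact kl x

/-- An isomorphism of the outer posets and isomorphisms of the inserted ones induce an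
isomorphism after substitution. -/
theorem Iso.subst {P P' : LabPoset A} {f g : A → LabPoset B} :
    Iso P P' → (∀ a, Iso (f a) (g a)) → Iso (P.subst f) (P'.subst g) := by
  rintro ⟨e, h, hl⟩ hfg
  choose i hi il using hfg
  have key : ∀ x, ∃ j : (f (P.label x)).carrier ≃ (g (P'.label (e x))).carrier,
      (∀ y z, (g (P'.label (e x))).lt (j y) (j z) ↔ (f (P.label x)).lt y z) ∧
      ∀ y, (g (P'.label (e x))).label (j y) = (f (P.label x)).label y := by
    intro x
    rw [hl x]
    exact ⟨i _, hi _, il _⟩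
  choose j hj jl using key
  refine ⟨Equiv.sigmaCongr e j, ?_, ?_⟩
  · rintro ⟨x, y⟩ ⟨x', y'⟩
    change Sigma.Lex P'.lt (fun x => (g (P'.label x)).lt) ⟨e x, j x y⟩ ⟨e x', j x' y'⟩ ↔
      Sigma.Lex P.lt (fun x => (f (P.label x)).lt) ⟨x, y⟩ ⟨x', y'⟩
    constructor
    · intro hh
      rcases Sigma.lex_iff.1 hh with hh | ⟨hx, hh⟩
      · exact .left _ _ ((h _ _).1 hh)
      · have hx' := e.injective hx
        subst hx'
        exact .right _ _ ((hj _ _ _).1 hh)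
    · intro hh
      cases hh with
      | left _ _ hh => exact .left _ _ ((h _ _).2 hh)
      | right _ _ hh => exact .right _ _ ((hj _ _ _).2 hh)
  · rintro ⟨x, y⟩
    exact jl x y

theorem subst_empty (f : A → LabPoset B) : Iso (empty.subst f) empty :=
  ⟨⟨fun x => x.1.elim, fun x => x.elim, fun x => x.1.elim, fun x => x.elim⟩,
    fun x => x.1.elim, fun x => x.1.elim⟩

theorem subst_single (a : A) (f : A → LabPoset B) : Iso ((single a).subst f) (f a) := by
  refine ⟨⟨fun x => x.2, fun y => ⟨(), y⟩, fun _ => rfl, fun _ => rfl⟩, ?_, fun _ => rfl⟩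
  rintro ⟨⟨⟩, y⟩ ⟨⟨⟩, y'⟩
  refine ⟨fun h => .right _ _ h, fun h => ?_⟩
  rcases Sigma.lex_iff.1 h with h | ⟨_, h⟩
  · exact h.elim
  · exact h

theorem subst_seq (P Q : LabPoset A) (f : A → LabPoset B) :
    Iso ((P.seq Q).subst f) ((P.subst f).seq (Q.subst f)) := by
  refine ⟨⟨fun x => match x with
      | ⟨.inl x, y⟩ => .inl ⟨x, y⟩
      | ⟨.inr x, y⟩ => .inr ⟨x, y⟩,
    fun x => match x with
      | .inl x => ⟨.inl x.1, x.2⟩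
      | .inr x => ⟨.inr x.1, x.2⟩, ?_, ?_⟩, ?_, ?_⟩
  · rintro ⟨x | x, y⟩ <;> rfl
  · rintro (x | x) <;> rfl
  · rintro ⟨x | x, y⟩ ⟨x' | x', y'⟩
    · refine Sum.lex_inl_inl.trans ⟨fun h => ?_, fun h => ?_⟩
      · cases h with
        | left _ _ h => exact .left _ _ (Sum.lex_inl_inl.2 h)
        | right _ _ h => exact .right _ _ h
      · cases h with
        | left _ _ h => exact .left _ _ (Sum.lex_inl_inl.1 h)
        | right _ _ h => exact .right _ _ h
    · exact iff_of_true (Sum.Lex.sep _ _) (.left _ _ (Sum.Lex.sep _ _))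
    · refine iff_of_false Sum.lex_inr_inl fun h => ?_
      cases h with
      | left _ _ h => exact Sum.lex_inr_inl h
    · refine Sum.lex_inr_inr.trans ⟨fun h => ?_, fun h => ?_⟩
      · cases h with
        | left _ _ h => exact .left _ _ (Sum.lex_inr_inr.2 h)
        | right _ _ h => exact .right _ _ h
      · cases h with
        | left _ _ h => exact .left _ _ (Sum.lex_inr_inr.1 h)
        | right _ _ h => exact .right _ _ h
  · rintro ⟨x | x, y⟩ <;> rfl

theorem subst_par (P Q : LabPoset A) (f : A → LabPoset B) :
    Iso ((P.par Q).subst f) ((P.subst f).par (Q.subst f)) := by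
  refine ⟨⟨fun x => match x with
      | ⟨.inl x, y⟩ => .inl ⟨x, y⟩
      | ⟨.inr x, y⟩ => .inr ⟨x, y⟩,
    fun x => match x with
      | .inl x => ⟨.inl x.1, x.2⟩
      | .inr x => ⟨.inr x.1, x.2⟩, ?_, ?_⟩, ?_, ?_⟩
  · rintro ⟨x | x, y⟩ <;> rfl
  · rintro (x | x) <;> rfl
  · rintro ⟨x | x, y⟩ ⟨x' | x', y'⟩
    · refine Sum.liftRel_inl_inl.trans ⟨fun h => ?_, fun h => ?_⟩
      · cases h with
        | left _ _ h => exact .left _ _ (Sum.liftRel_inl_inl.2 h)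
        | right _ _ h => exact .right _ _ h
      · cases h with
        | left _ _ h => exact .left _ _ (Sum.liftRel_inl_inl.1 h)
        | right _ _ h => exact .right _ _ h
    · refine iff_of_false Sum.not_liftRel_inl_inr fun h => ?_
      cases h with
      | left _ _ h => exact Sum.not_liftRel_inl_inr h
    · refine iff_of_false Sum.not_liftRel_inr_inl fun h => ?_
      cases h with
      | left _ _ h => exact Sum.not_liftRel_inr_inl h
    · refine Sum.liftRel_inr_inr.trans ⟨fun h => ?_, fun h => ?_⟩
      · cases h with
        | left _ _ h => exact .left _ _ (Sum.liftRel_inr_inr.2 h)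
        | right _ _ h => exact .right _ _ h
      · cases h with
        | left _ _ h => exact .left _ _ (Sum.liftRel_inr_inr.1 h)
        | right _ _ h => exact .right _ _ h
  · rintro ⟨x | x, y⟩ <;> rfl

end LabPoset

/-- A pomset is an isomorphism class of labelled posets. -/
def Pomset (A : Type u) : Type (max 1 u) := Quotient (LabPoset.setoid A)

/-- The two operators: sequential and parallel composition. -/
inductive Op
  | seq
  | par

namespace Pomset

variable {A : Type u} {B : Type v}

def mk (P : LabPoset A) : Pomset A := Quotient.mk _ P

def empty : Pomset A := mk LabPoset.empty

def single (a : A) : Pomset A := mk (LabPoset.single a)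

def comp : Op → Pomset A → Pomset A → Pomset A
  | .seq => Quotient.map₂ LabPoset.seq fun _ _ h _ _ k => LabPoset.Iso.seq h k
  | .par => Quotient.map₂ LabPoset.par fun _ _ h _ _ k => LabPoset.Iso.par h k

/-- Every element labelled `a` is replaced by the pomset `f a`. -/
def subst (w : Pomset A) (f : A → Pomset B) : Pomset B :=
  Quotient.map (fun P => LabPoset.subst P fun a => (f a).out)
    (fun _ _ h => LabPoset.Iso.subst h fun _ => LabPoset.Iso.refl _) w

/-- Series-parallel pomsets: the smallest class containing the empty and the singleton pomsets
that is closed under sequential and parallel composition. -/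
inductive IsSP : Pomset A → Prop
  | empty : IsSP empty
  | single (a : A) : IsSP (single a)
  | comp (o : Op) {x y : Pomset A} : IsSP x → IsSP y → IsSP (comp o x y)

/-- Exactly one element of the pomset carries the label `none`. -/
def OneHole (c : Pomset (Option A)) : Prop :=
  ∃ P : LabPoset (Option A), mk P = c ∧ ∃! x, P.label x = none

theorem subst_empty (f : A → Pomset B) : empty.subst f = empty :=
  Quotient.sound (LabPoset.subst_empty _)

theorem subst_single (a : A) (f : A → Pomset B) : (single a).subst f = f a := by
  have h : (single a).subst f = mk (f a).out := Quotient.sound (LabPoset.subst_single a _)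
  rw [h]
  exact Quotient.out_eq _

theorem subst_comp (o : Op) (x y : Pomset A) (f : A → Pomset B) :
    (comp o x y).subst f = comp o (x.subst f) (y.subst f) := by
  induction x using Quotient.inductionOn with | _ P =>
  induction y using Quotient.inductionOn with | _ Q =>
  cases o
  · exact Quotient.sound (LabPoset.subst_seq P Q _)
  · exact Quotient.sound (LabPoset.subst_par P Q _)

theorem IsSP.subst {w : Pomset A} (hw : IsSP w) {f : A → Pomset B} (hf : ∀ a, IsSP (f a)) :
    IsSP (w.subst f) := by
  induction hw with
  | empty => rw [subst_empty]; exact .empty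
  | single a => rw [subst_single]; exact hf a
  | comp o _ _ hx hy => rw [subst_comp]; exact .comp o hx hy

theorem oneHole_mk {P : LabPoset (Option A)} :
    OneHole (mk P) ↔ ∃! x, P.label x = none := by
  refine ⟨?_, fun h => ⟨P, rfl, h⟩⟩
  rintro ⟨Q, hQ, x, hx, hu⟩
  obtain ⟨e, -, hl⟩ : LabPoset.Iso Q P := Quotient.exact hQ
  refine ⟨e x, (hl x).trans hx, fun y hy => ?_⟩
  have := hu (e.symm y) ((hl _).symm.trans (by simpa using hy))
  rw [← this]; simp

/-- Substituting a one-hole pomset for the hole (and letters for letters) leaves one hole. -/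
theorem OneHole.subst {c : Pomset (Option A)} {f : Option A → Pomset (Option A)}
    (hc : OneHole c) (h0 : OneHole (f none)) (h1 : ∀ a, f (some a) = single (some a)) :
    OneHole (c.subst f) := by
  obtain ⟨P, rfl, x, hx, hu⟩ := hc
  have h1' : ∀ a y, (f (some a)).out.label y ≠ none := by
    intro a y hy
    have : mk (f (some a)).out = mk (LabPoset.single (some a)) :=
      (Quotient.out_eq _).trans (h1 a)
    obtain ⟨e, -, hl⟩ : LabPoset.Iso (f (some a)).out (LabPoset.single (some a)) :=
      Quotient.exact this
    have := hl y
    rw [hy] at this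
    exact Option.some_ne_none _ this
  have h0' : ∃! y, (f none).out.label y = none := by
    rw [← oneHole_mk]
    have : mk (f none).out = f none := Quotient.out_eq _
    rwa [this]
  have key : ∀ l : Option A, l = none → ∃! y, (f l).out.label y = none := by
    rintro l rfl; exact h0'
  have key' : ∀ l : Option A, l ≠ none → ∀ y, (f l).out.label y ≠ none := by
    intro l hl y
    obtain ⟨a, rfl⟩ := Option.ne_none_iff_exists'.1 hl
    exact h1' a y
  refine ⟨P.subst fun a => (f a).out, rfl, ?_⟩
  obtain ⟨y, hy, hyu⟩ := key _ hx
  refine ⟨⟨x, y⟩, hy, ?_⟩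
  rintro ⟨x', y'⟩ h
  have hx' : P.label x' = none := by
    by_contra hne
    exact key' _ hne y' h
  have hxx := hu x' hx'
  subst hxx
  rw [hyu y' h]

theorem OneHole.comp_letters {c : Pomset (Option A)} (hc : OneHole c) (o : Op) (w : Pomset A) :
    OneHole (comp o c (w.subst fun a => single (some a))) ∧
    OneHole (comp o (w.subst fun a => single (some a)) c) := by
  obtain ⟨P, rfl, x, hx, hu⟩ := hc
  induction w using Quotient.inductionOn with | _ Q =>
  set R : LabPoset (Option A) := Q.subst fun a => (single (some a) : Pomset (Option A)).out
    with hR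
  have hRl : ∀ y, R.label y ≠ none := by
    rintro ⟨q, y⟩ hy
    obtain ⟨e, -, hl⟩ : LabPoset.Iso (single (some (Q.label q)) : Pomset (Option A)).out
        (LabPoset.single (some (Q.label q))) :=
      Quotient.exact (Quotient.out_eq (single (some (Q.label q)) : Pomset (Option A)))
    have h2 := hl y
    have h3 : (single (some (Q.label q)) : Pomset (Option A)).out.label y = none := hy
    rw [h3] at h2
    exact Option.some_ne_none _ h2
  cases o
  · refine ⟨⟨P.seq R, rfl, .inl x, hx, ?_⟩, ⟨R.seq P, rfl, .inr x, hx, ?_⟩⟩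
    · rintro (y | y) hy
      · rw [hu y hy]
      · exact (hRl y hy).elim
    · rintro (y | y) hy
      · exact (hRl y hy).elim
      · rw [hu y hy]
  · refine ⟨⟨P.par R, rfl, .inl x, hx, ?_⟩, ⟨R.par P, rfl, .inr x, hx, ?_⟩⟩
    · rintro (y | y) hy
      · rw [hu y hy]
      · exact (hRl y hy).elim
    · rintro (y | y) hy
      · exact (hRl y hy).elim
      · rw [hu y hy]

end Pomset

/-- Series-parallel pomsets over `A`. -/
def SP (A : Type u) : Type (max 1 u) := {w : Pomset A // w.IsSP}

namespace SP

variable {A : Type u}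

def empty : SP A := ⟨Pomset.empty, .empty⟩

def single (a : A) : SP A := ⟨Pomset.single a, .single a⟩

def comp (o : Op) (x y : SP A) : SP A := ⟨Pomset.comp o x.1 y.1, .comp o x.2 y.2⟩

end SP

/-! ### Terms -/

/-- Syntactic terms: binary trees with inner nodes labelled by operators and leaves labelled by
letters or by the empty pomset. -/
inductive Term (A : Type u) : Type u
  | empty
  | letter (a : A)
  | node (o : Op) (l r : Term A)

namespace Term

variable {A : Type u}

/-- The pomset described by a term. -/
def toSP : Term A → SP A
  | empty => SP.empty
  | letter a => SP.single a
  | node o l r => SP.comp o l.toSP r.toSP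

def depth : Term A → ℕ
  | empty => 0
  | letter _ => 0
  | node _ l r => max l.depth r.depth + 1

/-- No leaf is labelled by the empty pomset. -/
def EmptyFree : Term A → Prop
  | empty => False
  | letter _ => True
  | node _ l r => l.EmptyFree ∧ r.EmptyFree

/-- A canonical term of `w`: of minimal depth among the terms of `w` and, if `w` is not empty,
without empty leaves. -/
def IsCanonical (t : Term A) (w : SP A) : Prop :=
  t.toSP = w ∧ (∀ t' : Term A, t'.toSP = w → t.depth ≤ t'.depth) ∧
    (w ≠ SP.empty → t.EmptyFree)

end Term

theorem SP.exists_term {A : Type u} (w : SP A) : ∃ t : Term A, t.toSP = w := by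
  obtain ⟨w, hw⟩ := w
  induction hw with
  | empty => exact ⟨.empty, rfl⟩
  | single a => exact ⟨.letter a, rfl⟩
  | comp o _ _ hx hy =>
    obtain ⟨s, hs⟩ := hx
    obtain ⟨t, ht⟩ := hy
    refine ⟨.node o s t, ?_⟩
    simp only [Term.toSP, hs, ht]
    rfl

/-- `z = z₁ ∘ z₂` is a canonical decomposition: some canonical term of `z` has root `∘` and
subtrees describing `z₁` and `z₂`. -/
def IsCanonicalDecomp {A : Type u} (z : SP A) (o : Op) (z₁ z₂ : SP A) : Prop :=
  ∃ t₁ t₂ : Term A, (Term.node o t₁ t₂).IsCanonical z ∧ t₁.toSP = z₁ ∧ t₂.toSP = z₂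

/-! ### Contexts -/

/-- Contexts: series-parallel pomsets over the letters and one additional symbol (`none`), which
labels exactly one element. -/
def Ctx (A : Type u) : Type (max 1 u) :=
  {c : Pomset (Option A) // c.IsSP ∧ c.OneHole}

namespace Ctx

variable {A : Type u}

/-- The trivial context. -/
def hole : Ctx A :=
  ⟨Pomset.single none, .single none, LabPoset.single none, rfl, (), rfl, fun _ _ => rfl⟩

/-- `c[w]`. -/
def fill (c : Ctx A) (w : SP A) : SP A :=
  ⟨c.1.subst fun l => l.elim w.1 Pomset.single, c.2.1.subst fun l => by
    cases l with
    | none => exact w.2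
    | some a => exact .single a⟩

/-- `c[c']`. -/
def plug (c c' : Ctx A) : Ctx A :=
  ⟨c.1.subst fun l => l.elim c'.1 fun a => Pomset.single (some a),
    c.2.1.subst fun l => by
      cases l with
      | none => exact c'.2.1
      | some a => exact .single (some a),
    c.2.2.subst c'.2.2 fun _ => rfl⟩

/-- The context in which the hole is the left operand and `z` the right one. -/
def holeLeft (o : Op) (z : SP A) : Ctx A :=
  ⟨Pomset.comp o hole.1 (z.1.subst fun a => Pomset.single (some a)),
    .comp o hole.2.1 (z.2.subst fun a => .single (some a)), (hole.2.2.comp_letters o z.1).1⟩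

/-- The context in which `z` is the left operand and the hole the right one. -/
def holeRight (o : Op) (z : SP A) : Ctx A :=
  ⟨Pomset.comp o (z.1.subst fun a => Pomset.single (some a)) hole.1,
    .comp o (z.2.subst fun a => .single (some a)) hole.2.1, (hole.2.2.comp_letters o z.1).2⟩

end Ctx

/-! ### Pomset recognizers -/

/-- A pomset recognizer on the alphabet `A` with set of states `M`: a bimonoid structure on `M`,
an interpretation of the letters and a set of accepting states. -/
structure Recognizer (A : Type u) (M : Type v) where
  op : Op → M → M → M
  one : M
  op_assoc : ∀ o x y z, op o (op o x y) z = op o x (op o y z)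
  par_comm : ∀ x y, op .par x y = op .par y x
  one_op : ∀ o x, op o one x = x
  op_one : ∀ o x, op o x one = x
  init : A → M
  final : Set M

namespace Recognizer

variable {A : Type u} {M : Type v}

def termValue (R : Recognizer A M) : Term A → M
  | .empty => R.one
  | .letter a => R.init a
  | .node o l r => R.op o (R.termValue l) (R.termValue r)

/-- The state a pomset evaluates to, computed along a term of the pomset. (The result does not
depend on the term, since series-parallel pomsets are the free bimonoid on the alphabet.) -/
def eval (R : Recognizer A M) (w : SP A) : M := R.termValue w.exists_term.choose

/-- The recognizer accepts `w`. -/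
def Accepts (R : Recognizer A M) (w : SP A) : Prop := R.eval w ∈ R.final

end Recognizer

/-! ### Data structures of the learner -/

/-- Discrimination trees: inner nodes are labelled by contexts, leaves are unlabelled or labelled
by a component. -/
inductive DTree (A : Type u) : Type (max 1 u)
  | leaf (label : Option (Finset (SP A)))
  | node (c : Ctx A) (left right : DTree A)

namespace DTree

variable {A : Type u}

/-- The label of the leaf reached by sifting `w` (`none` if the leaf is unlabelled): at a node
labelled `c`, go right if `c[w]` is in the language `L` and left otherwise. -/
def sift (L : Set (SP A)) : DTree A → SP A → Option (Finset (SP A))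
  | leaf B, _ => B
  | node c l r, w => open Classical in if c.fill w ∈ L then r.sift L w else l.sift L w

/-- Label the leaf reached by sifting `w` with `B`. -/
def labelLeaf (L : Set (SP A)) (w : SP A) (B : Finset (SP A)) : DTree A → DTree A
  | leaf _ => leaf (some B)
  | node c l r => open Classical in
      if c.fill w ∈ L then node c l (r.labelLeaf L w B) else node c (l.labelLeaf L w B) r

/-- `D.replaceLeaf B T`: replace the leaf labelled `B` of `D` by the tree `T`. -/
def replaceLeaf (B : Finset (SP A)) : DTree A → DTree A → DTree A
  | leaf b, T => open Classical in if b = some B then T else leaf b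
  | node c l r, T => node c (l.replaceLeaf B T) (r.replaceLeaf B T)

/-- The set of contexts that label the inner nodes. -/
def contexts : DTree A → Set (Ctx A)
  | leaf _ => ∅
  | node c l r => {c} ∪ l.contexts ∪ r.contexts

/-- A root labelled by the trivial context with two unlabelled leaves. -/
def initial : DTree A := node Ctx.hole (leaf none) (leaf none)

end DTree

/-- A hypothesis: a recognizer whose states are the components of a pack of components. -/
structure Hypothesis (A : Type u) where
  comps : Finset (Finset (SP A))
  recog : Recognizer A {B : Finset (SP A) // B ∈ comps}

/-- The number of states of a hypothesis. -/
def Hypothesis.numStates {A : Type u} (H : Hypothesis A) : ℕ :=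
  Nat.card {B : Finset (SP A) // B ∈ H.comps}

/-- The variables of the learner. -/
structure Store (A : Type u) where
  /-- the access sequences -/
  S : Finset (SP A)
  /-- the pack of components -/
  comps : Finset (Finset (SP A))
  /-- the discrimination tree -/
  tree : DTree A
  /-- the current hypothesis, if one has been built -/
  hyp : Option (Hypothesis A)
  /-- the pool of counter-examples -/
  ce : Finset (SP A)
  /-- the pair returned by the last counter-example analysis -/
  found : Ctx A × SP A
  /-- the Boolean returned by the last consistency pass -/
  alreadyConsistent : Bool
  /-- the Boolean returned by the last associativity pass -/
  alreadyAssoc : Bool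

namespace Store

variable {A : Type u}

def initial : Store A where
  S := ∅
  comps := ∅
  tree := DTree.initial
  hyp := none
  ce := ∅
  found := (Ctx.hole, SP.empty)
  alreadyConsistent := true
  alreadyAssoc := true

/-- `s` is an access sequence of the component `B`. -/
def IsAccess (σ : Store A) (B : Finset (SP A)) (s : SP A) : Prop := s ∈ B ∧ s ∈ σ.S

/-- The consistency defect of the component `B` witnessed by the access sequences `p₁`, `p₂`, with
`p` as right operand. -/
def ConsDefectRight (L : Set (SP A)) (σ : Store A) (o : Op) (B : Finset (SP A))
    (p₁ p₂ p : SP A) : Prop :=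
  B ∈ σ.comps ∧ σ.IsAccess B p₁ ∧ σ.IsAccess B p₂ ∧ p ∈ σ.S ∧
    σ.tree.sift L (SP.comp o p₁ p) ≠ σ.tree.sift L (SP.comp o p₂ p)

/-- The same with `p` as left operand. -/
def ConsDefectLeft (L : Set (SP A)) (σ : Store A) (o : Op) (B : Finset (SP A))
    (p₁ p₂ p : SP A) : Prop :=
  B ∈ σ.comps ∧ σ.IsAccess B p₁ ∧ σ.IsAccess B p₂ ∧ p ∈ σ.S ∧
    σ.tree.sift L (SP.comp o p p₁) ≠ σ.tree.sift L (SP.comp o p p₂)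

/-- The associativity defect witnessed by `s₁, s₂, s₃` and the access sequences `sl`, `sr` of the
components `Bl` of `s₁ ∘ s₂` and `Br` of `s₂ ∘ s₃`. -/
def AssocDefect (L : Set (SP A)) (σ : Store A) (o : Op) (s₁ s₂ s₃ sl sr : SP A)
    (Bl Br : Finset (SP A)) : Prop :=
  s₁ ∈ σ.S ∧ s₂ ∈ σ.S ∧ s₃ ∈ σ.S ∧
    Bl ∈ σ.comps ∧ SP.comp o s₁ s₂ ∈ Bl ∧ σ.IsAccess Bl sl ∧
    Br ∈ σ.comps ∧ SP.comp o s₂ s₃ ∈ Br ∧ σ.IsAccess Br sr ∧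
    σ.tree.sift L (SP.comp o s₁ sr) ≠ σ.tree.sift L (SP.comp o sl s₃)

/-- `R` is the hypothesis induced by the pack of components: the product of the components of
`u, v ∈ S` is the component of `u ∘ v`, the neutral element is the component of the empty pomset,
a letter is interpreted by its component, and a component is accepting if its members are in
`L`. -/
def IsInduced (L : Set (SP A)) (σ : Store A)
    (R : Recognizer A {B : Finset (SP A) // B ∈ σ.comps}) : Prop :=
  (∀ (o : Op) (B₁ B₂ B : {B : Finset (SP A) // B ∈ σ.comps}) (u v : SP A),
    u ∈ σ.S → v ∈ σ.S → u ∈ B₁.1 → v ∈ B₂.1 → SP.comp o u v ∈ B.1 → R.op o B₁ B₂ = B) ∧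
  SP.empty ∈ R.one.1 ∧
  (∀ a, SP.single a ∈ (R.init a).1) ∧
  (∀ B, B ∈ R.final ↔ ∀ s ∈ B.1, s ∈ L)

/-- `p` is an access sequence of the component `z` evaluates to in `H`. -/
def HypAccess (σ : Store A) (H : Hypothesis A) (z p : SP A) : Prop :=
  σ.IsAccess (H.recog.eval z).1 p

/-- `H` and the language `L` agree on `w`. -/
def SameVerdict (L : Set (SP A)) (H : Hypothesis A) (w : SP A) : Prop :=
  H.recog.Accepts w ↔ w ∈ L

/-- The agreement predicate: hypothesis and language agree on `c[p]` for each access sequence `p`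
of the state of `z`. -/
def Agree (L : Set (SP A)) (σ : Store A) (H : Hypothesis A) (c : Ctx A) (z : SP A) : Prop :=
  ∀ p, σ.HypAccess H z p → SameVerdict L H (c.fill p)

end Store

/-! ### The algorithms, as a nondeterministic machine with a stack of instructions -/

/-- Instructions: procedure calls and the loops occurring in the procedures. -/
inductive Instr (A : Type u) : Type (max 1 u)
  /-- insert `w` into the set of access sequences -/
  | expand (w : SP A)
  /-- body of the loop of `expand` -/
  | visit (p : SP A)
  /-- loop of `expand` over the remaining set `X` -/
  | visitAll (X : Finset (SP A))
  /-- split the component `B` by the context `c` -/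
  | refine (B : Finset (SP A)) (c : Ctx A)
  /-- expand some element of the component `B` if it has no access sequence -/
  | ensureAccess (B : Finset (SP A))
  | makeConsistent
  | consistentLoop
  | makeAssoc
  | assocLoop
  /-- counter-example analysis of `c[z]` -/
  | findEBP (c : Ctx A) (z : SP A)
  | buildHypothesis
  | handleCE (w : SP A)
  /-- while loop of `handleCE` -/
  | ceLoop
  /-- update of the counter-example pool, followed by the expansion of the new representative -/
  | recordAndExpand
  /-- repeat loop of `handleCE` -/
  | repeatLoop
  /-- test at the end of the repeat loop -/
  | repeatTest

open Store

open Classical in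
/-- `Step L i σ k σ'`: for the language `L`, executing the instruction `i` in the store `σ` leads
to the store `σ'`, the instructions `k` remaining to be executed in place of `i`. -/
inductive Step {A : Type u} [Fintype A] (L : Set (SP A)) :
    Instr A → Store A → List (Instr A) → Store A → Prop
  -- Expand
  | expand (w : SP A) (σ : Store A) :
      Step L (.expand w) σ
        [.visit w, .visitAll
          ((insert w σ.S).image (fun p => SP.comp .seq p w) ∪
           (insert w σ.S).image (fun p => SP.comp .seq w p) ∪
           (insert w σ.S).image (fun p => SP.comp .par p w) ∪
           (insert w σ.S).image (fun p => SP.comp .par w p) ∪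
           Finset.univ.image SP.single)]
        { σ with S := insert w σ.S }
  | visitAll_nil (σ : Store A) : Step L (.visitAll ∅) σ [] σ
  | visitAll_cons (X : Finset (SP A)) (σ : Store A) (p : SP A) (hp : p ∈ X) :
      Step L (.visitAll X) σ [.visit p, .visitAll (X.erase p)] σ
  | visit_classified (p : SP A) (σ : Store A) (h : ∃ B ∈ σ.comps, p ∈ B) :
      Step L (.visit p) σ [] σ
  | visit_labelled (p : SP A) (σ : Store A) (B : Finset (SP A)) (h : ∀ B' ∈ σ.comps, p ∉ B')
      (hB : σ.tree.sift L p = some B) :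
      Step L (.visit p) σ []
        { σ with
          comps := insert (insert p B) (σ.comps.erase B)
          tree := σ.tree.replaceLeaf B (.leaf (some (insert p B))) }
  | visit_unlabelled (p : SP A) (σ : Store A) (h : ∀ B' ∈ σ.comps, p ∉ B')
      (hp : σ.tree.sift L p = none) :
      Step L (.visit p) σ [.expand p]
        { σ with
          comps := insert {p} σ.comps
          tree := σ.tree.labelLeaf L p {p} }
  -- Refine
  | refine (B : Finset (SP A)) (c : Ctx A) (σ : Store A) (hB : B ∈ σ.comps) (z₁ z₂ : SP A)
      (h₁ : z₁ ∈ B) (h₂ : z₂ ∈ B) (hc : ¬ (c.fill z₁ ∈ L ↔ c.fill z₂ ∈ L)) :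
      Step L (.refine B c) σ
        [.ensureAccess (B.filter fun w => c.fill w ∉ L),
         .ensureAccess (B.filter fun w => c.fill w ∈ L)]
        { σ with
          comps := (σ.comps.erase B) ∪
            {B.filter fun w => c.fill w ∉ L, B.filter fun w => c.fill w ∈ L}
          tree := σ.tree.replaceLeaf B
            (.node c (.leaf (some (B.filter fun w => c.fill w ∉ L)))
              (.leaf (some (B.filter fun w => c.fill w ∈ L)))) }
  | ensureAccess_skip (B : Finset (SP A)) (σ : Store A) (h : ∃ s, σ.IsAccess B s) :
      Step L (.ensureAccess B) σ [] σ
  | ensureAccess_expand (B : Finset (SP A)) (σ : Store A) (h : ¬ ∃ s, σ.IsAccess B s)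
      (p : SP A) (hp : p ∈ B) :
      Step L (.ensureAccess B) σ [.expand p] σ
  -- MakeConsistent
  | makeConsistent (σ : Store A) :
      Step L .makeConsistent σ [.consistentLoop] { σ with alreadyConsistent := true }
  | consistent_right (σ : Store A) (o : Op) (B : Finset (SP A)) (p₁ p₂ p : SP A) (c : Ctx A)
      (h : σ.ConsDefectRight L o B p₁ p₂ p) (hc : c ∈ σ.tree.contexts)
      (hd : ¬ (c.fill (SP.comp o p₁ p) ∈ L ↔ c.fill (SP.comp o p₂ p) ∈ L)) :
      Step L .consistentLoop σ [.refine B (c.plug (Ctx.holeLeft o p)), .consistentLoop]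
        { σ with alreadyConsistent := false }
  | consistent_left (σ : Store A) (o : Op) (B : Finset (SP A)) (p₁ p₂ p : SP A) (c : Ctx A)
      (h : σ.ConsDefectLeft L o B p₁ p₂ p) (hc : c ∈ σ.tree.contexts)
      (hd : ¬ (c.fill (SP.comp o p p₁) ∈ L ↔ c.fill (SP.comp o p p₂) ∈ L)) :
      Step L .consistentLoop σ [.refine B (c.plug (Ctx.holeRight o p)), .consistentLoop]
        { σ with alreadyConsistent := false }
  | consistent_exit (σ : Store A)
      (h : ¬ ∃ o B p₁ p₂ p, σ.ConsDefectRight L o B p₁ p₂ p ∨ σ.ConsDefectLeft L o B p₁ p₂ p) :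
      Step L .consistentLoop σ [] σ
  -- MakeAssoc
  | makeAssoc (σ : Store A) :
      Step L .makeAssoc σ [.assocLoop] { σ with alreadyAssoc := true }
  | assoc_left (σ : Store A) (o : Op) (s₁ s₂ s₃ sl sr : SP A) (Bl Br : Finset (SP A)) (c : Ctx A)
      (h : σ.AssocDefect L o s₁ s₂ s₃ sl sr Bl Br) (hc : c ∈ σ.tree.contexts)
      (hd : ¬ (c.fill (SP.comp o s₁ sr) ∈ L ↔ c.fill (SP.comp o sl s₃) ∈ L))
      (hq : ¬ (c.fill (SP.comp o sl s₃) ∈ L ↔ c.fill (SP.comp o (SP.comp o s₁ s₂) s₃) ∈ L)) :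
      Step L .assocLoop σ [.refine Bl (c.plug (Ctx.holeLeft o s₃)), .assocLoop]
        { σ with alreadyAssoc := false }
  | assoc_right (σ : Store A) (o : Op) (s₁ s₂ s₃ sl sr : SP A) (Bl Br : Finset (SP A)) (c : Ctx A)
      (h : σ.AssocDefect L o s₁ s₂ s₃ sl sr Bl Br) (hc : c ∈ σ.tree.contexts)
      (hd : ¬ (c.fill (SP.comp o s₁ sr) ∈ L ↔ c.fill (SP.comp o sl s₃) ∈ L))
      (hq : c.fill (SP.comp o sl s₃) ∈ L ↔ c.fill (SP.comp o (SP.comp o s₁ s₂) s₃) ∈ L) :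
      Step L .assocLoop σ [.refine Br (c.plug (Ctx.holeRight o s₁)), .assocLoop]
        { σ with alreadyAssoc := false }
  | assoc_exit (σ : Store A)
      (h : ¬ ∃ o s₁ s₂ s₃ sl sr Bl Br, σ.AssocDefect L o s₁ s₂ s₃ sl sr Bl Br) :
      Step L .assocLoop σ [] σ
  -- FindEBP
  | findEBP_letter (σ : Store A) (H : Hypothesis A) (c : Ctx A) (a : A)
      (hH : σ.hyp = some H) (hw : ¬ SameVerdict L H (c.fill (SP.single a)))
      (ha : σ.Agree L H c (SP.single a)) :
      Step L (.findEBP c (SP.single a)) σ [] { σ with found := (c, SP.single a) }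
  | findEBP_descend (σ : Store A) (H : Hypothesis A) (c : Ctx A) (z : SP A)
      (hH : σ.hyp = some H) (hw : ¬ SameVerdict L H (c.fill z)) (ha : σ.Agree L H c z)
      (o : Op) (z₁ z₂ : SP A) (hz : IsCanonicalDecomp z o z₁ z₂)
      (h₁ : σ.Agree L H (c.plug (Ctx.holeLeft o z₂)) z₁) :
      Step L (.findEBP c z) σ [.findEBP (c.plug (Ctx.holeLeft o z₂)) z₁] σ
  | findEBP_switch (σ : Store A) (H : Hypothesis A) (c : Ctx A) (z : SP A)
      (hH : σ.hyp = some H) (hw : ¬ SameVerdict L H (c.fill z)) (ha : σ.Agree L H c z)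
      (o : Op) (z₁ z₂ : SP A) (hz : IsCanonicalDecomp z o z₁ z₂)
      (h₁ : ¬ σ.Agree L H (c.plug (Ctx.holeLeft o z₂)) z₁)
      (p₁ : SP A) (hp₁ : σ.HypAccess H z₁ p₁)
      (hd₁ : ¬ SameVerdict L H (c.fill (SP.comp o p₁ z₂)))
      (h₂ : σ.Agree L H (c.plug (Ctx.holeRight o p₁)) z₂) :
      Step L (.findEBP c z) σ [.findEBP (c.plug (Ctx.holeRight o p₁)) z₂] σ
  | findEBP_found (σ : Store A) (H : Hypothesis A) (c : Ctx A) (z : SP A)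
      (hH : σ.hyp = some H) (hw : ¬ SameVerdict L H (c.fill z)) (ha : σ.Agree L H c z)
      (o : Op) (z₁ z₂ : SP A) (hz : IsCanonicalDecomp z o z₁ z₂)
      (h₁ : ¬ σ.Agree L H (c.plug (Ctx.holeLeft o z₂)) z₁)
      (p₁ : SP A) (hp₁ : σ.HypAccess H z₁ p₁)
      (hd₁ : ¬ SameVerdict L H (c.fill (SP.comp o p₁ z₂)))
      (h₂ : ¬ σ.Agree L H (c.plug (Ctx.holeRight o p₁)) z₂)
      (p₂ : SP A) (hp₂ : σ.HypAccess H z₂ p₂)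
      (hd₂ : ¬ SameVerdict L H (c.fill (SP.comp o p₁ p₂))) :
      Step L (.findEBP c z) σ [] { σ with found := (c, SP.comp o p₁ p₂) }
  -- BuildHypothesis
  | buildHypothesis (σ : Store A) (R : Recognizer A {B : Finset (SP A) // B ∈ σ.comps})
      (hR : σ.IsInduced L R) :
      Step L .buildHypothesis σ [] { σ with hyp := some ⟨σ.comps, R⟩ }
  -- HandleCE
  | handleCE (w : SP A) (σ : Store A) :
      Step L (.handleCE w) σ [.ceLoop] { σ with ce := {w} }
  | ceLoop_body (σ : Store A) (H : Hypothesis A) (hH : σ.hyp = some H) (x : SP A)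
      (hx : x ∈ σ.ce) (hd : ¬ SameVerdict L H x) :
      Step L .ceLoop σ
        [.findEBP Ctx.hole x, .recordAndExpand, .repeatLoop, .buildHypothesis, .ceLoop] σ
  | ceLoop_exit (σ : Store A) (H : Hypothesis A) (hH : σ.hyp = some H)
      (h : ∀ x ∈ σ.ce, SameVerdict L H x) :
      Step L .ceLoop σ [] σ
  | recordAndExpand (σ : Store A) (H : Hypothesis A) (hH : σ.hyp = some H)
      (c : Ctx A) (p : SP A) (h : σ.found = (c, p)) :
      Step L .recordAndExpand σ [.expand p]
        { σ with
          ce := σ.ce ∪ {c.fill p} ∪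
            (σ.S.filter fun p' => σ.HypAccess H p p').image fun p' => c.fill p' }
  | repeatLoop (σ : Store A) :
      Step L .repeatLoop σ [.makeConsistent, .makeAssoc, .repeatTest] σ
  | repeatTest_again (σ : Store A) (h : ¬ (σ.alreadyConsistent = true ∧ σ.alreadyAssoc = true)) :
      Step L .repeatTest σ [.repeatLoop] σ
  | repeatTest_exit (σ : Store A) (h : σ.alreadyConsistent = true ∧ σ.alreadyAssoc = true) :
      Step L .repeatTest σ [] σ

/-- One step of the machine on configurations (stack of instructions, store). -/
inductive Next {A : Type u} [Fintype A] (L : Set (SP A)) :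
    List (Instr A) × Store A → List (Instr A) × Store A → Prop
  | mk {i : Instr A} {σ σ' : Store A} {k : List (Instr A)} (h : Step L i σ k σ')
      (rest : List (Instr A)) : Next L (i :: rest, σ) (k ++ rest, σ')

/-- Some execution leads from the first configuration to the second one. -/
def Runs {A : Type u} [Fintype A] (L : Set (SP A)) :
    List (Instr A) × Store A → List (Instr A) × Store A → Prop :=
  Relation.ReflTransGen (Next L)

/-- Every execution from the configuration `C` is finite, whatever choices are made, and none gets
stuck: an execution can stop only when no instruction is left. -/
def AlwaysTerminates {A : Type u} [Fintype A] (L : Set (SP A))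
    (C : List (Instr A) × Store A) : Prop :=
  (¬ ∃ f : ℕ → List (Instr A) × Store A, f 0 = C ∧ ∀ n, Next L (f n) (f (n + 1))) ∧
  ∀ C', Runs L C C' → C'.1 = [] ∨ ∃ C'', Next L C' C''

/-- The stores of the learner at the points where a counter-example may be handled: after the
initialisation (expansion of the empty pomset, first hypothesis) and after the handling of any
number of counter-examples. -/
inductive Reachable {A : Type u} [Fintype A] (L : Set (SP A)) : Store A → Prop
  | init {σ : Store A}
      (h : Runs L ([.expand SP.empty, .buildHypothesis], Store.initial) ([], σ)) : Reachable L σ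
  | handle {σ σ' : Store A} {H : Hypothesis A} {w : SP A} (hσ : Reachable L σ)
      (hH : σ.hyp = some H) (hw : w ≠ SP.empty) (hd : ¬ SameVerdict L H w)
      (h : Runs L ([.handleCE w], σ) ([], σ')) : Reachable L σ'

/-- The pack `new` strictly refines the pack `old`: it still covers all pomsets classified by
`old`, it does not merge any two of them that `old` separates, and it has more components. -/
def StrictlyRefines {A : Type u} (new old : Finset (Finset (SP A))) : Prop :=
  (∀ B ∈ old, ∀ x ∈ B, ∃ B' ∈ new, x ∈ B') ∧
  (∀ B' ∈ new, ∀ x ∈ B', ∀ y ∈ B', ∀ B ∈ old, x ∈ B → (∃ B₂ ∈ old, y ∈ B₂) → y ∈ B) ∧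
  old.card < new.card

end PomsetLearning

end

/-! Everything rests on one finite bound. A context evaluates in the target recognizer through the
state of the pomset filled in (`Recognizer.eval_fill_congr`), and pomsets in distinct components are
separated by contexts of the discrimination tree. So a coherent store has at most as many components
as the target has states (`Coherent.card_comps_le`). A nested expansion opens a new component, a
refinement splits one, and a repeated consistency or associativity pass must have split one. Hence
all inner loops are finite.

The second ingredient is the invariant `Gen`: every access sequence and every classified pomset is
built from the empty pomset and the letters by compositions whose operands are access sequences.
Together with closure (`Full`) it shows that an induced hypothesis evaluates each classified pomset
to its own component (`IsInduced.mem_eval`), and so judges it correctly. Consequently the empty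
pomset is no counter-example, and agreement holds in the trivial context when the analysis starts.
The induced hypothesis exists once no consistency or associativity defect is left
(`Coherent.exists_isInduced`).

The analysis of a counter-example ends with a context c and a generated pomset p such that the
hypothesis errs on c[p] but is right on c[p'] for all access sequences p' of the state of p. As the
hypothesis identifies p and p', the language must distinguish c[p] from c[p']. Access sequences in
other components are separated from p by the tree. Thus p has a target state that no old access
sequence has. The set of target states met by access sequences grows in each round of the main loop,
which bounds the number of rounds even if a round does not increase the number of components.

The increase of the number of components is seen only at the end. The pool still contains c[p] and
c[p'] from the first round, and the final hypothesis is right on both. If p and p' shared a final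
component, that hypothesis would give them the same state, hence c[p] and c[p'] the same verdict, a
contradiction. They shared a component at the start and refinement never merges components, so the
final pack is larger (`Refines.card_lt`).

Executions are handled by the inductive predicate `Total`, a well-founded tree of all possible
choices, which yields termination, absence of stuck states and postconditions together. The value of
a pomset is defined through a chosen term, so freeness of series-parallel pomsets is proved as well
(`Val.decompose`, `Val.unique`). -/

noncomputable section

namespace PomsetLearning

/-! ### Algebra of pomsets -/

namespace LabPoset

variable {A : Type*}

/-- The labelled poset induced on a set of elements. -/
def restrict (P : LabPoset A) (s : Set P.carrier) : LabPoset A where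
  carrier := s
  finite := by have := P.finite; infer_instance
  lt x y := P.lt x y
  irrefl x := P.irrefl x
  trans x y z := P.trans x y z
  label x := P.label x

/-- The order relation between the operands of a composition. -/
def Related (P : LabPoset A) : Op → Set P.carrier → Set P.carrier → Prop
  | .seq, s, t => ∀ x ∈ s, ∀ y ∈ t, P.lt x y
  | .par, s, t => ∀ x ∈ s, ∀ y ∈ t, ¬ P.lt x y ∧ ¬ P.lt y x

theorem Related.mono {P : LabPoset A} {o : Op} {s s' t t' : Set P.carrier}
    (h : P.Related o s t) (hs : s' ⊆ s) (ht : t' ⊆ t) : P.Related o s' t' := by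
  cases o <;> exact fun x hx y hy => h x (hs hx) y (ht hy)

theorem not_lt_of_lt (P : LabPoset A) {x y : P.carrier} (h : P.lt x y) : ¬ P.lt y x :=
  fun k => P.irrefl _ (P.trans _ _ _ h k)

end LabPoset

/-! ### Decompositions as subsets of the carrier, bimonoid laws, Levi-type lemmas. -/

namespace Pomset

variable {A : Type*}

/-- The pomset of an induced labelled poset. -/
def restr (P : LabPoset A) (s : Set P.carrier) : Pomset A := mk (P.restrict s)

theorem mk_eq_mk {P Q : LabPoset A} : mk P = mk Q ↔ LabPoset.Iso P Q :=
  ⟨fun h => Quotient.exact h, fun h => Quotient.sound h⟩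

theorem exists_mk (w : Pomset A) : ∃ P, mk P = w := Quotient.exists_rep w

theorem restr_univ (P : LabPoset A) : restr P Set.univ = mk P :=
  mk_eq_mk.2 ⟨Equiv.Set.univ _, fun _ _ => Iff.rfl, fun _ => rfl⟩

theorem mk_eq_empty {P : LabPoset A} : mk P = empty ↔ IsEmpty P.carrier := by
  constructor
  · intro h
    obtain ⟨e, -, -⟩ := mk_eq_mk.1 h
    exact ⟨fun x => (e x).elim⟩
  · intro h
    exact mk_eq_mk.2 ⟨⟨fun x => (h.false x).elim, fun x => x.elim, fun x => (h.false x).elim,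
      fun x => x.elim⟩, fun x => (h.false x).elim, fun x => (h.false x).elim⟩

theorem restr_eq_empty {P : LabPoset A} {s : Set P.carrier} : restr P s = empty ↔ s = ∅ := by
  rw [restr, mk_eq_empty]
  exact Set.isEmpty_coe_sort

open Classical in
theorem restr_union {P : LabPoset A} {o : Op} {s t : Set P.carrier} (hd : Disjoint s t)
    (h : P.Related o s t) : restr P (s ∪ t) = comp o (restr P s) (restr P t) := by
  cases o
  · have hiso : LabPoset.Iso ((P.restrict s).seq (P.restrict t)) (P.restrict (s ∪ t)) := by
      refine ⟨(Equiv.Set.union hd).symm, ?_, ?_⟩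
      · rintro (⟨x, hx⟩ | ⟨x, hx⟩) (⟨y, hy⟩ | ⟨y, hy⟩)
        · exact (Sum.lex_inl_inl (r := (P.restrict s).lt) (s := (P.restrict t).lt) (a₁ := ⟨x, hx⟩)
            (a₂ := ⟨y, hy⟩)).symm
        · exact iff_of_true (h x hx y hy) (Sum.Lex.sep _ _)
        · exact iff_of_false (P.not_lt_of_lt (h y hy x hx)) Sum.lex_inr_inl
        · exact (Sum.lex_inr_inr (r := (P.restrict s).lt) (s := (P.restrict t).lt) (b₁ := ⟨x, hx⟩)
            (b₂ := ⟨y, hy⟩)).symm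
      · rintro (⟨x, hx⟩ | ⟨x, hx⟩) <;> rfl
    exact (mk_eq_mk.2 hiso).symm
  · have hiso : LabPoset.Iso ((P.restrict s).par (P.restrict t)) (P.restrict (s ∪ t)) := by
      refine ⟨(Equiv.Set.union hd).symm, ?_, ?_⟩
      · rintro (⟨x, hx⟩ | ⟨x, hx⟩) (⟨y, hy⟩ | ⟨y, hy⟩)
        · exact (Sum.liftRel_inl_inl (r := (P.restrict s).lt) (s := (P.restrict t).lt) (a := ⟨x, hx⟩)
            (c := ⟨y, hy⟩)).symm
        · exact iff_of_false (h x hx y hy).1 Sum.not_liftRel_inl_inr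
        · exact iff_of_false (h y hy x hx).2 Sum.not_liftRel_inr_inl
        · exact (Sum.liftRel_inr_inr (r := (P.restrict s).lt) (s := (P.restrict t).lt) (b := ⟨x, hx⟩)
            (d := ⟨y, hy⟩)).symm
      · rintro (⟨x, hx⟩ | ⟨x, hx⟩) <;> rfl
    exact (mk_eq_mk.2 hiso).symm

theorem restr_eq_of_iso {P Q : LabPoset A} {s : Set P.carrier} (e : Q.carrier → P.carrier)
    (he : Function.Injective e) (hs : Set.range e = s)
    (hlt : ∀ x y, P.lt (e x) (e y) ↔ Q.lt x y) (hl : ∀ x, P.label (e x) = Q.label x) :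
    restr P s = mk Q := by
  subst hs
  exact (mk_eq_mk.2 ⟨Equiv.ofInjective e he, hlt, hl⟩).symm

/-- This moves a decomposition into a fixed representative. Two decompositions of one pomset become
two subsets of the same carrier and can be compared by intersections and differences. -/
theorem exists_split {P : LabPoset A} {o : Op} {a b : Pomset A} (h : mk P = comp o a b) :
    ∃ s : Set P.carrier, restr P s = a ∧ restr P sᶜ = b ∧ P.Related o s sᶜ := by
  obtain ⟨Q, rfl⟩ := exists_mk a
  obtain ⟨R, rfl⟩ := exists_mk b
  have compl : ∀ {X : Type} (e : Q.carrier ⊕ R.carrier ≃ X),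
      Set.range (e ∘ Sum.inr) = (Set.range (e ∘ Sum.inl))ᶜ := by
    intro X e
    ext x
    obtain ⟨y | y, rfl⟩ := e.surjective x <;> simp
  cases o
  · obtain ⟨e, hlt, hl⟩ : LabPoset.Iso (Q.seq R) P := mk_eq_mk.1 h.symm
    refine ⟨Set.range (e ∘ Sum.inl), ?_, ?_, ?_⟩
    · exact restr_eq_of_iso _ (e.injective.comp Sum.inl_injective) rfl
        (fun x y => (hlt _ _).trans Sum.lex_inl_inl) fun x => hl _
    · exact restr_eq_of_iso _ (e.injective.comp Sum.inr_injective) (compl e)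
        (fun x y => (hlt _ _).trans Sum.lex_inr_inr) fun x => hl _
    · refine compl e ▸ ?_
      rintro _ ⟨x, rfl⟩ _ ⟨y, rfl⟩
      exact (hlt _ _).2 (Sum.Lex.sep _ _)
  · obtain ⟨e, hlt, hl⟩ : LabPoset.Iso (Q.par R) P := mk_eq_mk.1 h.symm
    refine ⟨Set.range (e ∘ Sum.inl), ?_, ?_, ?_⟩
    · exact restr_eq_of_iso _ (e.injective.comp Sum.inl_injective) rfl
        (fun x y => (hlt _ _).trans Sum.liftRel_inl_inl) fun x => hl _
    · exact restr_eq_of_iso _ (e.injective.comp Sum.inr_injective) (compl e)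
        (fun x y => (hlt _ _).trans Sum.liftRel_inr_inr) fun x => hl _
    · refine compl e ▸ ?_
      rintro _ ⟨x, rfl⟩ _ ⟨y, rfl⟩
      exact ⟨fun k => Sum.not_liftRel_inl_inr ((hlt _ _).1 k),
        fun k => Sum.not_liftRel_inr_inl ((hlt _ _).1 k)⟩

theorem comp_assoc (o : Op) (a b c : Pomset A) :
    comp o (comp o a b) c = comp o a (comp o b c) := by
  obtain ⟨P, rfl⟩ := exists_mk a
  obtain ⟨Q, rfl⟩ := exists_mk b
  obtain ⟨R, rfl⟩ := exists_mk c
  have hl : ∀ x : (P.carrier ⊕ Q.carrier) ⊕ R.carrier,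
      Sum.elim P.label (Sum.elim Q.label R.label) (Equiv.sumAssoc _ _ _ x) =
        Sum.elim (Sum.elim P.label Q.label) R.label x := by
    rintro ((x | x) | x) <;> rfl
  cases o
  · have hlt : ∀ x y : (P.carrier ⊕ Q.carrier) ⊕ R.carrier,
        Sum.Lex P.lt (Sum.Lex Q.lt R.lt) (Equiv.sumAssoc _ _ _ x) (Equiv.sumAssoc _ _ _ y) ↔
          Sum.Lex (Sum.Lex P.lt Q.lt) R.lt x y := by
      rintro ((x | x) | x) ((y | y) | y) <;> simp
    exact Quotient.sound ⟨Equiv.sumAssoc _ _ _, hlt, hl⟩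
  · have hlt : ∀ x y : (P.carrier ⊕ Q.carrier) ⊕ R.carrier,
        Sum.LiftRel P.lt (Sum.LiftRel Q.lt R.lt) (Equiv.sumAssoc _ _ _ x)
          (Equiv.sumAssoc _ _ _ y) ↔ Sum.LiftRel (Sum.LiftRel P.lt Q.lt) R.lt x y := by
      rintro ((x | x) | x) ((y | y) | y) <;> simp
    exact Quotient.sound ⟨Equiv.sumAssoc _ _ _, hlt, hl⟩

theorem comp_par_comm (a b : Pomset A) : comp .par a b = comp .par b a := by
  obtain ⟨P, rfl⟩ := exists_mk a
  obtain ⟨Q, rfl⟩ := exists_mk b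
  have hlt : ∀ x y : P.carrier ⊕ Q.carrier,
      Sum.LiftRel Q.lt P.lt (Equiv.sumComm _ _ x) (Equiv.sumComm _ _ y) ↔
        Sum.LiftRel P.lt Q.lt x y := by
    rintro (x | x) (y | y) <;> simp
  refine Quotient.sound ⟨Equiv.sumComm _ _, hlt, ?_⟩
  rintro (x | x) <;> rfl

theorem empty_comp (o : Op) (a : Pomset A) : comp o empty a = a := by
  obtain ⟨P, rfl⟩ := exists_mk a
  cases o
  · refine Quotient.sound ⟨Equiv.emptySum Empty _, ?_, ?_⟩
    · rintro (⟨⟨⟩⟩ | x) (⟨⟨⟩⟩ | y)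
      exact Sum.lex_inr_inr.symm
    · rintro (⟨⟨⟩⟩ | x); rfl
  · refine Quotient.sound ⟨Equiv.emptySum Empty _, ?_, ?_⟩
    · rintro (⟨⟨⟩⟩ | x) (⟨⟨⟩⟩ | y)
      exact Sum.liftRel_inr_inr.symm
    · rintro (⟨⟨⟩⟩ | x); rfl

theorem comp_empty (o : Op) (a : Pomset A) : comp o a empty = a := by
  obtain ⟨P, rfl⟩ := exists_mk a
  cases o
  · refine Quotient.sound ⟨Equiv.sumEmpty _ Empty, ?_, ?_⟩
    · rintro (x | ⟨⟨⟩⟩) (y | ⟨⟨⟩⟩)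
      exact Sum.lex_inl_inl.symm
    · rintro (x | ⟨⟨⟩⟩); rfl
  · refine Quotient.sound ⟨Equiv.sumEmpty _ Empty, ?_, ?_⟩
    · rintro (x | ⟨⟨⟩⟩) (y | ⟨⟨⟩⟩)
      exact Sum.liftRel_inl_inl.symm
    · rintro (x | ⟨⟨⟩⟩); rfl

/-- Levi's lemma for sequential composition. -/
theorem seq_eq_seq {a b c d : Pomset A} (h : comp .seq a b = comp .seq c d) :
    (∃ x, a = comp .seq c x ∧ d = comp .seq x b) ∨
      ∃ x, c = comp .seq a x ∧ b = comp .seq x d := by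
  obtain ⟨P, hP⟩ := exists_mk (comp .seq a b)
  obtain ⟨s, rfl, rfl, hs⟩ := exists_split hP
  obtain ⟨t, rfl, rfl, ht⟩ := exists_split (hP.trans h)
  have key : ∀ {s t : Set P.carrier}, P.Related .seq s sᶜ → P.Related .seq t tᶜ → s ⊆ t →
      ∃ x, restr P t = comp .seq (restr P s) x ∧ restr P sᶜ = comp .seq x (restr P tᶜ) := by
    intro s t hs ht hst
    refine ⟨restr P (t \ s), ?_, ?_⟩
    · rw [← restr_union Set.disjoint_sdiff_right (hs.mono subset_rfl fun x hx => hx.2),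
        Set.union_sdiff_cancel hst]
    · rw [← restr_union (disjoint_compl_right.mono_left Set.sdiff_subset)
        (ht.mono Set.sdiff_subset subset_rfl)]
      congr 1
      ext x
      by_cases hx : x ∈ t <;> simp [hx]
      exact fun h => hx (hst h)
  -- The two lower parts are nested: an element of s outside t and an element of t outside s would
  -- each be below the other.
  by_cases hst : s ⊆ t
  · exact .inr (key hs ht hst)
  · refine .inl (key ht hs fun x hx => ?_)
    obtain ⟨y, hy, hyt⟩ := Set.not_subset.1 hst
    by_contra hxs
    exact P.not_lt_of_lt (hs y hy x hxs) (ht x hx y hyt)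

/-- Refinement of two parallel decompositions. -/
theorem par_eq_par {a b c d : Pomset A} (h : comp .par a b = comp .par c d) :
    ∃ w x y z, a = comp .par w x ∧ b = comp .par y z ∧ c = comp .par w y ∧
      d = comp .par x z := by
  obtain ⟨P, hP⟩ := exists_mk (comp .par a b)
  obtain ⟨s, rfl, rfl, hs⟩ := exists_split hP
  obtain ⟨t, rfl, rfl, ht⟩ := exists_split (hP.trans h)
  have key : ∀ (s t : Set P.carrier), P.Related .par t tᶜ →
      restr P s = comp .par (restr P (s ∩ t)) (restr P (s ∩ tᶜ)) := by
    intro s t ht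
    rw [← restr_union (Set.disjoint_left.2 fun x hx hx' => hx'.2 hx.2)
      (ht.mono Set.inter_subset_right Set.inter_subset_right), Set.inter_union_compl]
  -- The common refinement consists of the four cells cut out by the two subsets.
  refine ⟨restr P (s ∩ t), restr P (s ∩ tᶜ), restr P (sᶜ ∩ t), restr P (sᶜ ∩ tᶜ),
    key _ _ ht, key _ _ ht, ?_, ?_⟩
  · rw [key t s hs, Set.inter_comm t s, Set.inter_comm t]
  · rw [key tᶜ s hs, Set.inter_comm _ s, Set.inter_comm tᶜ]

/-- Comparable elements lie on the same side of a parallel splitting. If both sequential factors are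
non-empty, any two elements are linked by comparabilities through the other factor, so everything
lies on one side. -/
theorem seq_eq_par {a b c d : Pomset A} (h : comp .seq a b = comp .par c d) :
    a = empty ∨ b = empty ∨ c = empty ∨ d = empty := by
  obtain ⟨P, hP⟩ := exists_mk (comp .seq a b)
  obtain ⟨s, rfl, rfl, hs⟩ := exists_split hP
  obtain ⟨t, rfl, rfl, ht⟩ := exists_split (hP.trans h)
  simp only [restr_eq_empty]
  by_contra! hne
  obtain ⟨⟨x, hx⟩, ⟨y, hy⟩, ⟨u, hu⟩, ⟨v, hv⟩⟩ := hne
  have hsep : ∀ p ∈ s, ∀ q ∈ sᶜ, (p ∈ t ↔ q ∈ t) := by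
    intro p hp q hq
    have hpq := hs p hp q hq
    refine ⟨fun h => ?_, fun h => ?_⟩
    · by_contra k
      exact (ht p h q k).1 hpq
    · by_contra k
      exact (ht q h p k).2 hpq
  have hall : ∀ p, p ∈ t ↔ x ∈ t := by
    intro p
    by_cases hp : p ∈ s
    · rw [hsep p hp y hy, hsep x hx y hy]
    · exact (hsep x hx p hp).symm
  exact hv ((hall v).2 ((hall u).1 hu))

theorem comp_eq_empty {o : Op} {a b : Pomset A} (h : comp o a b = empty) :
    a = empty ∧ b = empty := by
  obtain ⟨s, rfl, rfl, -⟩ := exists_split (P := LabPoset.empty) h.symm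
  have : ∀ s : Set (LabPoset.empty : LabPoset A).carrier, s = ∅ :=
    fun s => Set.eq_empty_iff_forall_notMem.2 fun x => x.elim
  exact ⟨restr_eq_empty.2 (this _), restr_eq_empty.2 (this _)⟩

theorem comp_eq_single {o : Op} {a b : Pomset A} {l : A} (h : comp o a b = single l) :
    (a = empty ∧ b = single l) ∨ (a = single l ∧ b = empty) := by
  obtain ⟨s, rfl, rfl, -⟩ := exists_split (P := LabPoset.single l) h.symm
  by_cases hs : () ∈ s
  · have : s = Set.univ := Set.eq_univ_of_forall fun _ => hs
    subst this
    exact .inr ⟨restr_univ _, restr_eq_empty.2 Set.compl_univ⟩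
  · have : s = ∅ := Set.eq_empty_of_forall_notMem fun _ => hs
    subst this
    exact .inl ⟨restr_eq_empty.2 rfl, by rw [Set.compl_empty]; exact restr_univ _⟩

/-- The number of elements. -/
def size (w : Pomset A) : ℕ :=
  Quotient.lift (fun P : LabPoset A => Nat.card P.carrier)
    (fun P Q (h : LabPoset.Iso P Q) => Nat.card_congr h.choose) w

theorem size_comp (o : Op) (a b : Pomset A) : (comp o a b).size = a.size + b.size := by
  obtain ⟨P, rfl⟩ := exists_mk a
  obtain ⟨Q, rfl⟩ := exists_mk b
  have := P.finite
  have := Q.finite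
  cases o <;> exact Nat.card_sum

theorem size_pos {w : Pomset A} (h : w ≠ empty) : 0 < w.size := by
  obtain ⟨P, rfl⟩ := exists_mk w
  have := P.finite
  rw [Ne, mk_eq_empty, not_isEmpty_iff] at h
  exact Nat.card_pos

theorem single_ne_empty (a : A) : single a ≠ empty :=
  fun h => (mk_eq_empty.1 h).false ()

/-! ### Substitution -/

/-- Restricting to series-parallel pomsets allows an induction along the construction instead of an
explicit isomorphism of nested dependent sums. -/
theorem subst_subst {B C : Type*} {c : Pomset A} (hc : c.IsSP) (f : A → Pomset B)
    (g : B → Pomset C) : (c.subst f).subst g = c.subst fun a => (f a).subst g := by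
  induction hc with
  | empty => simp only [subst_empty]
  | single a => simp only [subst_single]
  | comp o _ _ hx hy => simp only [subst_comp, hx, hy]

theorem subst_single_self {c : Pomset A} (hc : c.IsSP) : c.subst single = c := by
  induction hc with
  | empty => simp only [subst_empty]
  | single a => simp only [subst_single]
  | comp o _ _ hx hy => simp only [subst_comp, hx, hy]

end Pomset

/-! ### Bimonoid laws for series-parallel pomsets. -/

namespace SP

variable {A : Type*}

theorem comp_assoc (o : Op) (a b c : SP A) : comp o (comp o a b) c = comp o a (comp o b c) :=
  Subtype.ext (Pomset.comp_assoc _ _ _ _)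

theorem comp_par_comm (a b : SP A) : comp .par a b = comp .par b a :=
  Subtype.ext (Pomset.comp_par_comm _ _)

theorem empty_comp (o : Op) (a : SP A) : comp o empty a = a :=
  Subtype.ext (Pomset.empty_comp _ _)

theorem comp_empty (o : Op) (a : SP A) : comp o a empty = a :=
  Subtype.ext (Pomset.comp_empty _ _)

end SP

/-! ### Filling and composing contexts. -/

namespace Ctx

variable {A : Type*}

theorem fill_hole (w : SP A) : hole.fill w = w := Subtype.ext (Pomset.subst_single _ _)

theorem fill_plug (c c' : Ctx A) (w : SP A) : (c.plug c').fill w = c.fill (c'.fill w) := by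
  refine Subtype.ext ((Pomset.subst_subst c.2.1 _ _).trans ?_)
  refine congrArg c.1.subst (funext fun l => ?_)
  cases l with
  | none => rfl
  | some a => exact Pomset.subst_single _ _

theorem subst_letters_fill (z : SP A) (w : Pomset A) :
    ((z.1.subst fun a => Pomset.single (some a)).subst
      fun l => l.elim w Pomset.single : Pomset A) = z.1 := by
  rw [Pomset.subst_subst z.2]
  simp only [Pomset.subst_single, Option.elim]
  exact Pomset.subst_single_self z.2

theorem fill_holeLeft (o : Op) (z w : SP A) : (holeLeft o z).fill w = SP.comp o w z := by
  refine Subtype.ext ((Pomset.subst_comp _ _ _ _).trans ?_)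
  rw [subst_letters_fill]
  exact congrArg (Pomset.comp o · z.1) (Pomset.subst_single _ _)

theorem fill_holeRight (o : Op) (z w : SP A) : (holeRight o z).fill w = SP.comp o z w := by
  refine Subtype.ext ((Pomset.subst_comp _ _ _ _).trans ?_)
  rw [subst_letters_fill]
  exact congrArg (Pomset.comp o z.1) (Pomset.subst_single _ _)

end Ctx

/-! ### Recognizers are evaluated homomorphically -/

namespace Recognizer

variable {A M : Type*}

/-- `R.Val w m`: some term of `w` has the value `m`. -/
inductive Val (R : Recognizer A M) : Pomset A → M → Prop
  | empty : Val R Pomset.empty R.one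
  | single (a : A) : Val R (Pomset.single a) (R.init a)
  | comp (o : Op) {x y : Pomset A} {m n : M} :
      Val R x m → Val R y n → Val R (Pomset.comp o x y) (R.op o m n)

variable {R : Recognizer A M}

theorem Val.eq_one {w : Pomset A} {m : M} (h : R.Val w m) (hw : w = Pomset.empty) :
    m = R.one := by
  induction h with
  | empty => rfl
  | single a => exact (Pomset.single_ne_empty a hw).elim
  | comp o _ _ hx hy =>
    obtain ⟨h₁, h₂⟩ := Pomset.comp_eq_empty hw
    rw [hx h₁, hy h₂, R.one_op]

theorem Val.eq_init {w : Pomset A} {m : M} (h : R.Val w m) {a : A} (hw : w = Pomset.single a) :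
    m = R.init a := by
  induction h with
  | empty => exact (Pomset.single_ne_empty a hw.symm).elim
  | single b =>
    obtain ⟨e, -, hl⟩ := Pomset.mk_eq_mk.1 hw
    rw [show b = a from (hl ()).symm]
  | comp o hx hy ihx ihy =>
    obtain ⟨h₁, h₂⟩ | ⟨h₁, h₂⟩ := Pomset.comp_eq_single hw
    · rw [hx.eq_one h₁, R.one_op]
      exact ihy h₂
    · rw [hy.eq_one h₂, R.op_one]
      exact ihx h₁

theorem op_par_op_par (R : Recognizer A M) (w x y z : M) :
    R.op .par (R.op .par w x) (R.op .par y z) = R.op .par (R.op .par w y) (R.op .par x z) := by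
  rw [R.op_assoc, ← R.op_assoc _ x, R.par_comm x y, R.op_assoc, ← R.op_assoc]

/-- This is the core of freeness: a value computed along one term can be recomputed along any other
decomposition. Equal operators are handled by Levi's lemma with associativity, or by the four-cell
refinement with commutativity. Different operators force an empty operand. -/
theorem Val.decompose {w : Pomset A} {m : M} (h : R.Val w m) :
    ∀ {o : Op} {x y : Pomset A}, w = Pomset.comp o x y →
      ∃ k n, R.Val x k ∧ R.Val y n ∧ m = R.op o k n := by
  induction h with
  | empty =>
    intro o x y hw
    obtain ⟨rfl, rfl⟩ := Pomset.comp_eq_empty hw.symm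
    exact ⟨_, _, .empty, .empty, (R.one_op _ _).symm⟩
  | single a =>
    intro o x y hw
    obtain ⟨rfl, rfl⟩ | ⟨rfl, rfl⟩ := Pomset.comp_eq_single hw.symm
    · exact ⟨_, _, .empty, .single a, (R.one_op _ _).symm⟩
    · exact ⟨_, _, .single a, .empty, (R.op_one _ _).symm⟩
  | @comp o u v m n hu hv ihu ihv =>
    -- An empty operand on the side of the term reduces to the induction hypothesis; an empty
    -- operand on the other side makes the decomposition trivial.
    have mixed : ∀ {o' : Op} {x y : Pomset A}, Pomset.comp o u v = Pomset.comp o' x y →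
        u = Pomset.empty ∨ v = Pomset.empty ∨ x = Pomset.empty ∨ y = Pomset.empty →
        ∃ k l, R.Val x k ∧ R.Val y l ∧ R.op o m n = R.op o' k l := by
      rintro o' x y hw (rfl | rfl | rfl | rfl)
      · rw [hu.eq_one rfl, R.one_op]
        exact ihv (by rw [← hw, Pomset.empty_comp])
      · rw [hv.eq_one rfl, R.op_one]
        exact ihu (by rw [← hw, Pomset.comp_empty])
      · rw [Pomset.empty_comp] at hw
        exact ⟨_, _, .empty, hw ▸ .comp o hu hv, (R.one_op _ _).symm⟩
      · rw [Pomset.comp_empty] at hw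
        exact ⟨_, _, hw ▸ .comp o hu hv, .empty, (R.op_one _ _).symm⟩
    intro o' x y hw
    match o, o', hw with
    | .seq, .par, hw => exact mixed hw (Pomset.seq_eq_par hw)
    | .par, .seq, hw =>
      refine mixed hw ?_
      have := Pomset.seq_eq_par hw.symm
      tauto
    | .seq, .seq, hw =>
      obtain ⟨z, rfl, rfl⟩ | ⟨z, rfl, rfl⟩ := Pomset.seq_eq_seq hw
      · obtain ⟨k, l, hk, hl, rfl⟩ := ihu rfl
        exact ⟨k, _, hk, .comp _ hl hv, R.op_assoc _ _ _ _⟩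
      · obtain ⟨k, l, hk, hl, rfl⟩ := ihv rfl
        exact ⟨_, l, .comp _ hu hk, hl, (R.op_assoc _ _ _ _).symm⟩
    | .par, .par, hw =>
      obtain ⟨a, b, c, d, rfl, rfl, rfl, rfl⟩ := Pomset.par_eq_par hw
      obtain ⟨k, l, hk, hl, rfl⟩ := ihu rfl
      obtain ⟨k', l', hk', hl', rfl⟩ := ihv rfl
      exact ⟨_, _, .comp _ hk hk', .comp _ hl hl', R.op_par_op_par _ _ _ _⟩

theorem Val.unique {w : Pomset A} {m n : M} (hm : R.Val w m) (hn : R.Val w n) : m = n := by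
  induction hn generalizing m with
  | empty => exact hm.eq_one rfl
  | single a => exact hm.eq_init rfl
  | comp o _ _ hx hy =>
    obtain ⟨k, l, hk, hl, rfl⟩ := hm.decompose rfl
    rw [hx hk, hy hl]

theorem val_termValue (R : Recognizer A M) (t : Term A) : R.Val t.toSP.1 (R.termValue t) := by
  induction t with
  | empty => exact .empty
  | letter a => exact .single a
  | node o l r hl hr => exact .comp o hl hr

theorem val_eval (R : Recognizer A M) (w : SP A) : R.Val w.1 (R.eval w) := by
  have h := R.val_termValue w.exists_term.choose
  rwa [w.exists_term.choose_spec] at h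

theorem eval_empty (R : Recognizer A M) : R.eval SP.empty = R.one :=
  (R.val_eval _).unique .empty

theorem eval_single (R : Recognizer A M) (a : A) : R.eval (SP.single a) = R.init a :=
  (R.val_eval _).unique (.single a)

theorem eval_comp (R : Recognizer A M) (o : Op) (x y : SP A) :
    R.eval (SP.comp o x y) = R.op o (R.eval x) (R.eval y) :=
  (R.val_eval _).unique (.comp o (R.val_eval x) (R.val_eval y))

/-- The recognizer that interprets the hole by the state `m`. -/
def withHole (R : Recognizer A M) (m : M) : Recognizer (Option A) M :=
  { R with init := fun l => l.elim m R.init }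

theorem Val.fill {m n : M} {c : Pomset (Option A)} (h : (R.withHole m).Val c n) {w : Pomset A}
    (hw : R.Val w m) : R.Val (c.subst fun l => l.elim w Pomset.single) n := by
  induction h with
  | empty => rw [Pomset.subst_empty]; exact .empty
  | single l =>
    rw [Pomset.subst_single]
    cases l with
    | none => exact hw
    | some a => exact .single a
  | comp o _ _ hx hy => rw [Pomset.subst_comp]; exact .comp o hx hy

theorem eval_fill (R : Recognizer A M) (c : Ctx A) (w : SP A) :
    R.eval (c.fill w) = (R.withHole (R.eval w)).eval ⟨c.1, c.2.1⟩ :=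
  (R.val_eval _).unique
    (((R.withHole (R.eval w)).val_eval ⟨c.1, c.2.1⟩).fill (R.val_eval w))

/-- Pomsets with equal states are indistinguishable by contexts. Applied to the target this bounds
the data of the learner; applied to a hypothesis it turns errors into separating contexts. -/
theorem eval_fill_congr (R : Recognizer A M) (c : Ctx A) {w w' : SP A}
    (h : R.eval w = R.eval w') : R.eval (c.fill w) = R.eval (c.fill w') := by
  rw [eval_fill, eval_fill, h]

end Recognizer

/-! ### Canonical terms -/

namespace Term

variable {A : Type*}

theorem EmptyFree.toSP_ne_empty {t : Term A} (h : t.EmptyFree) : t.toSP ≠ SP.empty := by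
  induction t with
  | empty => exact h.elim
  | letter a => exact fun k => Pomset.single_ne_empty a (congrArg Subtype.val k)
  | node o l r hl _ =>
    exact fun k => hl h.1 (Subtype.ext (Pomset.comp_eq_empty (congrArg Subtype.val k)).1)

/-- Pruning neutral leaves replaces a node by one of its subtrees, so the depth does not increase
and minimal depth is compatible with having no empty leaf. -/
theorem exists_emptyFree (t : Term A) :
    ∃ t' : Term A, t'.toSP = t.toSP ∧ t'.depth ≤ t.depth ∧ (t' = .empty ∨ t'.EmptyFree) := by
  induction t with
  | empty => exact ⟨.empty, rfl, le_rfl, .inl rfl⟩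
  | letter a => exact ⟨.letter a, rfl, le_rfl, .inr trivial⟩
  | node o l r hl hr =>
    obtain ⟨l', hl, hld, rfl | hl'⟩ := hl
    · obtain ⟨r', hr, hrd, hr'⟩ := hr
      refine ⟨r', ?_, ?_, hr'⟩
      · rw [toSP, ← hl, ← hr]
        exact (SP.empty_comp _ _).symm
      · rw [depth]; omega
    · obtain ⟨r', hr, hrd, rfl | hr'⟩ := hr
      · refine ⟨l', ?_, ?_, .inr hl'⟩
        · rw [toSP, ← hl, ← hr]
          exact (SP.comp_empty _ _).symm
        · rw [depth]; omega
      · refine ⟨.node o l' r', by rw [toSP, toSP, hl, hr], ?_, .inr ⟨hl', hr'⟩⟩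
        rw [depth, depth]; omega

theorem exists_isCanonical (w : SP A) : ∃ t : Term A, t.IsCanonical w := by
  classical
  have hex : ∃ n, ∃ t : Term A, t.toSP = w ∧ t.depth = n :=
    w.exists_term.elim fun t ht => ⟨_, t, ht, rfl⟩
  obtain ⟨t, ht, htd⟩ := Nat.find_spec hex
  obtain ⟨t', ht', htd', he⟩ := t.exists_emptyFree
  refine ⟨t', ht'.trans ht, fun u hu => ?_, fun hw => ?_⟩
  · have := Nat.find_min' hex ⟨u, hu, rfl⟩
    omega
  · refine he.resolve_left ?_
    rintro rfl
    exact hw (ht.symm.trans ht'.symm)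

end Term

variable {A : Type*}

theorem exists_isCanonicalDecomp {z : SP A} (hz : z ≠ SP.empty) (hl : ∀ a, z ≠ SP.single a) :
    ∃ o z₁ z₂, IsCanonicalDecomp z o z₁ z₂ := by
  obtain ⟨t, ht⟩ := Term.exists_isCanonical z
  cases t with
  | empty => exact (ht.2.2 hz).elim
  | letter a => exact (hl a ht.1.symm).elim
  | node o l r => exact ⟨o, _, _, l, r, ht, rfl, rfl⟩

theorem IsCanonicalDecomp.eq_comp {z z₁ z₂ : SP A} {o : Op} (h : IsCanonicalDecomp z o z₁ z₂) :
    z = SP.comp o z₁ z₂ := by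
  obtain ⟨t₁, t₂, ht, rfl, rfl⟩ := h
  exact ht.1.symm

theorem IsCanonicalDecomp.ne_empty {z z₁ z₂ : SP A} {o : Op} (h : IsCanonicalDecomp z o z₁ z₂)
    (hz : z ≠ SP.empty) : z₁ ≠ SP.empty ∧ z₂ ≠ SP.empty := by
  obtain ⟨t₁, t₂, ht, rfl, rfl⟩ := h
  obtain ⟨h₁, h₂⟩ := ht.2.2 hz
  exact ⟨h₁.toSP_ne_empty, h₂.toSP_ne_empty⟩

/-- Number of elements is the termination measure of the counter-example analysis; it drops because
both factors are non-empty. -/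
theorem IsCanonicalDecomp.size_lt {z z₁ z₂ : SP A} {o : Op} (h : IsCanonicalDecomp z o z₁ z₂)
    (hz : z ≠ SP.empty) : z₁.1.size < z.1.size ∧ z₂.1.size < z.1.size := by
  have h₁ := Pomset.size_pos fun k => (h.ne_empty hz).1 (Subtype.ext k)
  have h₂ := Pomset.size_pos fun k => (h.ne_empty hz).2 (Subtype.ext k)
  have : z.1.size = z₁.1.size + z₂.1.size := by
    rw [h.eq_comp]; exact Pomset.size_comp _ _ _
  omega

/-! ### Discrimination trees -/

namespace DTree

variable {A : Type*} {L : Set (SP A)}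

theorem sift_congr {D : DTree A} {x y : SP A}
    (h : ∀ c ∈ D.contexts, (c.fill x ∈ L ↔ c.fill y ∈ L)) : D.sift L x = D.sift L y := by
  induction D with
  | leaf B => rfl
  | node c l r hl hr =>
    have hc := h c (.inl (.inl rfl))
    rw [sift, sift, hl fun c' hc' => h c' (.inl (.inr hc')), hr fun c' hc' => h c' (.inr hc')]
    by_cases hx : c.fill x ∈ L
    · rw [if_pos hx, if_pos (hc.1 hx)]
    · rw [if_neg hx, if_neg (hx ∘ hc.2)]

theorem exists_context_of_sift_ne {D : DTree A} {x y : SP A} (h : D.sift L x ≠ D.sift L y) :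
    ∃ c ∈ D.contexts, ¬ (c.fill x ∈ L ↔ c.fill y ∈ L) := by
  contrapose! h
  exact sift_congr h

open Classical in
theorem sift_replaceLeaf (D T : DTree A) (B : Finset (SP A)) (x : SP A) :
    (D.replaceLeaf B T).sift L x = if D.sift L x = some B then T.sift L x else D.sift L x := by
  induction D with
  | leaf b => rw [replaceLeaf, sift]; split_ifs <;> rfl
  | node c l r hl hr =>
    rw [replaceLeaf, sift, sift, hl, hr]
    by_cases hx : c.fill x ∈ L <;> simp only [hx, if_true, if_false]

theorem contexts_replaceLeaf_leaf (D : DTree A) (B : Finset (SP A)) (b : Option (Finset (SP A))) :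
    (D.replaceLeaf B (.leaf b)).contexts = D.contexts := by
  induction D with
  | leaf b => rw [replaceLeaf]; split_ifs <;> rfl
  | node c l r hl hr => rw [replaceLeaf, contexts, contexts, hl, hr]

theorem sift_labelLeaf_self (D : DTree A) (p : SP A) (B : Finset (SP A)) :
    (D.labelLeaf L p B).sift L p = some B := by
  induction D with
  | leaf b => rfl
  | node c l r hl hr =>
    rw [labelLeaf]
    split_ifs with h
    · rw [sift, if_pos h, hr]
    · rw [sift, if_neg h, hl]

/-- Labelling the leaf reached by `p` either does not affect `x`, or `x` reaches the same leaf. -/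
theorem sift_labelLeaf (D : DTree A) (p : SP A) (B : Finset (SP A)) (x : SP A) :
    (D.labelLeaf L p B).sift L x = D.sift L x ∨
      ((D.labelLeaf L p B).sift L x = some B ∧ D.sift L x = D.sift L p ∧
        ∀ c l r, D = .node c l r → (c.fill x ∈ L ↔ c.fill p ∈ L)) := by
  induction D with
  | leaf b => exact .inr ⟨rfl, rfl, fun _ _ _ h => by cases h⟩
  | node c l r hl hr =>
    rw [labelLeaf]
    by_cases hp : c.fill p ∈ L <;> by_cases hx : c.fill x ∈ L <;>
      simp only [hp, hx, sift, if_true, if_false, true_or]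
    · refine hr.imp_right fun h => ⟨h.1, h.2.1, ?_⟩
      rintro _ _ _ ⟨⟩
      exact iff_of_true hx hp
    · refine hl.imp_right fun h => ⟨h.1, h.2.1, ?_⟩
      rintro _ _ _ ⟨⟩
      exact iff_of_false hx hp

theorem contexts_labelLeaf (D : DTree A) (p : SP A) (B : Finset (SP A)) :
    (D.labelLeaf L p B).contexts = D.contexts := by
  induction D with
  | leaf b => rfl
  | node c l r hl hr =>
    rw [labelLeaf]
    split_ifs
    · rw [contexts, contexts, hr]
    · rw [contexts, contexts, hl]

end DTree

/-! ### Refinement of packs -/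

/-- `new` covers all pomsets covered by `old` and does not merge components of `old`. -/
def Refines {A : Type*} (new old : Finset (Finset (SP A))) : Prop :=
  (∀ B ∈ old, ∀ x ∈ B, ∃ B' ∈ new, x ∈ B') ∧
  (∀ B' ∈ new, ∀ x ∈ B', ∀ y ∈ B', ∀ B ∈ old, x ∈ B → (∃ B₂ ∈ old, y ∈ B₂) → y ∈ B)

namespace Refines

variable {A : Type*} {P Q R : Finset (Finset (SP A))}

theorem trans (h : Refines P Q) (k : Refines Q R) : Refines P R := by
  refine ⟨fun B hB x hx => ?_, fun B' hB' x hx y hy B hB hxB hyB => ?_⟩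
  · obtain ⟨C, hC, hxC⟩ := k.1 B hB x hx
    exact h.1 C hC x hxC
  · obtain ⟨C, hC, hxC⟩ := k.1 B hB x hxB
    obtain ⟨B₂, hB₂, hyB₂⟩ := hyB
    exact k.2 C hC x hxC y (h.2 B' hB' x hx y hy C hC hxC (k.1 B₂ hB₂ y hyB₂)) B hB hxB
      ⟨B₂, hB₂, hyB₂⟩

/-- Each old component is sent to a new one that contains its representative. Two old components
with the same image would have been merged. -/
theorem exists_injOn (h : Refines P Q)
    (hd : ∀ B ∈ Q, ∀ C ∈ Q, ∀ x, x ∈ B → x ∈ C → B = C)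
    (rep : Finset (SP A) → SP A) (hrep : ∀ B ∈ Q, rep B ∈ B) :
    ∃ f : Finset (SP A) → Finset (SP A), (∀ B ∈ Q, f B ∈ P ∧ rep B ∈ f B) ∧
      Set.InjOn f Q := by
  have : ∀ B, ∃ B', B ∈ Q → B' ∈ P ∧ rep B ∈ B' := by
    intro B
    by_cases hB : B ∈ Q
    · obtain ⟨B', hB', hx⟩ := h.1 B hB _ (hrep B hB)
      exact ⟨B', fun _ => ⟨hB', hx⟩⟩
    · exact ⟨∅, fun h => (hB h).elim⟩
  choose f hf using this
  refine ⟨f, hf, fun B hB C hC hBC => ?_⟩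
  have hC' := hf C hC
  rw [← hBC] at hC'
  exact hd B hB C hC (rep C)
    (h.2 _ (hf B hB).1 _ (hf B hB).2 _ hC'.2 B hB (hrep B hB) ⟨C, hC, hrep C hC⟩) (hrep C hC)

theorem card_lt (h : Refines P Q) (hne : ∀ B ∈ Q, B.Nonempty)
    (hd : ∀ B ∈ Q, ∀ C ∈ Q, ∀ x, x ∈ B → x ∈ C → B = C) {D : Finset (SP A)} (hD : D ∈ Q)
    {p q : SP A} (hp : p ∈ D) (hq : q ∈ D) (hpq : ∀ B ∈ P, p ∈ B → q ∉ B) :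
    Q.card < P.card := by
  classical
  -- The representative of D is forced to be p, so that the new component of q is missed by the
  -- injection: it could only be the image of D, but it does not contain p.
  have : ∀ B, ∃ x, B ∈ Q → x ∈ B ∧ (B = D → x = p) := by
    intro B
    by_cases hB : B ∈ Q
    · by_cases hBD : B = D
      · exact ⟨p, fun _ => ⟨hBD ▸ hp, fun _ => rfl⟩⟩
      · exact (hne B hB).elim fun x hx => ⟨x, fun _ => ⟨hx, fun h => (hBD h).elim⟩⟩
    · exact ⟨p, fun h => (hB h).elim⟩
  choose rep hrep using this
  obtain ⟨f, hf, hinj⟩ := h.exists_injOn hd rep fun B hB => (hrep B hB).1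
  obtain ⟨E, hE, hqE⟩ := h.1 D hD q hq
  rw [← Finset.card_image_of_injOn hinj]
  refine Finset.card_lt_card (Finset.ssubset_iff.2 ⟨E, ?_, ?_⟩)
  · rw [Finset.mem_image]
    rintro ⟨B, hB, rfl⟩
    have hBD := h.2 _ hE q hqE _ (hf B hB).2 D hD hq ⟨B, hB, (hrep B hB).1⟩
    have := (hrep B hB).2 (hd B hB D hD _ (hrep B hB).1 hBD)
    exact hpq _ hE (this ▸ (hf B hB).2) hqE
  · refine Finset.insert_subset hE fun B' hB' => ?_
    obtain ⟨B, hB, rfl⟩ := Finset.mem_image.1 hB'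
    exact (hf B hB).1

end Refines

/-! ### Invariants of the learner -/

/-- The pomsets that can be built from the empty one and the letters by compositions whose operands
lie in `S`. -/
inductive Gen {A : Type*} (S : Finset (SP A)) : SP A → Prop
  | empty : Gen S SP.empty
  | single (a : A) : Gen S (SP.single a)
  | comp (o : Op) {x y : SP A} : x ∈ S → y ∈ S → Gen S x → Gen S y → Gen S (SP.comp o x y)

theorem Gen.mono {A : Type*} {S T : Finset (SP A)} (h : S ⊆ T) {x : SP A} (hx : Gen S x) :
    Gen T x := by
  induction hx with
  | empty => exact .empty
  | single a => exact .single a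
  | comp o h₁ h₂ _ _ k₁ k₂ => exact .comp o (h h₁) (h h₂) k₁ k₂

namespace Store

variable {A : Type*}

/-- The pomset `x` lies in a component. -/
def Classified (σ : Store A) (x : SP A) : Prop := ∃ B ∈ σ.comps, x ∈ B

/-- The pack of components is the set of classes of the discrimination tree, restricted to finitely
many members, and all pomsets are generated from the access sequences. -/
structure Coherent (L : Set (SP A)) (σ : Store A) : Prop where
  nonempty : ∀ B ∈ σ.comps, B.Nonempty
  sift_of_mem : ∀ B ∈ σ.comps, ∀ x ∈ B, σ.tree.sift L x = some B
  mem_of_sift : ∀ x B, σ.tree.sift L x = some B → B ∈ σ.comps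
  root : ∃ l r, σ.tree = .node Ctx.hole l r
  verdict : ∀ x y B, σ.tree.sift L x = some B → σ.tree.sift L y = some B → (x ∈ L ↔ y ∈ L)
  gen_S : ∀ s ∈ σ.S, Gen σ.S s
  gen_comps : ∀ B ∈ σ.comps, ∀ x ∈ B, Gen σ.S x

/-- The pomset `s` and its compositions with access sequences are classified. -/
def ClosedAt (σ : Store A) (s : SP A) : Prop :=
  σ.Classified s ∧
    ∀ s' ∈ σ.S, ∀ o, σ.Classified (SP.comp o s s') ∧ σ.Classified (SP.comp o s' s)

/-- Everything needed to define the operations of a hypothesis is classified. -/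
structure Full (σ : Store A) : Prop where
  closedAt : ∀ s ∈ σ.S, σ.ClosedAt s
  single : ∀ a, σ.Classified (SP.single a)
  empty_mem : SP.empty ∈ σ.S
  access : ∀ B ∈ σ.comps, ∃ s, σ.IsAccess B s

/-- The two stores differ at most in the access sequences, the components and the tree. -/
def Frame (σ σ' : Store A) : Prop :=
  σ'.hyp = σ.hyp ∧ σ'.ce = σ.ce ∧ σ'.found = σ.found ∧
    σ'.alreadyConsistent = σ.alreadyConsistent ∧ σ'.alreadyAssoc = σ.alreadyAssoc

theorem Frame.trans {σ σ' σ'' : Store A} (h : σ.Frame σ') (k : σ'.Frame σ'') : σ.Frame σ'' :=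
  ⟨k.1.trans h.1, k.2.1.trans h.2.1, k.2.2.1.trans h.2.2.1, k.2.2.2.1.trans h.2.2.2.1,
    k.2.2.2.2.trans h.2.2.2.2⟩

/-- The store `σ'` arises from `σ` by classifying pomsets, where new access sequences are closed
under composition and new components have access sequences. -/
structure Grow (σ σ' : Store A) : Prop where
  frame : σ.Frame σ'
  subset : σ.S ⊆ σ'.S
  enlarge : ∀ B ∈ σ.comps, ∃ B' ∈ σ'.comps, B ⊆ B'
  access : ∀ B' ∈ σ'.comps, (∃ B ∈ σ.comps, B ⊆ B') ∨ ∃ s, σ'.IsAccess B' s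
  closedAt : ∀ s ∈ σ'.S, s ∉ σ.S → σ'.ClosedAt s
  contexts : σ'.tree.contexts = σ.tree.contexts
  refines : Refines σ'.comps σ.comps

namespace Coherent

variable {L : Set (SP A)} {σ : Store A}

theorem eq_of_mem (h : σ.Coherent L) {B C : Finset (SP A)} (hB : B ∈ σ.comps)
    (hC : C ∈ σ.comps) {x : SP A} (hxB : x ∈ B) (hxC : x ∈ C) : B = C :=
  Option.some_injective _ ((h.sift_of_mem B hB x hxB).symm.trans (h.sift_of_mem C hC x hxC))

theorem disjoint (h : σ.Coherent L) :
    ∀ B ∈ σ.comps, ∀ C ∈ σ.comps, ∀ x, x ∈ B → x ∈ C → B = C :=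
  fun _ hB _ hC _ hxB hxC => h.eq_of_mem hB hC hxB hxC

theorem refines_refl (h : σ.Coherent L) : Refines σ.comps σ.comps :=
  ⟨fun B hB _ hx => ⟨B, hB, hx⟩,
    fun _ hB' _ hx _ hy _ hB hxB _ => h.eq_of_mem hB' hB hx hxB ▸ hy⟩

/-- This keeps a budget counted in components valid after any intermediate run that refines the
pack. -/
theorem card_le (h : σ.Coherent L) {P : Finset (Finset (SP A))} (k : Refines P σ.comps) :
    σ.comps.card ≤ P.card := by
  have : ∀ B, ∃ x, B ∈ σ.comps → x ∈ B := by
    intro B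
    by_cases hB : B ∈ σ.comps
    · exact (h.nonempty B hB).elim fun x hx => ⟨x, fun _ => hx⟩
    · exact ⟨SP.empty, fun h => (hB h).elim⟩
  choose rep hrep using this
  obtain ⟨f, hf, hinj⟩ := k.exists_injOn h.disjoint rep hrep
  exact Finset.card_le_card_of_injOn f (fun B hB => (hf B hB).1) hinj

theorem grow_refl (h : σ.Coherent L) : σ.Grow σ where
  frame := ⟨rfl, rfl, rfl, rfl, rfl⟩
  subset := subset_rfl
  enlarge B hB := ⟨B, hB, subset_rfl⟩
  access B hB := .inl ⟨B, hB, subset_rfl⟩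
  closedAt _ hs hs' := (hs' hs).elim
  contexts := rfl
  refines := h.refines_refl

/-- Pomsets in distinct components are separated by a context. -/
theorem card_comps_le {M : Type*} [Finite M] {Mod : Recognizer A M}
    (h : σ.Coherent {w | Mod.Accepts w}) : σ.comps.card ≤ Nat.card M := by
  have : ∀ B, ∃ x, B ∈ σ.comps → x ∈ B := by
    intro B
    by_cases hB : B ∈ σ.comps
    · exact (h.nonempty B hB).elim fun x hx => ⟨x, fun _ => hx⟩
    · exact ⟨SP.empty, fun h => (hB h).elim⟩
  choose rep hrep using this
  rw [← Fintype.card_coe, ← Nat.card_eq_fintype_card]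
  -- Representatives with the same target state pass every test of the tree alike, hence reach the
  -- same label.
  refine Nat.card_le_card_of_injective (fun B : σ.comps => Mod.eval (rep B.1)) fun B C hBC => ?_
  refine Subtype.ext (Option.some_injective _ ?_)
  rw [← h.sift_of_mem B.1 B.2 _ (hrep _ B.2), ← h.sift_of_mem C.1 C.2 _ (hrep _ C.2)]
  refine DTree.sift_congr fun c _ => ?_
  change Mod.eval _ ∈ Mod.final ↔ Mod.eval _ ∈ Mod.final
  rw [Mod.eval_fill_congr c hBC]

end Coherent

theorem Classified.mono {σ σ' : Store A} (h : Refines σ'.comps σ.comps) {x : SP A}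
    (hx : σ.Classified x) : σ'.Classified x := hx.elim fun B hB => h.1 B hB.1 x hB.2

theorem Grow.trans {σ σ' σ'' : Store A} (h : σ.Grow σ') (k : σ'.Grow σ'') : σ.Grow σ'' where
  frame := h.frame.trans k.frame
  subset := h.subset.trans k.subset
  enlarge B hB := by
    obtain ⟨B', hB', hBB'⟩ := h.enlarge B hB
    obtain ⟨B'', hB'', hBB''⟩ := k.enlarge B' hB'
    exact ⟨B'', hB'', hBB'.trans hBB''⟩
  access B'' hB'' := by
    obtain ⟨B', hB', hBB'⟩ | hs := k.access B'' hB''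
    · obtain ⟨B, hB, hBB⟩ | ⟨s, hs, hs'⟩ := h.access B' hB'
      · exact .inl ⟨B, hB, hBB.trans hBB'⟩
      · exact .inr ⟨s, hBB' hs, k.subset hs'⟩
    · exact .inr hs
  closedAt s hs hs' := by
    by_cases hsσ : s ∈ σ'.S
    · have hc := h.closedAt s hsσ hs'
      refine ⟨hc.1.mono k.refines, fun t ht o => ?_⟩
      by_cases htσ : t ∈ σ'.S
      · exact ⟨(hc.2 t htσ o).1.mono k.refines, (hc.2 t htσ o).2.mono k.refines⟩
      -- For an older and a newer access sequence, closure comes from the newer one, with the two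
      -- orders of the operands exchanged.
      · exact ((k.closedAt t ht htσ).2 s hs o).symm
    · exact k.closedAt s hs hsσ
  contexts := k.contexts.trans h.contexts
  refines := k.refines.trans h.refines

/-- Old components are only enlarged and keep their access sequences, while new ones bring their
own. Mixed compositions are covered by the closure of the new access sequence. -/
theorem Grow.full {σ σ' : Store A} (h : σ.Grow σ') (hσ : σ.Full) : σ'.Full where
  closedAt s hs := by
    by_cases hsσ : s ∈ σ.S
    · have hc := hσ.closedAt s hsσ
      refine ⟨hc.1.mono h.refines, fun t ht o => ?_⟩
      by_cases htσ : t ∈ σ.S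
      · exact ⟨(hc.2 t htσ o).1.mono h.refines, (hc.2 t htσ o).2.mono h.refines⟩
      · exact ((h.closedAt t ht htσ).2 s hs o).symm
    · exact h.closedAt s hs hsσ
  single a := (hσ.single a).mono h.refines
  empty_mem := h.subset hσ.empty_mem
  access B' hB' := by
    obtain ⟨B, hB, hBB⟩ | hs := h.access B' hB'
    · obtain ⟨s, hs, hs'⟩ := hσ.access B hB
      exact ⟨s, hBB hs, h.subset hs'⟩
    · exact hs

end Store

/-! ### Total correctness -/

/-- Every execution of the instructions from the store is finite, is never stuck, and ends in a
store with the property `Q`. -/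
inductive Total {A : Type*} [Fintype A] (L : Set (SP A)) (Q : Store A → Prop) :
    List (Instr A) → Store A → Prop
  | done {σ : Store A} : Q σ → Total L Q [] σ
  | step {i : Instr A} {k : List (Instr A)} {σ : Store A} :
      (∃ k' σ', Step L i σ k' σ') → (∀ k' σ', Step L i σ k' σ' → Total L Q (k' ++ k) σ') →
      Total L Q (i :: k) σ

namespace Total

variable {A : Type*} [Fintype A] {L : Set (SP A)} {P Q : Store A → Prop}

/-- Sequencing rule: it permits proofs about single procedures to be chained through their
postconditions. -/
theorem append {k k' : List (Instr A)} {σ : Store A} (h : Total L P k σ)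
    (hQ : ∀ σ', P σ' → Total L Q k' σ') : Total L Q (k ++ k') σ := by
  induction h with
  | done hP => exact hQ _ hP
  | step hex _ ih =>
    refine .step hex fun k₁ σ₁ hs => ?_
    have := ih k₁ σ₁ hs
    rw [List.append_assoc] at this
    exact this

theorem cons {i : Instr A} {k : List (Instr A)} {σ : Store A} (h : Total L P [i] σ)
    (hQ : ∀ σ', P σ' → Total L Q k σ') : Total L Q (i :: k) σ := h.append hQ

theorem mono {k : List (Instr A)} {σ : Store A} (h : Total L P k σ) (hPQ : ∀ σ', P σ' → Q σ') :
    Total L Q k σ := by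
  have := h.append (k' := []) fun σ' hσ' => .done (hPQ σ' hσ')
  rwa [List.append_nil] at this

/-- A single instruction, all of whose steps are correct. -/
theorem single {i : Instr A} {σ : Store A} (hex : ∃ k' σ', Step L i σ k' σ')
    (h : ∀ k' σ', Step L i σ k' σ' → Total L Q k' σ') : Total L Q [i] σ :=
  .step hex fun k' σ' hs => by rw [List.append_nil]; exact h k' σ' hs

theorem next {C C' : List (Instr A) × Store A} (h : Total L Q C.1 C.2) (hn : Next L C C') :
    Total L Q C'.1 C'.2 := by
  obtain ⟨hs, rest⟩ := hn
  cases h with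
  | step _ h => exact h _ _ hs

theorem runs {C C' : List (Instr A) × Store A} (h : Total L Q C.1 C.2) (hr : Runs L C C') :
    Total L Q C'.1 C'.2 := by
  induction hr with
  | refl => exact h
  | tail _ hn ih => exact ih.next hn

theorem post {k : List (Instr A)} {σ σ' : Store A} (h : Total L Q k σ)
    (hr : Runs L (k, σ) ([], σ')) : Q σ' := by
  have h' : Total L Q [] σ' := h.runs (C := (k, σ)) (C' := ([], σ')) hr
  cases h' with
  | done hQ => exact hQ

/-- An infinite run would be an infinite branch in a well-founded tree: by induction on `Total`, no
configuration with this property occurs on such a run. Progress holds because `Total` passes to all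
reachable configurations. -/
theorem alwaysTerminates {k : List (Instr A)} {σ : Store A} (h : Total L Q k σ) :
    AlwaysTerminates L (k, σ) := by
  constructor
  · rintro ⟨f, h0, hf⟩
    have key : ∀ {k : List (Instr A)} {σ : Store A}, Total L Q k σ → ∀ n, f n ≠ (k, σ) := by
      intro k σ h
      induction h with
      | done hQ =>
        intro n hn
        have := hf n
        rw [hn] at this
        cases this
      | step _ _ ih =>
        intro n hn
        have := hf n
        rw [hn] at this
        generalize hC : f (n + 1) = C at this
        cases this with
        | mk hs => exact ih _ _ hs (n + 1) hC
    exact key h 0 h0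
  · rintro ⟨k', σ'⟩ hr
    have h' : Total L Q k' σ' := h.runs (C := (k, σ)) (C' := (k', σ')) hr
    cases h' with
    | done => exact .inl rfl
    | step hex _ =>
      obtain ⟨_, _, hs⟩ := hex
      exact .inr ⟨_, .mk hs _⟩

end Total

/-! ### Expansion -/

section Expand

open Store
open scoped Classical

variable {A : Type*} {L : Set (SP A)}

/-- The enlarged component contains a pomset that was unclassified, so its label is fresh and cannot
collide with that of another leaf. Neither access sequences nor the number of components change. -/
theorem Store.Coherent.enlarge_component {σ : Store A} (h : σ.Coherent L) {p : SP A}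
    {B : Finset (SP A)} (hp : ∀ B' ∈ σ.comps, p ∉ B') (hB : σ.tree.sift L p = some B)
    (hg : Gen σ.S p) {σ' : Store A}
    (hσ' : σ' = { σ with
      comps := insert (insert p B) (σ.comps.erase B)
      tree := σ.tree.replaceLeaf B (.leaf (some (insert p B))) }) :
    σ'.Coherent L ∧ σ.Grow σ' ∧ σ'.S.card + σ.comps.card ≤ σ.S.card + σ'.comps.card ∧
      σ'.Classified p := by
  have hBc : B ∈ σ.comps := h.mem_of_sift p B hB
  have hnew : insert p B ∉ σ.comps := fun k => hp _ k (Finset.mem_insert_self p B)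
  have hcomps : ∀ C, C ∈ σ'.comps ↔ C = insert p B ∨ (C ≠ B ∧ C ∈ σ.comps) := by
    intro C; rw [hσ']; simp only [Finset.mem_insert, Finset.mem_erase]
  have hsift : ∀ x, σ'.tree.sift L x =
      if σ.tree.sift L x = some B then some (insert p B) else σ.tree.sift L x := by
    intro x; rw [hσ']; exact DTree.sift_replaceLeaf _ _ _ _
  have hS : σ'.S = σ.S := by rw [hσ']
  have hback : ∀ x C, σ'.tree.sift L x = some C →
      (C = insert p B ∧ σ.tree.sift L x = some B) ∨ (C ≠ B ∧ σ.tree.sift L x = some C) := by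
    intro x C hx
    rw [hsift] at hx
    split_ifs at hx with hxB
    · exact .inl ⟨(Option.some_injective _ hx).symm, hxB⟩
    · exact .inr ⟨fun k => hxB (k ▸ hx), hx⟩
  refine ⟨⟨?_, ?_, ?_, ?_, ?_, ?_, ?_⟩, ⟨?_, ?_, ?_, ?_, ?_, ?_, ?_⟩, ?_, ?_⟩
  · intro C hC
    obtain rfl | hC := (hcomps C).1 hC
    · exact Finset.insert_nonempty _ _
    · exact h.nonempty C hC.2
  · intro C hC x hx
    rw [hsift]
    obtain rfl | hC := (hcomps C).1 hC
    · refine if_pos ?_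
      obtain rfl | hx := Finset.mem_insert.1 hx
      · exact hB
      · exact h.sift_of_mem B hBc x hx
    · rw [h.sift_of_mem C hC.2 x hx, if_neg fun k => hC.1 (Option.some_injective _ k)]
  · intro x C hx
    obtain ⟨rfl, -⟩ | ⟨hCB, hx⟩ := hback x C hx
    · exact (hcomps _).2 (.inl rfl)
    · exact (hcomps _).2 (.inr ⟨hCB, h.mem_of_sift x C hx⟩)
  · obtain ⟨l, r, hlr⟩ := h.root
    exact ⟨_, _, by rw [hσ', hlr]; rfl⟩
  · intro x y C hx hy
    obtain ⟨hC, hx'⟩ | ⟨-, hx'⟩ := hback x C hx <;> obtain ⟨hC', hy'⟩ | ⟨-, hy'⟩ := hback y C hy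
    · exact h.verdict x y B hx' hy'
    · exact (hnew (hC ▸ h.mem_of_sift _ _ hy')).elim
    · exact (hnew (hC' ▸ h.mem_of_sift _ _ hx')).elim
    · exact h.verdict x y C hx' hy'
  · rw [hS]; exact h.gen_S
  · intro C hC x hx
    rw [hS]
    obtain rfl | hC := (hcomps C).1 hC
    · obtain rfl | hx := Finset.mem_insert.1 hx
      · exact hg
      · exact h.gen_comps B hBc x hx
    · exact h.gen_comps C hC.2 x hx
  · rw [hσ']; exact ⟨rfl, rfl, rfl, rfl, rfl⟩
  · rw [hS]
  · intro C hC
    by_cases hCB : C = B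
    · exact ⟨_, (hcomps _).2 (.inl rfl), hCB ▸ Finset.subset_insert _ _⟩
    · exact ⟨C, (hcomps _).2 (.inr ⟨hCB, hC⟩), subset_rfl⟩
  · intro C hC
    obtain rfl | hC := (hcomps C).1 hC
    · exact .inl ⟨B, hBc, Finset.subset_insert _ _⟩
    · exact .inl ⟨C, hC.2, subset_rfl⟩
  · intro s hs hs'
    exact (hs' (hS ▸ hs)).elim
  · rw [hσ']; exact DTree.contexts_replaceLeaf_leaf _ _ _
  · refine ⟨fun C hC x hx => ?_, fun C hC x hx y hy D hD hxD hyD => ?_⟩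
    · by_cases hCB : C = B
      · exact ⟨_, (hcomps _).2 (.inl rfl), Finset.mem_insert_of_mem (hCB ▸ hx)⟩
      · exact ⟨C, (hcomps _).2 (.inr ⟨hCB, hC⟩), hx⟩
    · obtain rfl | hC := (hcomps C).1 hC
      · obtain rfl | hx := Finset.mem_insert.1 hx
        · exact (hp D hD hxD).elim
        · obtain rfl | hy := Finset.mem_insert.1 hy
          · exact (hyD.elim fun E hE => hp E hE.1 hE.2).elim
          · exact h.eq_of_mem hBc hD hx hxD ▸ hy
      · exact h.eq_of_mem hC.2 hD hx hxD ▸ hy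
  · have : σ'.comps.card = σ.comps.card := by
      rw [hσ']
      change (insert (insert p B) (σ.comps.erase B)).card = _
      rw [Finset.card_insert_of_notMem fun k => hnew (Finset.mem_of_mem_erase k),
        Finset.card_erase_add_one hBc]
    rw [hS, this]
  · exact ⟨_, (hcomps _).2 (.inl rfl), Finset.mem_insert_self _ _⟩

theorem Store.Coherent.new_component {σ : Store A} (h : σ.Coherent L) {p : SP A}
    (hp : ∀ B' ∈ σ.comps, p ∉ B') (hn : σ.tree.sift L p = none)
    (hg : Gen σ.S p) {σ' : Store A}
    (hσ' : σ' = { σ with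
      comps := insert {p} σ.comps
      tree := σ.tree.labelLeaf L p {p} }) :
    σ'.Coherent L ∧ Refines σ'.comps σ.comps ∧ σ'.comps.card = σ.comps.card + 1 := by
  have hnew : {p} ∉ σ.comps := fun k => hp _ k (Finset.mem_singleton_self p)
  have hcomps : ∀ C, C ∈ σ'.comps ↔ C = {p} ∨ C ∈ σ.comps := by
    intro C; rw [hσ']; simp only [Finset.mem_insert]
  have hsift : ∀ x, σ'.tree.sift L x = σ.tree.sift L x ∨
      (σ'.tree.sift L x = some {p} ∧ σ.tree.sift L x = none ∧ (x ∈ L ↔ p ∈ L)) := by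
    intro x
    rw [hσ']
    refine (DTree.sift_labelLeaf σ.tree p {p} x).imp_right fun hx => ⟨hx.1, hx.2.1.trans hn, ?_⟩
    -- The root tests membership in the language itself, so a pomset that reaches the newly labelled
    -- leaf has the verdict of p.
    obtain ⟨l, r, hlr⟩ := h.root
    have := hx.2.2 _ _ _ hlr
    rwa [Ctx.fill_hole, Ctx.fill_hole] at this
  have hS : σ'.S = σ.S := by rw [hσ']
  refine ⟨⟨?_, ?_, ?_, ?_, ?_, ?_, ?_⟩, ⟨?_, ?_⟩, ?_⟩
  · intro C hC
    obtain rfl | hC := (hcomps C).1 hC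
    · exact Finset.singleton_nonempty _
    · exact h.nonempty C hC
  · intro C hC x hx
    obtain rfl | hC := (hcomps C).1 hC
    · obtain rfl := Finset.mem_singleton.1 hx
      rw [hσ']
      exact DTree.sift_labelLeaf_self _ _ _
    · obtain hs | hs := hsift x
      · rw [hs, h.sift_of_mem C hC x hx]
      · rw [h.sift_of_mem C hC x hx] at hs
        exact (Option.some_ne_none _ hs.2.1).elim
  · intro x C hx
    obtain hs | hs := hsift x
    · exact (hcomps C).2 (.inr (h.mem_of_sift x C (hs ▸ hx)))
    · exact (hcomps C).2 (.inl (Option.some_injective _ (hx.symm.trans hs.1)))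
  · obtain ⟨l, r, hlr⟩ := h.root
    rw [hσ', hlr]
    change ∃ l' r', (DTree.node Ctx.hole l r).labelLeaf L p {p} = _
    rw [DTree.labelLeaf]
    split_ifs
    exacts [⟨_, _, rfl⟩, ⟨_, _, rfl⟩]
  · intro x y C hx hy
    obtain hs | hs := hsift x <;> obtain ht | ht := hsift y
    · exact h.verdict x y C (hs ▸ hx) (ht ▸ hy)
    · refine (hnew (h.mem_of_sift x _ ?_)).elim
      rw [← hs, hx, ← hy, ht.1]
    · refine (hnew (h.mem_of_sift y _ ?_)).elim
      rw [← ht, hy, ← hx, hs.1]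
    · exact hs.2.2.trans ht.2.2.symm
  · rw [hS]; exact h.gen_S
  · intro C hC x hx
    rw [hS]
    obtain rfl | hC := (hcomps C).1 hC
    · obtain rfl := Finset.mem_singleton.1 hx
      exact hg
    · exact h.gen_comps C hC x hx
  · exact fun C hC x hx => ⟨C, (hcomps C).2 (.inr hC), hx⟩
  · intro C hC x hx y hy D hD hxD _
    obtain rfl | hC := (hcomps C).1 hC
    · obtain rfl := Finset.mem_singleton.1 hx
      exact (hp D hD hxD).elim
    · exact h.eq_of_mem hC hD hx hxD ▸ hy
  · rw [hσ']
    exact Finset.card_insert_of_notMem hnew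

/-- What is achieved by expanding `w`. -/
def ExpandPost (L : Set (SP A)) (σ : Store A) (w : SP A) (σ' : Store A) : Prop :=
  σ'.Coherent L ∧ Grow { σ with S := insert w σ.S } σ' ∧
    σ'.S.card + σ.comps.card ≤ (insert w σ.S).card + σ'.comps.card ∧
    σ'.ClosedAt w ∧ ∀ a, σ'.Classified (SP.single a)

theorem ExpandPost.mem {σ σ' : Store A} {w : SP A} (h : ExpandPost L σ w σ') : w ∈ σ'.S :=
  h.2.1.subset (Finset.mem_insert_self _ _)

theorem ExpandPost.closedAt {σ σ' : Store A} {w : SP A} (h : ExpandPost L σ w σ') :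
    ∀ s ∈ σ'.S, s ∉ σ.S → σ'.ClosedAt s := by
  intro s hs hs'
  by_cases hsw : s = w
  · exact hsw ▸ h.2.2.2.1
  · exact h.2.1.closedAt s hs fun k => (Finset.mem_insert.1 k).elim hsw hs'

theorem ExpandPost.grow {σ σ' : Store A} {w : SP A} (h : ExpandPost L σ w σ') : σ.Grow σ' :=
  ⟨h.2.1.frame, (Finset.subset_insert _ _).trans h.2.1.subset, h.2.1.enlarge, h.2.1.access,
    h.closedAt, h.2.1.contexts, h.2.1.refines⟩

/-- What is achieved by visiting `p`. -/
def VisitPost (L : Set (SP A)) (σ : Store A) (p : SP A) (σ' : Store A) : Prop :=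
  σ'.Coherent L ∧ σ.Grow σ' ∧ σ'.S.card + σ.comps.card ≤ σ.S.card + σ'.comps.card ∧
    σ'.Classified p

variable [Fintype A]

/-- Expansion within a budget for the number of components. -/
def ExpandTotal (L : Set (SP A)) (N n : ℕ) : Prop :=
  ∀ (σ : Store A) (w : SP A), σ.Coherent L → Gen σ.S w → N < n + σ.comps.card →
    Total L (ExpandPost L σ w) [.expand w] σ

variable {N : ℕ}

theorem visit_total {n : ℕ} (ih : ExpandTotal L N n) {σ : Store A} {p : SP A}
    (h : σ.Coherent L) (hg : Gen σ.S p) (hN : N < n + 1 + σ.comps.card) :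
    Total L (VisitPost L σ p) [.visit p] σ := by
  refine .single ?_ ?_
  · by_cases hp : ∃ B ∈ σ.comps, p ∈ B
    · exact ⟨_, _, .visit_classified p σ hp⟩
    · push Not at hp
      cases hs : σ.tree.sift L p with
      | none => exact ⟨_, _, .visit_unlabelled p σ hp hs⟩
      | some B => exact ⟨_, _, .visit_labelled p σ B hp hs⟩
  · intro k' σ₁ hs
    cases hs with
    | visit_classified _ _ hp => exact .done ⟨h, h.grow_refl, le_rfl, hp⟩
    | visit_labelled _ _ B hp hB => exact .done (h.enlarge_component hp hB hg rfl)
    | visit_unlabelled _ _ hp hn =>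
      obtain ⟨h₁, hr, hcard⟩ := h.new_component hp hn hg rfl
      -- The component just created pays for the unit of budget lost by the nested expansion.
      refine (ih _ p h₁ hg (by rw [hcard]; omega)).mono fun σ' hσ' => ?_
      obtain ⟨h', hG, h₂, hcl, hl⟩ := id hσ'
      refine ⟨h', ⟨hG.frame, (Finset.subset_insert _ _).trans hG.subset, ?_, ?_, hσ'.closedAt, ?_,
        hG.refines.trans hr⟩, ?_, hcl.1⟩
      · exact fun B hB => hG.enlarge B (Finset.mem_insert_of_mem hB)
      · intro B' hB'
        obtain ⟨B, hB, hBB⟩ | hs := hG.access B' hB'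
        · obtain rfl | hB := Finset.mem_insert.1 hB
          · exact .inr ⟨p, hBB (Finset.mem_singleton_self p), hσ'.mem⟩
          · exact .inl ⟨B, hB, hBB⟩
        · exact .inr hs
      · exact hG.contexts.trans (DTree.contexts_labelLeaf _ _ _)
      · have h₃ := Finset.card_insert_le p σ.S
        simp only at h₂ hcard
        omega

/-- Inner induction on the number of pomsets left to visit. The budget n stays fixed, since visits
never decrease the number of components. -/
theorem visitAll_total {n : ℕ} (ih : ExpandTotal L N n) (m : ℕ) :
    ∀ {σ : Store A} {X : Finset (SP A)}, X.card = m → σ.Coherent L → (∀ p ∈ X, Gen σ.S p) →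
    N < n + 1 + σ.comps.card →
    Total L (fun σ' => σ'.Coherent L ∧ σ.Grow σ' ∧
      σ'.S.card + σ.comps.card ≤ σ.S.card + σ'.comps.card ∧ ∀ p ∈ X, σ'.Classified p)
      [.visitAll X] σ := by
  induction m with
  | zero =>
    intro σ X hX h _ _
    obtain rfl := Finset.card_eq_zero.1 hX
    refine .single ⟨_, _, .visitAll_nil σ⟩ fun k' σ₁ hs => ?_
    cases hs with
    | visitAll_nil => exact .done ⟨h, h.grow_refl, le_rfl, fun p hp => by simp at hp⟩
    | visitAll_cons _ _ p hp => simp at hp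
  | succ m ihm =>
    intro σ X hX h hg hN
    obtain ⟨q, hq⟩ : X.Nonempty := Finset.card_pos.1 (by omega)
    refine .single ⟨_, _, .visitAll_cons X σ q hq⟩ fun k' σ₁ hs => ?_
    cases hs with
    | visitAll_nil => simp at hq
    | visitAll_cons _ _ p hp =>
      refine (visit_total ih h (hg p hp) hN).cons fun σ' ⟨h', hG', hc', hp'⟩ => ?_
      have hle := h.card_le hG'.refines
      refine (ihm (by rw [Finset.card_erase_of_mem hp]; omega) h'
        (fun r hr => (hg r (Finset.mem_of_mem_erase hr)).mono hG'.subset) (by omega)).mono ?_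
      intro σ'' ⟨h'', hG'', hc'', hX''⟩
      refine ⟨h'', hG'.trans hG'', by omega, fun r hr => ?_⟩
      by_cases hrp : r = p
      · exact hrp ▸ hp'.mono hG''.refines
      · exact hX'' r (Finset.mem_erase.2 ⟨hrp, hr⟩)

/-- Induction on the budget: n bounds the depth of nested expansions. With n = 0 the assumption
would give more than N components. -/
theorem expandTotal (hN : ∀ σ : Store A, σ.Coherent L → σ.comps.card ≤ N) (n : ℕ) :
    ExpandTotal L N n := by
  induction n with
  | zero =>
    intro σ w h _ hlt
    have := hN σ h
    omega
  | succ n ih =>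
    intro σ w h hg hlt
    refine .single ⟨_, _, .expand w σ⟩ fun k' σ₁ hs => ?_
    cases hs with
    | expand =>
      have hsub := Finset.subset_insert w σ.S
      have h₁ : Coherent L { σ with S := insert w σ.S } :=
        ⟨h.nonempty, h.sift_of_mem, h.mem_of_sift, h.root, h.verdict,
          fun s hs => (Finset.mem_insert.1 hs).elim (fun k => k ▸ hg.mono hsub)
            fun k => (h.gen_S s k).mono hsub,
          fun B hB x hx => (h.gen_comps B hB x hx).mono hsub⟩
      have hw : w ∈ insert w σ.S := Finset.mem_insert_self _ _
      refine (visit_total ih h₁ (hg.mono hsub) hlt).cons fun τ ⟨hτ, hGτ, hcτ, hwτ⟩ => ?_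
      have hle : σ.comps.card ≤ τ.comps.card := h₁.card_le hGτ.refines
      refine (visitAll_total ih _ rfl hτ ?_ (by omega)).mono fun σ' ⟨h', hG, hc, hX⟩ => ?_
      · intro p hp
        refine Gen.mono hGτ.subset ?_
        change Gen (insert w σ.S) p
        simp only [Finset.mem_union, Finset.mem_image, Finset.mem_univ, true_and] at hp
        have hgen : ∀ s ∈ insert w σ.S, Gen (insert w σ.S) s := h₁.gen_S
        obtain (((⟨s, hs, rfl⟩ | ⟨s, hs, rfl⟩) | ⟨s, hs, rfl⟩) | ⟨s, hs, rfl⟩) | ⟨a, rfl⟩ := hp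
        · exact .comp _ hs hw (hgen s hs) (hgen w hw)
        · exact .comp _ hw hs (hgen w hw) (hgen s hs)
        · exact .comp _ hs hw (hgen s hs) (hgen w hw)
        · exact .comp _ hw hs (hgen w hw) (hgen s hs)
        · exact .single a
      · have hG' := hGτ.trans hG
        refine ⟨h', hG', ?_, ⟨hwτ.mono hG.refines, fun s hs o => ?_⟩, fun a => hX _ ?_⟩
        · simp only at hcτ
          omega
        · by_cases hsσ : s ∈ insert w σ.S
          · cases o
            · refine ⟨hX _ ?_, hX _ ?_⟩ <;>
                simp only [Finset.mem_union, Finset.mem_image]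
              · exact .inl (.inl (.inl (.inr ⟨s, hsσ, rfl⟩)))
              · exact .inl (.inl (.inl (.inl ⟨s, hsσ, rfl⟩)))
            · refine ⟨hX _ ?_, hX _ ?_⟩ <;>
                simp only [Finset.mem_union, Finset.mem_image]
              · exact .inl (.inr ⟨s, hsσ, rfl⟩)
              · exact .inl (.inl (.inr ⟨s, hsσ, rfl⟩))
          · exact ((hG'.closedAt s hs hsσ).2 w (hG'.subset hw) o).symm
        · simp only [Finset.mem_union, Finset.mem_image, Finset.mem_univ, true_and]
          exact .inr ⟨a, rfl⟩

theorem expand_total (hN : ∀ σ : Store A, σ.Coherent L → σ.comps.card ≤ N) {σ : Store A}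
    {w : SP A} (h : σ.Coherent L) (hg : Gen σ.S w) :
    Total L (ExpandPost L σ w) [.expand w] σ :=
  expandTotal hN (N + 1) σ w h hg (by omega)

end Expand

/-! ### Refinement, consistency and associativity -/

section Refine

open Store
open scoped Classical

variable {A : Type*} {L : Set (SP A)}

theorem Store.Coherent.congr {σ σ' : Store A} (h : σ.Coherent L) (hS : σ'.S = σ.S)
    (hc : σ'.comps = σ.comps) (ht : σ'.tree = σ.tree) : σ'.Coherent L := by
  cases σ; cases σ'
  subst hS hc ht
  exact ⟨h.nonempty, h.sift_of_mem, h.mem_of_sift, h.root, h.verdict, h.gen_S, h.gen_comps⟩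

theorem Store.Full.congr {σ σ' : Store A} (h : σ.Full) (hS : σ'.S = σ.S)
    (hc : σ'.comps = σ.comps) : σ'.Full := by
  cases σ; cases σ'
  subst hS hc
  exact ⟨h.closedAt, h.single, h.empty_mem, h.access⟩

/-- The two witnesses make both halves non-empty. The halves differ from each other and from the
remaining old components, so exactly one component is gained. -/
theorem Store.Coherent.split_component {σ : Store A} (h : σ.Coherent L) {B : Finset (SP A)}
    (hB : B ∈ σ.comps) {c : Ctx A} {z₁ z₂ : SP A} (h₁ : z₁ ∈ B) (h₂ : z₂ ∈ B)
    (hc : ¬ (c.fill z₁ ∈ L ↔ c.fill z₂ ∈ L)) {σ' : Store A}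
    (hσ' : σ' = { σ with
      comps := (σ.comps.erase B) ∪
        {B.filter fun w => c.fill w ∉ L, B.filter fun w => c.fill w ∈ L}
      tree := σ.tree.replaceLeaf B
        (.node c (.leaf (some (B.filter fun w => c.fill w ∉ L)))
          (.leaf (some (B.filter fun w => c.fill w ∈ L)))) }) :
    σ'.Coherent L ∧ Refines σ'.comps σ.comps ∧ σ.comps.card < σ'.comps.card := by
  set B₀ := B.filter fun w => c.fill w ∉ L with hB₀
  set B₁ := B.filter fun w => c.fill w ∈ L with hB₁
  have hne₀ : B₀.Nonempty := by
    by_cases k : c.fill z₁ ∈ L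
    · exact ⟨z₂, Finset.mem_filter.2 ⟨h₂, fun k' => hc (iff_of_true k k')⟩⟩
    · exact ⟨z₁, Finset.mem_filter.2 ⟨h₁, k⟩⟩
  have hne₁ : B₁.Nonempty := by
    by_cases k : c.fill z₁ ∈ L
    · exact ⟨z₁, Finset.mem_filter.2 ⟨h₁, k⟩⟩
    · exact ⟨z₂, Finset.mem_filter.2 ⟨h₂, by_contra fun k' => hc (iff_of_false k k')⟩⟩
  have hsub₀ : B₀ ⊆ B := Finset.filter_subset _ _
  have hsub₁ : B₁ ⊆ B := Finset.filter_subset _ _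
  have hcomps : ∀ C, C ∈ σ'.comps ↔ (C ≠ B ∧ C ∈ σ.comps) ∨ C = B₀ ∨ C = B₁ := by
    intro C
    rw [hσ']
    simp only [Finset.mem_union, Finset.mem_erase, Finset.mem_insert, Finset.mem_singleton]
  have hS : σ'.S = σ.S := by rw [hσ']
  have hsift : ∀ x, σ'.tree.sift L x =
      if σ.tree.sift L x = some B then (if c.fill x ∈ L then some B₁ else some B₀)
      else σ.tree.sift L x := by
    intro x; rw [hσ']; exact DTree.sift_replaceLeaf _ _ _ _
  -- a part of `B` is not an old component different from `B`
  have hpart : ∀ C : Finset (SP A), C.Nonempty → C ⊆ B → C ∈ σ.comps → C = B := by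
    rintro C ⟨x, hx⟩ hCB hC
    exact h.eq_of_mem hC hB hx (hCB hx)
  have hback : ∀ x C, σ'.tree.sift L x = some C → (C ≠ B ∧ σ.tree.sift L x = some C) ∨
      (C.Nonempty ∧ C ⊆ B ∧ (C = B₀ ∨ C = B₁) ∧ σ.tree.sift L x = some B) := by
    intro x C hx
    rw [hsift] at hx
    split_ifs at hx with hxB hxL
    · obtain rfl := Option.some_injective _ hx
      exact .inr ⟨hne₁, hsub₁, .inr rfl, hxB⟩
    · obtain rfl := Option.some_injective _ hx
      exact .inr ⟨hne₀, hsub₀, .inl rfl, hxB⟩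
    · exact .inl ⟨fun k => hxB (k ▸ hx), hx⟩
  refine ⟨⟨?_, ?_, ?_, ?_, ?_, ?_, ?_⟩, ⟨?_, ?_⟩, ?_⟩
  · intro C hC
    obtain hC | rfl | rfl := (hcomps C).1 hC
    exacts [h.nonempty C hC.2, hne₀, hne₁]
  · intro C hC x hx
    rw [hsift]
    obtain hC | rfl | rfl := (hcomps C).1 hC
    · rw [h.sift_of_mem C hC.2 x hx, if_neg fun k => hC.1 (Option.some_injective _ k)]
    · rw [if_pos (h.sift_of_mem B hB x (hsub₀ hx)), if_neg (Finset.mem_filter.1 hx).2]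
    · rw [if_pos (h.sift_of_mem B hB x (hsub₁ hx)), if_pos (Finset.mem_filter.1 hx).2]
  · intro x C hx
    obtain hx | hx := hback x C hx
    · exact (hcomps C).2 (.inl ⟨hx.1, h.mem_of_sift x C hx.2⟩)
    · exact (hcomps C).2 (.inr hx.2.2.1)
  · obtain ⟨l, r, hlr⟩ := h.root
    exact ⟨_, _, by rw [hσ', hlr]; rfl⟩
  · intro x y C hx hy
    obtain hx | hx := hback x C hx <;> obtain hy | hy := hback y C hy
    · exact h.verdict x y C hx.2 hy.2
    · exact (hx.1 (hpart C hy.1 hy.2.1 (h.mem_of_sift x C hx.2))).elim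
    · exact (hy.1 (hpart C hx.1 hx.2.1 (h.mem_of_sift y C hy.2))).elim
    · exact h.verdict x y B hx.2.2.2 hy.2.2.2
  · rw [hS]; exact h.gen_S
  · intro C hC x hx
    rw [hS]
    obtain hC | rfl | rfl := (hcomps C).1 hC
    exacts [h.gen_comps C hC.2 x hx, h.gen_comps B hB x (hsub₀ hx), h.gen_comps B hB x (hsub₁ hx)]
  · intro C hC x hx
    by_cases hCB : C = B
    · subst hCB
      by_cases hxL : c.fill x ∈ L
      · exact ⟨B₁, (hcomps _).2 (.inr (.inr rfl)), Finset.mem_filter.2 ⟨hx, hxL⟩⟩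
      · exact ⟨B₀, (hcomps _).2 (.inr (.inl rfl)), Finset.mem_filter.2 ⟨hx, hxL⟩⟩
    · exact ⟨C, (hcomps C).2 (.inl ⟨hCB, hC⟩), hx⟩
  · intro C hC x hx y hy D hD hxD _
    obtain hC | rfl | rfl := (hcomps C).1 hC
    · exact h.eq_of_mem hC.2 hD hx hxD ▸ hy
    · exact h.eq_of_mem hB hD (hsub₀ hx) hxD ▸ hsub₀ hy
    · exact h.eq_of_mem hB hD (hsub₁ hx) hxD ▸ hsub₁ hy
  · have hne : B₀ ≠ B₁ := by
      intro k
      obtain ⟨x, hx⟩ := hne₀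
      exact (Finset.mem_filter.1 hx).2 (Finset.mem_filter.1 (k ▸ hx : x ∈ B₁)).2
    have hd : Disjoint (σ.comps.erase B) {B₀, B₁} := by
      rw [Finset.disjoint_right]
      intro C hC hC'
      obtain ⟨hCB, hC'⟩ := Finset.mem_erase.1 hC'
      obtain rfl | hC := Finset.mem_insert.1 hC
      · exact hCB (hpart _ hne₀ hsub₀ hC')
      · obtain rfl := Finset.mem_singleton.1 hC
        exact hCB (hpart _ hne₁ hsub₁ hC')
    have hcard : σ'.comps.card = (σ.comps.erase B).card + 2 := by
      rw [hσ']
      exact (Finset.card_union_of_disjoint hd).trans (by rw [Finset.card_pair hne])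
    have := Finset.card_erase_add_one hB
    omega

namespace Store

/-- The access sequences grow and the pack of components is refined. -/
structure Advance (σ σ' : Store A) : Prop where
  hyp : σ'.hyp = σ.hyp
  ce : σ'.ce = σ.ce
  subset : σ.S ⊆ σ'.S
  refines : Refines σ'.comps σ.comps

theorem Advance.trans {σ σ' σ'' : Store A} (h : σ.Advance σ') (k : σ'.Advance σ'') :
    σ.Advance σ'' :=
  ⟨k.hyp.trans h.hyp, k.ce.trans h.ce, h.subset.trans k.subset, k.refines.trans h.refines⟩

theorem Grow.advance {σ σ' : Store A} (h : σ.Grow σ') : σ.Advance σ' :=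
  ⟨h.frame.1, h.frame.2.1, h.subset, h.refines⟩

theorem Coherent.advance_refl {σ : Store A} (h : σ.Coherent L) : σ.Advance σ := h.grow_refl.advance

/-- Some operands witness a consistency defect. -/
def HasConsDefect (L : Set (SP A)) (σ : Store A) : Prop :=
  ∃ o B p₁ p₂ p, σ.ConsDefectRight L o B p₁ p₂ p ∨ σ.ConsDefectLeft L o B p₁ p₂ p

/-- Some operands witness an associativity defect. -/
def HasAssocDefect (L : Set (SP A)) (σ : Store A) : Prop :=
  ∃ o s₁ s₂ s₃ sl sr Bl Br, σ.AssocDefect L o s₁ s₂ s₃ sl sr Bl Br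

/-- What is achieved by a loop that refines components until the defect `D` has disappeared, its
body changing the flags by `f` and `g`. -/
def LoopPost (L : Set (SP A)) (D : Store A → Prop) (f g : Bool → Bool) (σ σ' : Store A) : Prop :=
  σ'.Coherent L ∧ σ'.Full ∧ ¬ D σ' ∧
    (σ' = σ ∨ (σ.Advance σ' ∧ σ'.alreadyConsistent = f σ.alreadyConsistent ∧
      σ'.alreadyAssoc = g σ.alreadyAssoc ∧ σ.comps.card < σ'.comps.card))

end Store

variable [Fintype A] {N : ℕ}

/-- B is only required to lie inside a component: the second half of a split may have been enlarged
while the first half was being expanded. -/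
theorem ensureAccess_total (hN : ∀ σ : Store A, σ.Coherent L → σ.comps.card ≤ N) {σ : Store A}
    {B : Finset (SP A)} (h : σ.Coherent L) (hB : B.Nonempty) (hsub : ∃ C ∈ σ.comps, B ⊆ C) :
    Total L (fun σ' => σ'.Coherent L ∧ σ.Grow σ' ∧ ∃ s, σ'.IsAccess B s) [.ensureAccess B] σ := by
  refine .single ?_ fun k' σ₁ hs => ?_
  · by_cases hs : ∃ s, σ.IsAccess B s
    · exact ⟨_, _, .ensureAccess_skip B σ hs⟩
    · exact hB.elim fun p hp => ⟨_, _, .ensureAccess_expand B σ hs p hp⟩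
  · cases hs with
    | ensureAccess_skip _ _ hs => exact .done ⟨h, h.grow_refl, hs⟩
    | ensureAccess_expand _ _ _ p hp =>
      obtain ⟨C, hC, hBC⟩ := hsub
      exact (expand_total hN h (h.gen_comps C hC p (hBC hp))).mono
        fun σ' hσ' => ⟨hσ'.1, hσ'.grow, p, hp, hσ'.mem⟩

/-- A split may leave a half without access sequence, so `Full` can fail in between; the two
`ensureAccess` calls restore it. -/
theorem refine_total (hN : ∀ σ : Store A, σ.Coherent L → σ.comps.card ≤ N) {σ : Store A}
    (h : σ.Coherent L) (hF : σ.Full) {B : Finset (SP A)} (hB : B ∈ σ.comps) {c : Ctx A}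
    {z₁ z₂ : SP A} (h₁ : z₁ ∈ B) (h₂ : z₂ ∈ B) (hc : ¬ (c.fill z₁ ∈ L ↔ c.fill z₂ ∈ L)) :
    Total L (fun σ' => σ'.Coherent L ∧ σ'.Full ∧ σ.Advance σ' ∧
      σ'.alreadyConsistent = σ.alreadyConsistent ∧ σ'.alreadyAssoc = σ.alreadyAssoc ∧
      σ.comps.card < σ'.comps.card) [.refine B c] σ := by
  refine .single ⟨_, _, .refine B c σ hB z₁ z₂ h₁ h₂ hc⟩ fun k' σ₁ hs => ?_
  cases hs with
  | refine =>
    obtain ⟨hσ₁, hr, hcard⟩ := h.split_component hB h₁ h₂ hc rfl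
    have hmem : ∀ C ∈ ({B.filter fun w => c.fill w ∉ L, B.filter fun w => c.fill w ∈ L} :
        Finset (Finset (SP A))), C ∈ (σ.comps.erase B) ∪
          {B.filter fun w => c.fill w ∉ L, B.filter fun w => c.fill w ∈ L} :=
      fun C hC => Finset.mem_union_right _ hC
    have hm₀ := hmem _ (Finset.mem_insert_self _ _)
    have hm₁ := hmem _ (Finset.mem_insert_of_mem (Finset.mem_singleton_self _))
    refine (ensureAccess_total hN hσ₁ (hσ₁.nonempty _ hm₀) ⟨_, hm₀, subset_rfl⟩).cons
      fun σ₂ ⟨hσ₂, hG₂, s₀, hs₀⟩ => ?_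
    refine (ensureAccess_total hN hσ₂ (hσ₁.nonempty _ hm₁) (hG₂.enlarge _ hm₁)).mono
      fun σ₃ ⟨hσ₃, hG₃, s₁, hs₁⟩ => ?_
    have hG := hG₂.trans hG₃
    refine ⟨hσ₃, ⟨fun s hs => ?_, fun a => (hF.single a).mono (hG.refines.trans hr),
      hG.subset hF.empty_mem, fun C' hC' => ?_⟩,
      ⟨hG.frame.1, hG.frame.2.1, hG.subset, hG.refines.trans hr⟩, hG.frame.2.2.2.1,
      hG.frame.2.2.2.2, hcard.trans_le (hσ₁.card_le hG.refines)⟩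
    · by_cases hsσ : s ∈ σ.S
      · have hcl := hF.closedAt s hsσ
        have hr' := hG.refines.trans hr
        refine ⟨hcl.1.mono hr', fun t ht o => ?_⟩
        by_cases htσ : t ∈ σ.S
        · exact ⟨(hcl.2 t htσ o).1.mono hr', (hcl.2 t htσ o).2.mono hr'⟩
        · exact ((hG.closedAt t ht htσ).2 s hs o).symm
      · exact hG.closedAt s hs hsσ
    · obtain ⟨C, hC, hCC⟩ | hs := hG.access C' hC'
      · obtain hC | hC := Finset.mem_union.1 hC
        · obtain ⟨s, hs, hs'⟩ := hF.access C (Finset.mem_of_mem_erase hC)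
          exact ⟨s, hCC hs, hG.subset hs'⟩
        · obtain rfl | hC := Finset.mem_insert.1 hC
          · exact ⟨s₀, hCC hs₀.1, hG₃.subset hs₀.2⟩
          · obtain rfl := Finset.mem_singleton.1 hC
            exact ⟨s₁, hCC hs₁.1, hs₁.2⟩
      · exact hs

/-- Common form of the consistency and the associativity loop: each iteration splits a component, so
the bound N limits their number. The flag updates are idempotent so that the outcome does not depend
on how many iterations took place. -/
theorem refineLoop_total (hN : ∀ σ : Store A, σ.Coherent L → σ.comps.card ≤ N) {i : Instr A}
    {D : Store A → Prop} {f g : Bool → Bool} (hf : ∀ b, f (f b) = f b) (hg : ∀ b, g (g b) = g b)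
    (hex : ∀ σ : Store A, ∃ k' σ', Step L i σ k' σ')
    (hstep : ∀ (σ : Store A) k' σ', Step L i σ k' σ' → (k' = [] ∧ σ' = σ ∧ ¬ D σ) ∨
      ∃ B c z₁ z₂, B ∈ σ.comps ∧ z₁ ∈ B ∧ z₂ ∈ B ∧ ¬ (c.fill z₁ ∈ L ↔ c.fill z₂ ∈ L) ∧
        k' = [.refine B c, i] ∧ σ' = { σ with
          alreadyConsistent := f σ.alreadyConsistent
          alreadyAssoc := g σ.alreadyAssoc })
    (n : ℕ) : ∀ {σ : Store A}, σ.Coherent L → σ.Full → N < n + σ.comps.card →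
      Total L (LoopPost L D f g σ) [i] σ := by
  induction n with
  | zero =>
    intro σ h _ hlt
    have := hN σ h
    omega
  | succ n ih =>
    intro σ h hF hlt
    refine .single (hex σ) fun k' σ₁ hs => ?_
    obtain ⟨rfl, rfl, hD⟩ | ⟨B, c, z₁, z₂, hB, h₁, h₂, hc, rfl, hσ₁⟩ := hstep σ k' σ₁ hs
    · exact .done ⟨h, hF, hD, .inl rfl⟩
    · have hC₁ : σ₁.Coherent L := h.congr (by rw [hσ₁]) (by rw [hσ₁]) (by rw [hσ₁])
      have hF₁ : σ₁.Full := hF.congr (by rw [hσ₁]) (by rw [hσ₁])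
      subst hσ₁
      refine (refine_total hN hC₁ hF₁ hB h₁ h₂ hc).cons
        fun τ ⟨hτ, hFτ, hadv, hfτ, hgτ, hcard⟩ => ?_
      simp only at hcard hfτ hgτ
      have hadv' : σ.Advance τ := ⟨hadv.hyp, hadv.ce, hadv.subset, hadv.refines⟩
      refine (ih hτ hFτ (by omega)).mono fun σ' ⟨h', hF', hD', hor⟩ => ⟨h', hF', hD', .inr ?_⟩
      obtain rfl | ⟨hadv'', hf', hg', hcard'⟩ := hor
      · exact ⟨hadv', hfτ, hgτ, hcard⟩
      · exact ⟨hadv'.trans hadv'', by rw [hf', hfτ, hf], by rw [hg', hgτ, hg],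
          hcard.trans hcard'⟩

theorem consistentLoop_total (hN : ∀ σ : Store A, σ.Coherent L → σ.comps.card ≤ N) {σ : Store A}
    (h : σ.Coherent L) (hF : σ.Full) :
    Total L (LoopPost L (HasConsDefect L) (fun _ => false) id σ) [.consistentLoop] σ := by
  refine refineLoop_total (f := fun _ => false) (g := id) hN (fun _ => rfl) (fun _ => rfl)
    (fun σ => ?_) (fun σ k' σ' hs => ?_) (N + 1) h hF (by omega)
  · by_cases hd : σ.HasConsDefect L
    · obtain ⟨o, B, p₁, p₂, p, hd | hd⟩ := hd
      · obtain ⟨c, hc, hcd⟩ := DTree.exists_context_of_sift_ne hd.2.2.2.2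
        exact ⟨_, _, .consistent_right σ o B p₁ p₂ p c hd hc hcd⟩
      · obtain ⟨c, hc, hcd⟩ := DTree.exists_context_of_sift_ne hd.2.2.2.2
        exact ⟨_, _, .consistent_left σ o B p₁ p₂ p c hd hc hcd⟩
    · exact ⟨_, _, .consistent_exit σ hd⟩
  · cases hs with
    | consistent_exit _ hd => exact .inl ⟨rfl, rfl, hd⟩
    | consistent_right _ o B p₁ p₂ p c hd hc hcd =>
      refine .inr ⟨B, _, p₁, p₂, hd.1, hd.2.1.1, hd.2.2.1.1, ?_, rfl, rfl⟩
      rwa [Ctx.fill_plug, Ctx.fill_plug, Ctx.fill_holeLeft, Ctx.fill_holeLeft]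
    | consistent_left _ o B p₁ p₂ p c hd hc hcd =>
      refine .inr ⟨B, _, p₁, p₂, hd.1, hd.2.1.1, hd.2.2.1.1, ?_, rfl, rfl⟩
      rwa [Ctx.fill_plug, Ctx.fill_plug, Ctx.fill_holeRight, Ctx.fill_holeRight]

theorem assocLoop_total (hN : ∀ σ : Store A, σ.Coherent L → σ.comps.card ≤ N) {σ : Store A}
    (h : σ.Coherent L) (hF : σ.Full) :
    Total L (LoopPost L (HasAssocDefect L) id (fun _ => false) σ) [.assocLoop] σ := by
  refine refineLoop_total (f := id) (g := fun _ => false) hN (fun _ => rfl) (fun _ => rfl)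
    (fun σ => ?_) (fun σ k' σ' hs => ?_) (N + 1) h hF (by omega)
  · by_cases hd : σ.HasAssocDefect L
    · obtain ⟨o, s₁, s₂, s₃, sl, sr, Bl, Br, hd⟩ := hd
      obtain ⟨c, hc, hcd⟩ := DTree.exists_context_of_sift_ne hd.2.2.2.2.2.2.2.2.2
      by_cases hq : c.fill (SP.comp o sl s₃) ∈ L ↔ c.fill (SP.comp o (SP.comp o s₁ s₂) s₃) ∈ L
      · exact ⟨_, _, .assoc_right σ o s₁ s₂ s₃ sl sr Bl Br c hd hc hcd hq⟩
      · exact ⟨_, _, .assoc_left σ o s₁ s₂ s₃ sl sr Bl Br c hd hc hcd hq⟩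
    · exact ⟨_, _, .assoc_exit σ hd⟩
  · cases hs with
    | assoc_exit _ hd => exact .inl ⟨rfl, rfl, hd⟩
    | assoc_left _ o s₁ s₂ s₃ sl sr Bl Br c hd hc hcd hq =>
      obtain ⟨-, -, -, hBl, hBl', hsl, -⟩ := hd
      refine .inr ⟨Bl, _, sl, SP.comp o s₁ s₂, hBl, hsl.1, hBl', ?_, rfl, rfl⟩
      rwa [Ctx.fill_plug, Ctx.fill_plug, Ctx.fill_holeLeft, Ctx.fill_holeLeft]
    | assoc_right _ o s₁ s₂ s₃ sl sr Bl Br c hd hc hcd hq =>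
      obtain ⟨-, -, -, -, -, -, hBr, hBr', hsr, -⟩ := hd
      -- Here sl ∘ s₃ and the full product have the same verdict in c, so s₁ ∘ sr differs from s₁ ∘
      -- (s₂ ∘ s₃); with s₁ fixed, this separates sr from s₂ ∘ s₃.
      refine .inr ⟨Br, _, sr, SP.comp o s₂ s₃, hBr, hsr.1, hBr', ?_, rfl, rfl⟩
      rw [Ctx.fill_plug, Ctx.fill_plug, Ctx.fill_holeRight, Ctx.fill_holeRight, ← SP.comp_assoc,
        ← hq]
      exact hcd

theorem makeConsistent_total (hN : ∀ σ : Store A, σ.Coherent L → σ.comps.card ≤ N) {σ : Store A}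
    (h : σ.Coherent L) (hF : σ.Full) :
    Total L (fun σ' => σ'.Coherent L ∧ σ'.Full ∧ σ.Advance σ' ∧ ¬ σ'.HasConsDefect L ∧
      (σ'.alreadyConsistent = true ∨ σ.comps.card < σ'.comps.card)) [.makeConsistent] σ := by
  refine .single ⟨_, _, .makeConsistent σ⟩ fun k' σ₁ hs => ?_
  cases hs with
  | makeConsistent =>
    have hC₁ : Coherent L { σ with alreadyConsistent := true } := h.congr rfl rfl rfl
    have hF₁ : Full { σ with alreadyConsistent := true } := hF.congr rfl rfl
    refine (consistentLoop_total hN hC₁ hF₁).mono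
      fun σ' ⟨h', hF', hD, hor⟩ => ⟨h', hF', ?_⟩
    obtain rfl | ⟨hadv, -, -, hcard⟩ := hor
    · have hadv := h.advance_refl
      exact ⟨⟨rfl, rfl, hadv.subset, hadv.refines⟩, hD, .inl rfl⟩
    · exact ⟨⟨hadv.hyp, hadv.ce, hadv.subset, hadv.refines⟩, hD, .inr hcard⟩

/-- If no iteration took place the store is unchanged up to the flag. This strong form is needed to
carry the consistency established by the preceding pass over to the exit of the repeat loop. -/
theorem makeAssoc_total (hN : ∀ σ : Store A, σ.Coherent L → σ.comps.card ≤ N) {σ : Store A}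
    (h : σ.Coherent L) (hF : σ.Full) :
    Total L (fun σ' => σ'.Coherent L ∧ σ'.Full ∧ σ.Advance σ' ∧ ¬ σ'.HasAssocDefect L ∧
      σ'.alreadyConsistent = σ.alreadyConsistent ∧
      (σ' = { σ with alreadyAssoc := true } ∨
        (σ'.alreadyAssoc = false ∧ σ.comps.card < σ'.comps.card))) [.makeAssoc] σ := by
  refine .single ⟨_, _, .makeAssoc σ⟩ fun k' σ₁ hs => ?_
  cases hs with
  | makeAssoc =>
    have hC₁ : Coherent L { σ with alreadyAssoc := true } := h.congr rfl rfl rfl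
    have hF₁ : Full { σ with alreadyAssoc := true } := hF.congr rfl rfl
    refine (assocLoop_total hN hC₁ hF₁).mono
      fun σ' ⟨h', hF', hD, hor⟩ => ⟨h', hF', ?_⟩
    obtain rfl | ⟨hadv, hf, hg, hcard⟩ := hor
    · have hadv := h.advance_refl
      exact ⟨⟨rfl, rfl, hadv.subset, hadv.refines⟩, hD, rfl, .inl rfl⟩
    · exact ⟨⟨hadv.hyp, hadv.ce, hadv.subset, hadv.refines⟩, hD, hf, .inr ⟨hg, hcard⟩⟩

theorem repeatLoop_total_aux (hN : ∀ σ : Store A, σ.Coherent L → σ.comps.card ≤ N) (n : ℕ) :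
    ∀ {σ : Store A}, σ.Coherent L → σ.Full → N < n + σ.comps.card →
    Total L (fun σ' => σ'.Coherent L ∧ σ'.Full ∧ σ.Advance σ' ∧ ¬ σ'.HasConsDefect L ∧
      ¬ σ'.HasAssocDefect L) [.repeatLoop] σ := by
  induction n with
  | zero =>
    intro σ h _ hlt
    have := hN σ h
    omega
  | succ n ih =>
    intro σ h hF hlt
    refine .single ⟨_, _, .repeatLoop σ⟩ fun k' σ₁ hs => ?_
    cases hs with
    | repeatLoop =>
      refine (makeConsistent_total hN h hF).cons fun τ ⟨hτ, hFτ, hadv, hD, hor⟩ => ?_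
      refine (makeAssoc_total hN hτ hFτ).cons fun υ ⟨hυ, hFυ, hadv', hD', hfl, hor'⟩ => ?_
      have hle := h.card_le hadv.refines
      have hle' := hτ.card_le hadv'.refines
      have hadv'' := hadv.trans hadv'
      refine .single ?_ fun k' σ₂ hs => ?_
      · by_cases hb : υ.alreadyConsistent = true ∧ υ.alreadyAssoc = true
        · exact ⟨_, _, .repeatTest_exit υ hb⟩
        · exact ⟨_, _, .repeatTest_again υ hb⟩
      · cases hs with
        | repeatTest_exit _ hb =>
          -- A true associativity flag means that the last pass changed nothing, so absence of
          -- consistency defects still holds.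
          obtain rfl | ⟨hfalse, -⟩ := hor'
          · exact .done ⟨hυ, hFυ, hadv'', hD, hD'⟩
          · rw [hfalse] at hb
            exact (Bool.false_ne_true hb.2).elim
        | repeatTest_again _ hb =>
          -- Another round is due only if one of the two passes has split a component.
          have hlt' : σ.comps.card < υ.comps.card := by
            obtain rfl | ⟨-, hcard⟩ := hor'
            · obtain ht | hcard := hor
              · exact (hb ⟨ht, rfl⟩).elim
              · exact hcard
            · omega
          exact (ih hυ hFυ (by omega)).mono fun σ' ⟨h', hF', hadv₃, hDD⟩ =>
            ⟨h', hF', hadv''.trans hadv₃, hDD⟩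

theorem repeatLoop_total (hN : ∀ σ : Store A, σ.Coherent L → σ.comps.card ≤ N) {σ : Store A}
    (h : σ.Coherent L) (hF : σ.Full) :
    Total L (fun σ' => σ'.Coherent L ∧ σ'.Full ∧ σ.Advance σ' ∧ ¬ σ'.HasConsDefect L ∧
      ¬ σ'.HasAssocDefect L) [.repeatLoop] σ :=
  repeatLoop_total_aux hN (N + 1) h hF (by omega)

end Refine

/-! ### Hypotheses -/

section Learn

open Store
open scoped Classical

variable {A : Type*} {L : Set (SP A)}

namespace Store

variable {σ : Store A}

theorem Gen.classified (hF : σ.Full) {x : SP A} (hx : Gen σ.S x) : σ.Classified x := by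
  cases hx with
  | empty => exact (hF.closedAt _ hF.empty_mem).1
  | single a => exact hF.single a
  | comp o h₁ h₂ _ _ => exact ((hF.closedAt _ h₁).2 _ h₂ o).1

/-- Without defects the components form a recognizer. -/
theorem Coherent.exists_isInduced (h : σ.Coherent L) (hF : σ.Full)
    (hc : ¬ σ.HasConsDefect L) (ha : ¬ σ.HasAssocDefect L) : ∃ R, σ.IsInduced L R := by
  let Q := {B : Finset (SP A) // B ∈ σ.comps}
  have hrep : ∀ B : Q, ∃ s, σ.IsAccess B.1 s := fun B => hF.access B.1 B.2
  choose rep hrep using hrep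
  have hop : ∀ (o : Op) (B C : Q), ∃ D : Q, SP.comp o (rep B) (rep C) ∈ D.1 := by
    intro o B C
    obtain ⟨D, hD, hm⟩ := ((hF.closedAt _ (hrep B).2).2 _ (hrep C).2 o).1
    exact ⟨⟨D, hD⟩, hm⟩
  choose op hop using hop
  obtain ⟨E, hE, hεE⟩ := (hF.closedAt _ hF.empty_mem).1
  have hlet : ∀ a, ∃ B : Q, SP.single a ∈ B.1 := by
    intro a
    obtain ⟨B, hB, hm⟩ := hF.single a
    exact ⟨⟨B, hB⟩, hm⟩
  choose ι hι using hlet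
  have huniq : ∀ (B C : Q) (x y : SP A), σ.tree.sift L x = σ.tree.sift L y → x ∈ B.1 → y ∈ C.1 →
      B = C := by
    intro B C x y hxy hx hy
    refine Subtype.ext (Option.some_injective _ ?_)
    rw [← h.sift_of_mem B.1 B.2 x hx, ← h.sift_of_mem C.1 C.2 y hy, hxy]
  have key : ∀ (o : Op) (B₁ B₂ B : Q) (u v : SP A), u ∈ σ.S → v ∈ σ.S → u ∈ B₁.1 → v ∈ B₂.1 →
      SP.comp o u v ∈ B.1 → op o B₁ B₂ = B := by
    intro o B₁ B₂ B u v hu hv hu' hv' hB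
    refine huniq _ _ _ _ ?_ (hop o B₁ B₂) hB
    -- Independence of the representatives: the operands are exchanged one at a time, each exchange
    -- being an instance of consistency.
    have h₁ : σ.tree.sift L (SP.comp o u v) = σ.tree.sift L (SP.comp o (rep B₁) v) := by
      by_contra hne
      exact hc ⟨o, B₁.1, u, rep B₁, v, .inl ⟨B₁.2, ⟨hu', hu⟩, hrep B₁, hv, hne⟩⟩
    have h₂ : σ.tree.sift L (SP.comp o (rep B₁) v) =
        σ.tree.sift L (SP.comp o (rep B₁) (rep B₂)) := by
      by_contra hne
      exact hc ⟨o, B₂.1, v, rep B₂, rep B₁, .inr ⟨B₂.2, ⟨hv', hv⟩, hrep B₂, (hrep B₁).2, hne⟩⟩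
    exact (h₁.trans h₂).symm
  refine ⟨{
    op := op
    one := ⟨E, hE⟩
    op_assoc := ?_
    par_comm := ?_
    one_op := ?_
    op_one := ?_
    init := ι
    final := {B | ∀ s ∈ B.1, s ∈ L} }, key, hεE, hι, fun B => Iff.rfl⟩
  · intro o x y z
    refine huniq _ _ _ _ ?_ (hop o (op o x y) z) (hop o x (op o y z))
    -- Both bracketings are computed through access sequences of the inner products, exactly the
    -- situation of an associativity defect.
    by_contra hne
    exact ha ⟨o, rep x, rep y, rep z, rep (op o x y), rep (op o y z), (op o x y).1, (op o y z).1,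
      (hrep x).2, (hrep y).2, (hrep z).2, (op o x y).2, hop o x y, hrep _, (op o y z).2,
      hop o y z, hrep _, Ne.symm hne⟩
  · intro x y
    exact huniq _ _ _ _ (by rw [SP.comp_par_comm]) (hop .par x y) (hop .par y x)
  · intro o x
    exact key o _ x x SP.empty (rep x) hF.empty_mem (hrep x).2 hεE (hrep x).1
      (by rw [SP.empty_comp]; exact (hrep x).1)
  · intro o x
    exact key o x _ x (rep x) SP.empty (hrep x).2 hF.empty_mem (hrep x).1 hεE
      (by rw [SP.comp_empty]; exact (hrep x).1)

/-- The store is as required at the points where the hypothesis is up to date. -/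
structure Good (L : Set (SP A)) (σ : Store A) : Prop where
  coherent : σ.Coherent L
  full : σ.Full
  hyp : ∃ R, σ.IsInduced L R ∧ σ.hyp = some ⟨σ.comps, R⟩

section Induced

variable {R : Recognizer A {B : Finset (SP A) // B ∈ σ.comps}}

/-- The operands of each composition in `Gen` are access sequences lying in their own states, so the
defining rule of the induced operation applies at every node. -/
theorem IsInduced.mem_eval (hR : σ.IsInduced L R) (hF : σ.Full) {x : SP A} (hx : Gen σ.S x) :
    x ∈ (R.eval x).1 := by
  induction hx with
  | empty => rw [R.eval_empty]; exact hR.2.1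
  | single a => rw [R.eval_single]; exact hR.2.2.1 a
  | comp o h₁ h₂ g₁ g₂ ih₁ ih₂ =>
    obtain ⟨B, hB, hm⟩ := Gen.classified hF (.comp o h₁ h₂ g₁ g₂)
    rw [R.eval_comp, hR.1 o _ _ ⟨B, hB⟩ _ _ h₁ h₂ ih₁ ih₂ hm]
    exact hm

theorem IsInduced.eval_eq (hR : σ.IsInduced L R) (h : σ.Coherent L) (hF : σ.Full) {x : SP A}
    (hx : Gen σ.S x) {B : {B : Finset (SP A) // B ∈ σ.comps}} (hB : x ∈ B.1) : R.eval x = B :=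
  Subtype.ext (h.eq_of_mem (R.eval x).2 B.2 (hR.mem_eval hF hx) hB)

/-- A generated pomset lies in the component it evaluates to, and the root test makes the members of
a component share their verdict. -/
theorem IsInduced.accepts_iff (hR : σ.IsInduced L R) (h : σ.Coherent L) (hF : σ.Full) {x : SP A}
    (hx : Gen σ.S x) : R.Accepts x ↔ x ∈ L := by
  have hm := hR.mem_eval hF hx
  refine (hR.2.2.2 _).trans ⟨fun k => k x hm, fun k s hs => ?_⟩
  exact (h.verdict x s _ (h.sift_of_mem _ (R.eval x).2 x hm)
    (h.sift_of_mem _ (R.eval x).2 s hs)).1 k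

theorem IsInduced.hypAccess_eval (hR : σ.IsInduced L R) (h : σ.Coherent L) (hF : σ.Full)
    {z p : SP A} (hp : σ.HypAccess ⟨σ.comps, R⟩ z p) : R.eval p = R.eval z :=
  hR.eval_eq h hF (h.gen_S p hp.2) hp.1

theorem IsInduced.ne_empty (hR : σ.IsInduced L R) (h : σ.Coherent L) (hF : σ.Full) {x : SP A}
    (hx : ¬ SameVerdict L ⟨σ.comps, R⟩ x) : x ≠ SP.empty := by
  rintro rfl
  exact hx (hR.accepts_iff h hF .empty)

theorem IsInduced.agree_hole (hR : σ.IsInduced L R) (h : σ.Coherent L) (hF : σ.Full) (x : SP A) :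
    σ.Agree L ⟨σ.comps, R⟩ Ctx.hole x := by
  intro p hp
  rw [Ctx.fill_hole]
  exact hR.accepts_iff h hF (h.gen_S p hp.2)

end Induced

end Store

/-! ### Postconditions of the main loop -/

/-- The outcome of the counter-example analysis. -/
def FoundPost (L : Set (SP A)) (σ : Store A) (H : Hypothesis A) (σ' : Store A) : Prop :=
  ∃ c p, σ' = { σ with found := (c, p) } ∧ ¬ SameVerdict L H (c.fill p) ∧ σ.Agree L H c p ∧
    Gen σ.S p

/-- What is achieved by one iteration of the main loop: a pomset `p` that is separated from all old
access sequences by contexts becomes an access sequence, and two pomsets that reveal a component to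
be too large enter the pool. -/
def IterPost (L : Set (SP A)) (σ σ' : Store A) : Prop :=
  σ'.Good L ∧ σ.S ⊆ σ'.S ∧ Refines σ'.comps σ.comps ∧ σ.ce ⊆ σ'.ce ∧
    ∃ (c : Ctx A) (p p' : SP A) (B : Finset (SP A)), B ∈ σ.comps ∧ p ∈ B ∧ p' ∈ B ∧
      p ∈ σ'.S ∧ p' ∈ σ.S ∧ c.fill p ∈ σ'.ce ∧
      c.fill p' ∈ σ'.ce ∧ ¬ (c.fill p ∈ L ↔ c.fill p' ∈ L) ∧
      ∀ s ∈ σ.S, ∃ c' : Ctx A, ¬ (c'.fill p ∈ L ↔ c'.fill s ∈ L)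

/-- What is achieved by the main loop. -/
def LearnPost (L : Set (SP A)) (σ σ' : Store A) : Prop :=
  σ'.Good L ∧ σ.S ⊆ σ'.S ∧ Refines σ'.comps σ.comps ∧ σ.ce ⊆ σ'.ce ∧
    ∀ H, σ'.hyp = some H → ∀ x ∈ σ'.ce, SameVerdict L H x

/-! ### Progress measured in states of the target recognizer. -/

section Model

variable {M : Type*} {Mod : Recognizer A M}

/-- The new access sequence is separated by contexts from all old ones, hence has a target state
that none of them has. -/
theorem IterPost.card_image_lt {σ σ' : Store A} (h : IterPost {w | Mod.Accepts w} σ σ') :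
    (σ.S.image Mod.eval).card < (σ'.S.image Mod.eval).card := by
  obtain ⟨-, hS, -, -, c, p, p', B, -, -, -, hp, -, -, -, -, hsep⟩ := h
  refine Finset.card_lt_card (Finset.ssubset_iff.2 ⟨Mod.eval p, fun k => ?_,
    Finset.insert_subset (Finset.mem_image_of_mem _ hp) (Finset.image_subset_image hS)⟩)
  obtain ⟨s, hs, hsp⟩ := Finset.mem_image.1 k
  obtain ⟨c', hc'⟩ := hsep s hs
  refine hc' ?_
  change Mod.eval _ ∈ Mod.final ↔ Mod.eval _ ∈ Mod.final
  rw [Mod.eval_fill_congr c' hsp]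

theorem card_comps_le_of_coherent [Finite M] (σ : Store A) (h : σ.Coherent {w | Mod.Accepts w}) :
    σ.comps.card ≤ Nat.card M := h.card_comps_le

end Model

/-- When all components are separated by the trivial context and have only one access sequence
each, there are no defects. -/
theorem Store.Coherent.no_defects {σ : Store A} (h : σ.Coherent L) (hF : σ.Full)
    (hcard : σ.S.card ≤ σ.comps.card) (hctx : ∀ c ∈ σ.tree.contexts, c = Ctx.hole) :
    ¬ σ.HasConsDefect L ∧ ¬ σ.HasAssocDefect L := by
  -- Every component has an access sequence, so sifting maps S onto the pack; as S is not larger,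
  -- the map is injective. The default value ∅ is never taken on S.
  have hinj : Set.InjOn (fun s => (σ.tree.sift L s).getD ∅) (σ.S : Set (SP A)) := by
    refine Finset.injOn_of_surjOn_of_card_le _ (t := σ.comps) (fun s hs => ?_) (fun B hB => ?_)
      hcard
    · obtain ⟨B, hB, hsB⟩ := (hF.closedAt s hs).1
      change (σ.tree.sift L s).getD ∅ ∈ σ.comps
      rw [h.sift_of_mem B hB s hsB]
      exact hB
    · obtain ⟨s, hs, hs'⟩ := hF.access B hB
      refine ⟨s, hs', ?_⟩
      change (σ.tree.sift L s).getD ∅ = B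
      rw [h.sift_of_mem B hB s hs]
      rfl
  have huniq : ∀ {B s t}, B ∈ σ.comps → s ∈ σ.S → t ∈ σ.S → s ∈ B → t ∈ B → s = t := by
    intro B s t hB hs ht hsB htB
    refine hinj hs ht ?_
    change (σ.tree.sift L s).getD ∅ = (σ.tree.sift L t).getD ∅
    rw [h.sift_of_mem B hB s hsB, h.sift_of_mem B hB t htB]
  have hverd : ∀ {s t}, s ∈ σ.S → t ∈ σ.S → (s ∈ L ↔ t ∈ L) → s = t := by
    intro s t hs ht hst
    refine hinj hs ht ?_
    change (σ.tree.sift L s).getD ∅ = (σ.tree.sift L t).getD ∅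
    rw [DTree.sift_congr (y := t) fun c hc => by rwa [hctx c hc, Ctx.fill_hole, Ctx.fill_hole]]
  -- Access sequences are determined by their verdict, and one of the two verdicts belongs to the
  -- empty pomset.
  have htwo : ∀ {s t}, s ∈ σ.S → t ∈ σ.S → s ≠ SP.empty → t ≠ SP.empty → s = t := by
    intro s t hs ht hsε htε
    refine hverd hs ht ?_
    have h₁ := mt (hverd hs hF.empty_mem) hsε
    have h₂ := mt (hverd ht hF.empty_mem) htε
    tauto
  constructor
  · rintro ⟨o, B, p₁, p₂, p, ⟨hB, h₁, h₂, -, hne⟩ | ⟨hB, h₁, h₂, -, hne⟩⟩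
    · exact hne (by rw [huniq hB h₁.2 h₂.2 h₁.1 h₂.1])
    · exact hne (by rw [huniq hB h₁.2 h₂.2 h₁.1 h₂.1])
  · rintro ⟨o, s₁, s₂, s₃, sl, sr, Bl, Br, h₁, h₂, h₃, hBl, hl, hsl, hBr, hr, hsr, hne⟩
    refine hne ?_
    -- With an empty outer operand, the product with the middle one is that operand, and uniqueness
    -- identifies it with the access sequence. Otherwise the outer operands coincide, and then so do
    -- sl and sr; that common sequence is empty or equal to s₁, so it commutes with s₁.
    by_cases e₁ : s₁ = SP.empty
    · subst e₁
      rw [SP.empty_comp] at hl ⊢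
      rw [huniq hBl hsl.2 h₂ hsl.1 hl, h.sift_of_mem Br hBr sr hsr.1, h.sift_of_mem Br hBr _ hr]
    by_cases e₃ : s₃ = SP.empty
    · subst e₃
      rw [SP.comp_empty] at hr ⊢
      rw [huniq hBr hsr.2 h₂ hsr.1 hr, h.sift_of_mem Bl hBl sl hsl.1, h.sift_of_mem Bl hBl _ hl]
    obtain rfl := htwo h₁ h₃ e₁ e₃
    by_cases e₂ : s₂ = SP.empty
    · subst e₂
      rw [SP.comp_empty] at hl
      rw [SP.empty_comp] at hr
      rw [huniq hBl hsl.2 h₁ hsl.1 hl, huniq hBr hsr.2 h₁ hsr.1 hr]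
    obtain rfl := htwo h₁ h₂ e₁ e₂
    obtain rfl := h.eq_of_mem hBl hBr hl hr
    obtain rfl := huniq hBl hsl.2 hsr.2 hsl.1 hsr.1
    by_cases e : sl = SP.empty
    · rw [e, SP.comp_empty, SP.empty_comp]
    · rw [htwo hsl.2 h₁ e e₁]

theorem Store.coherent_initial : (Store.initial : Store A).Coherent L := by
  have hsift : ∀ x, (Store.initial : Store A).tree.sift L x = none := by
    intro x
    change (DTree.node Ctx.hole (.leaf none) (.leaf none)).sift L x = none
    rw [DTree.sift]
    split_ifs <;> rfl
  refine ⟨fun B hB => by simp [initial] at hB, fun B hB => by simp [initial] at hB,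
    fun x B hx => ?_, ⟨_, _, rfl⟩, fun x y B hx => ?_, fun s hs => by simp [initial] at hs,
    fun B hB => by simp [initial] at hB⟩
  · rw [hsift] at hx; cases hx
  · rw [hsift] at hx; cases hx

variable [Fintype A] {N : ℕ}

theorem buildHypothesis_total {σ : Store A} (h : σ.Coherent L) (hF : σ.Full)
    (hc : ¬ σ.HasConsDefect L) (ha : ¬ σ.HasAssocDefect L) :
    Total L (fun σ' => σ'.Good L ∧ σ'.S = σ.S ∧ σ'.comps = σ.comps ∧ σ'.ce = σ.ce)
      [.buildHypothesis] σ := by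
  obtain ⟨R, hR⟩ := h.exists_isInduced hF hc ha
  refine .single ⟨_, _, .buildHypothesis σ R hR⟩ fun k' σ₁ hs => ?_
  cases hs with
  | buildHypothesis _ R hR =>
    exact .done ⟨⟨h.congr rfl rfl rfl, hF.congr rfl rfl, R, hR, rfl⟩, rfl, rfl, rfl⟩

/-! ### Counter-example analysis -/

/-- Error and agreement at (c, z) are the invariant of the recursion. Failed agreement supplies the
access sequence on which the hypothesis still errs, so some branch is always open, and the size of z
decreases. -/
theorem findEBP_total {σ : Store A} (h : σ.Coherent L) (hF : σ.Full)
    {R : Recognizer A {B : Finset (SP A) // B ∈ σ.comps}} (hR : σ.IsInduced L R)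
    (hH : σ.hyp = some ⟨σ.comps, R⟩) (n : ℕ) : ∀ (c : Ctx A) (z : SP A), z.1.size < n →
    z ≠ SP.empty → ¬ SameVerdict L ⟨σ.comps, R⟩ (c.fill z) → σ.Agree L ⟨σ.comps, R⟩ c z →
    Total L (FoundPost L σ ⟨σ.comps, R⟩) [.findEBP c z] σ := by
  have hHyp : ∀ {H : Hypothesis A}, σ.hyp = some H → H = ⟨σ.comps, R⟩ := fun {H} k =>
    Option.some_injective _ (k.symm.trans hH)
  have hnotAgree : ∀ {c : Ctx A} {z : SP A}, ¬ σ.Agree L ⟨σ.comps, R⟩ c z →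
      ∃ p, σ.HypAccess ⟨σ.comps, R⟩ z p ∧ ¬ SameVerdict L ⟨σ.comps, R⟩ (c.fill p) := by
    intro c z hz
    unfold Agree at hz
    push Not at hz
    exact hz
  induction n with
  | zero => intro c z hz; omega
  | succ n ih =>
    intro c z hsz hz hw ha
    refine .single ?_ fun k' σ₁ hs => ?_
    · by_cases hl : ∃ a, z = SP.single a
      · obtain ⟨a, rfl⟩ := hl
        exact ⟨_, _, .findEBP_letter σ _ c a hH hw ha⟩
      · push Not at hl
        obtain ⟨o, z₁, z₂, hd⟩ := exists_isCanonicalDecomp hz hl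
        by_cases h₁ : σ.Agree L ⟨σ.comps, R⟩ (c.plug (Ctx.holeLeft o z₂)) z₁
        · exact ⟨_, _, .findEBP_descend σ _ c z hH hw ha o z₁ z₂ hd h₁⟩
        · obtain ⟨p₁, hp₁, hd₁⟩ := hnotAgree h₁
          rw [Ctx.fill_plug, Ctx.fill_holeLeft] at hd₁
          by_cases h₂ : σ.Agree L ⟨σ.comps, R⟩ (c.plug (Ctx.holeRight o p₁)) z₂
          · exact ⟨_, _, .findEBP_switch σ _ c z hH hw ha o z₁ z₂ hd h₁ p₁ hp₁ hd₁ h₂⟩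
          · obtain ⟨p₂, hp₂, hd₂⟩ := hnotAgree h₂
            rw [Ctx.fill_plug, Ctx.fill_holeRight] at hd₂
            exact ⟨_, _, .findEBP_found σ _ c z hH hw ha o z₁ z₂ hd h₁ p₁ hp₁ hd₁ h₂ p₂ hp₂ hd₂⟩
    · cases hs with
      | findEBP_letter _ H _ a hH' =>
        exact .done ⟨c, _, rfl, hw, ha, .single a⟩
      | findEBP_descend _ H _ _ hH' _ _ o z₁ z₂ hd h₁ =>
        obtain rfl := hHyp hH'
        have hlt := (hd.size_lt hz).1
        refine ih _ z₁ (by omega) (hd.ne_empty hz).1 ?_ h₁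
        rw [Ctx.fill_plug, Ctx.fill_holeLeft, ← hd.eq_comp]
        exact hw
      | findEBP_switch _ H _ _ hH' _ _ o z₁ z₂ hd h₁ p₁ hp₁ hd₁ h₂ =>
        obtain rfl := hHyp hH'
        have hlt := (hd.size_lt hz).2
        refine ih _ z₂ (by omega) (hd.ne_empty hz).2 ?_ h₂
        rw [Ctx.fill_plug, Ctx.fill_holeRight]
        exact hd₁
      | findEBP_found _ H _ _ hH' _ _ o z₁ z₂ hd h₁ p₁ hp₁ hd₁ h₂ p₂ hp₂ hd₂ =>
        obtain rfl := hHyp hH'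
        refine .done ⟨c, _, rfl, hd₂, fun p hp => ha p ?_,
          .comp o hp₁.2 hp₂.2 (h.gen_S _ hp₁.2) (h.gen_S _ hp₂.2)⟩
        -- The operands have been replaced by access sequences of the same states, so the agreement
        -- assumed for z is literally that for p₁ ∘ p₂.
        have heval : R.eval (SP.comp o p₁ p₂) = R.eval z := by
          rw [hd.eq_comp, R.eval_comp, R.eval_comp, hR.hypAccess_eval h hF hp₁,
            hR.hypAccess_eval h hF hp₂]
        have hp' : σ.IsAccess (R.eval (SP.comp o p₁ p₂)).1 p := hp
        rw [heval] at hp'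
        exact hp'

theorem iteration_total (hN : ∀ σ : Store A, σ.Coherent L → σ.comps.card ≤ N) {σ : Store A}
    (h : σ.Coherent L) (hF : σ.Full)
    {R : Recognizer A {B : Finset (SP A) // B ∈ σ.comps}} (hR : σ.IsInduced L R)
    (hH : σ.hyp = some ⟨σ.comps, R⟩) {x : SP A} (hx : ¬ SameVerdict L ⟨σ.comps, R⟩ x) :
    Total L (IterPost L σ)
      [.findEBP Ctx.hole x, .recordAndExpand, .repeatLoop, .buildHypothesis] σ := by
  refine (findEBP_total h hF hR hH _ Ctx.hole x (Nat.lt_succ_self _) (hR.ne_empty h hF hx)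
    (by rwa [Ctx.fill_hole]) (hR.agree_hole h hF x)).cons ?_
  rintro _ ⟨c, p, rfl, hcp, hag, hg⟩
  -- the access sequences of the state of `p` disagree with `p` in the context `c`
  have hsep : ∀ s, σ.HypAccess ⟨σ.comps, R⟩ p s → ¬ (c.fill p ∈ L ↔ c.fill s ∈ L) := by
    intro s hs hiff
    refine hcp ?_
    have heval := R.eval_fill_congr c (hR.hypAccess_eval h hF hs)
    have hacc : R.Accepts (c.fill s) ↔ R.Accepts (c.fill p) := by
      unfold Recognizer.Accepts
      rw [heval]
    exact (hacc.symm.trans (hag s hs)).trans hiff.symm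
  have hpB := hR.mem_eval hF hg
  obtain ⟨p', hp'⟩ := hF.access _ (R.eval p).2
  -- Updating the pool and the recorded pair leaves sequences, pack and tree intact, so only their
  -- values matter for the remaining instructions.
  have key : ∀ ρ : Store A, ρ.S = σ.S → ρ.comps = σ.comps → ρ.tree = σ.tree →
      ρ.ce = σ.ce ∪ {c.fill p} ∪
        (σ.S.filter fun p' => σ.HypAccess ⟨σ.comps, R⟩ p p').image (fun p' => c.fill p') →
      Total L (IterPost L σ) [.expand p, .repeatLoop, .buildHypothesis] ρ := by
    intro ρ hρS hρc hρt hρce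
    refine (expand_total hN (h.congr hρS hρc hρt) (by rwa [hρS])).cons fun τ hτ => ?_
    have hG := hτ.grow
    refine (repeatLoop_total hN hτ.1 (hG.full (hF.congr hρS hρc))).cons
      fun υ ⟨hυ, hFυ, hadv, hD, hD'⟩ => ?_
    refine (buildHypothesis_total hυ hFυ hD hD').mono fun σ' ⟨h', hS, hc, hce⟩ => ?_
    have hce' := ((hce.trans hadv.ce).trans hG.frame.2.1).trans hρce
    refine ⟨h', ?_, ?_, ?_, c, p, p', _, (R.eval p).2, hpB, hp'.1, ?_, hp'.2, ?_, ?_,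
      hsep p' hp', fun s hs => ?_⟩
    · rw [hS, ← hρS]; exact hG.subset.trans hadv.subset
    · rw [hc, ← hρc]; exact hadv.refines.trans hG.refines
    · rw [hce', Finset.union_assoc]; exact Finset.subset_union_left
    · rw [hS]; exact hadv.subset hτ.mem
    · rw [hce']
      exact Finset.mem_union_left _ (Finset.mem_union_right _ (Finset.mem_singleton_self _))
    · rw [hce']
      exact Finset.mem_union_right _
        (Finset.mem_image.2 ⟨p', Finset.mem_filter.2 ⟨hp'.2, hp'⟩, rfl⟩)
    -- Access sequences in the component of p are separated from it by c, all others by a context of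
    -- the tree.
    · by_cases hsB : s ∈ (R.eval p).1
      · exact ⟨c, hsep s ⟨hsB, hs⟩⟩
      · obtain ⟨c', -, hc'⟩ := DTree.exists_context_of_sift_ne (L := L) (D := σ.tree)
          (x := p) (y := s) fun k => by
            obtain ⟨B, hB, hsB'⟩ := (hF.closedAt s hs).1
            rw [h.sift_of_mem _ (R.eval p).2 p hpB, h.sift_of_mem B hB s hsB'] at k
            exact hsB (Option.some_injective _ k ▸ hsB')
        exact ⟨c', hc'⟩
  refine .step ⟨_, _, .recordAndExpand { σ with found := (c, p) } ⟨σ.comps, R⟩ hH c p rfl⟩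
    fun k' σ₁ hs => ?_
  cases hs with
  | recordAndExpand _ H hH' c' q hcq =>
    obtain rfl : H = ⟨σ.comps, R⟩ := Option.some_injective _ (hH'.symm.trans hH)
    obtain ⟨rfl, rfl⟩ := Prod.mk.inj hcq
    exact key _ rfl rfl rfl rfl

/-! ### The main loop -/

variable {M : Type*} [Finite M] {Mod : Recognizer A M}

/-- Induction on the number of target states not yet met by access sequences; each round meets a new
one. -/
theorem ceLoop_total (n : ℕ) : ∀ {σ : Store A}, σ.Good {w | Mod.Accepts w} →
    Nat.card M < n + (σ.S.image Mod.eval).card →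
    Total {w | Mod.Accepts w} (LearnPost {w | Mod.Accepts w} σ) [.ceLoop] σ := by
  induction n with
  | zero =>
    intro σ _ hlt
    have := Fintype.ofFinite M
    have := (σ.S.image Mod.eval).card_le_univ
    rw [Nat.card_eq_fintype_card] at hlt
    omega
  | succ n ih =>
    intro σ hσ hlt
    obtain ⟨h, hF, R, hR, hH⟩ := id hσ
    refine .single ?_ fun k' σ₁ hs => ?_
    · by_cases hx : ∃ x ∈ σ.ce, ¬ SameVerdict {w | Mod.Accepts w} ⟨σ.comps, R⟩ x
      · obtain ⟨x, hx, hd⟩ := hx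
        exact ⟨_, _, .ceLoop_body σ _ hH x hx hd⟩
      · push Not at hx
        exact ⟨_, _, .ceLoop_exit σ _ hH hx⟩
    · cases hs with
      | ceLoop_exit _ H hH' hx =>
        refine .done ⟨hσ, subset_rfl, h.refines_refl, subset_rfl, fun H₂ hH₂ => ?_⟩
        obtain rfl := Option.some_injective _ (hH'.symm.trans hH₂)
        exact hx
      | ceLoop_body _ H hH' x hx hd =>
        obtain rfl := Option.some_injective _ (hH'.symm.trans hH)
        refine (iteration_total card_comps_le_of_coherent h hF hR hH hd).append
          (k' := [.ceLoop]) fun τ hτ => ?_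
        have hlt' := hτ.card_image_lt
        refine (ih hτ.1 (by omega)).mono fun σ' ⟨h', hS, hr, hce, hfin⟩ => ?_
        exact ⟨h', hτ.2.1.trans hS, hr.trans hτ.2.2.1, hτ.2.2.2.1.trans hce, hfin⟩

/-- The first round is unfolded separately to keep hold of its witnesses p, p' and c. The pool
preserves c[p] and c[p'] to the end, where correctness on both forces p and p' apart. -/
theorem handleCE_total {σ : Store A} (hσ : σ.Good {w | Mod.Accepts w}) {H : Hypothesis A}
    (hH : σ.hyp = some H) {w : SP A} (hw : ¬ SameVerdict {w | Mod.Accepts w} H w) :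
    Total {w | Mod.Accepts w} (fun σ' => σ'.Good {w | Mod.Accepts w} ∧
      Refines σ'.comps σ.comps ∧ σ.comps.card < σ'.comps.card) [.handleCE w] σ := by
  obtain ⟨h, hF, R, hR, hH'⟩ := id hσ
  obtain rfl := Option.some_injective _ (hH.symm.trans hH')
  refine .single ⟨_, _, .handleCE w σ⟩ fun k' σ₁ hs => ?_
  cases hs with
  | handleCE =>
    have hmem : w ∈ ({w} : Finset (SP A)) := Finset.mem_singleton_self w
    refine .single ⟨_, _, .ceLoop_body { σ with ce := {w} } _ hH w hmem hw⟩ fun k' σ₁ hs => ?_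
    cases hs with
    -- The loop cannot be left at once, since its pool consists of a genuine counter-example.
    | ceLoop_exit _ H hH₂ hx =>
      obtain rfl := Option.some_injective _ (hH₂.symm.trans hH)
      exact (hw (hx w hmem)).elim
    | ceLoop_body _ H hH₂ x hx hd =>
      obtain rfl := Option.some_injective _ (hH₂.symm.trans hH)
      have hC₁ : Coherent {w | Mod.Accepts w} { σ with ce := {w} } := h.congr rfl rfl rfl
      have hF₁ : Full { σ with ce := {w} } := hF.congr rfl rfl
      refine (iteration_total (R := R) card_comps_le_of_coherent hC₁ hF₁ hR hH hd).append
        (k' := [.ceLoop]) fun τ hτ => ?_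
      refine (ceLoop_total (Nat.card M + 1) hτ.1 (by omega)).mono
        fun σ' ⟨h', hS, hr, hce, hfin⟩ => ?_
      obtain ⟨-, hSτ, hrτ, -, c, p, p', B, hB, hp, hp', hpS, hpS', hcp, hcp', hne, -⟩ := hτ
      have href := hr.trans hrτ
      refine ⟨h', href, href.card_lt h.nonempty h.disjoint hB hp hp' fun C hC hpC hpC' => hne ?_⟩
      obtain ⟨hC', hF', R', hR', hH₃⟩ := h'
      -- Both are still access sequences, hence generated, so a common final component would be the
      -- final state of each.
      have heval : R'.eval p = R'.eval p' :=
        (hR'.eval_eq hC' hF' (hC'.gen_S p (hS hpS)) (B := ⟨C, hC⟩) hpC).trans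
          (hR'.eval_eq hC' hF' (hC'.gen_S p' (hS (hSτ hpS'))) (B := ⟨C, hC⟩) hpC').symm
      have hacc : R'.Accepts (c.fill p) ↔ R'.Accepts (c.fill p') := by
        unfold Recognizer.Accepts
        rw [R'.eval_fill_congr c heval]
      exact (hfin _ hH₃ _ (hce hcp)).symm.trans (hacc.trans (hfin _ hH₃ _ (hce hcp')))

/-! ### Initialisation -/

/-- No repair loop precedes the first hypothesis; defects are absent because the tree only has the
trivial context and there are at most as many access sequences as components. The general
postcondition of an expansion misses this count by one. The start is therefore unfolded: visiting
the empty pomset creates its component and expands it a second time, which adds no further access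
sequence. -/
theorem init_total (hN : ∀ σ : Store A, σ.Coherent L → σ.comps.card ≤ N) :
    Total L (Good L) [.expand SP.empty, .buildHypothesis] Store.initial := by
  refine .step ⟨_, _, .expand _ _⟩ fun k' σ₁ hs => ?_
  cases hs with
  | expand =>
    have h₁ : Coherent L { (initial : Store A) with S := insert SP.empty ∅ } := by
      have h := coherent_initial (A := A) (L := L)
      refine ⟨h.nonempty, h.sift_of_mem, h.mem_of_sift, h.root, h.verdict, fun s hs => ?_,
        fun B hB => by simp [initial] at hB⟩
      obtain rfl := Finset.mem_singleton.1 (hs : s ∈ ({SP.empty} : Finset (SP A)))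
      exact .empty
    have hnone : (initial : Store A).tree.sift L SP.empty = none := by
      cases hs : (initial : Store A).tree.sift L SP.empty with
      | none => rfl
      | some B =>
        have := (coherent_initial (A := A) (L := L)).mem_of_sift _ _ hs
        simp [initial] at this
    have hunc : ∀ B ∈ (initial : Store A).comps, SP.empty ∉ B := fun B hB => by
      simp [initial] at hB
    refine .step ⟨_, _, .visit_unlabelled _ _ hunc hnone⟩ fun k' σ₂ hs => ?_
    cases hs with
    | visit_classified _ _ hcl => obtain ⟨B, hB, -⟩ := hcl; exact absurd hB (by simp [initial])
    | visit_labelled _ _ B _ hB => rw [hnone] at hB; cases hB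
    | visit_unlabelled _ _ hp hn =>
      obtain ⟨h₂, -, hcard₂⟩ := h₁.new_component hp hn .empty rfl
      refine (expand_total hN h₂ .empty).cons fun τ hτ => ?_
      obtain ⟨hC, hG, hcard, hcl, hl⟩ := id hτ
      have hFτ : τ.Full := by
        refine ⟨fun s hs => ?_, hl, hτ.mem, fun B' hB' => ?_⟩
        · by_cases hsε : s = SP.empty
          · exact hsε ▸ hcl
          · refine hG.closedAt s hs fun k => hsε ?_
            have : s ∈ insert SP.empty (insert SP.empty (∅ : Finset (SP A))) := k
            simpa using this
        · obtain ⟨B, hB, hBB⟩ | hs := hG.access B' hB'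
          · have hB₂ : B ∈ insert {SP.empty} (∅ : Finset (Finset (SP A))) := hB
            obtain rfl : B = {SP.empty} := by simpa using hB₂
            exact ⟨SP.empty, hBB (Finset.mem_singleton_self _), hτ.mem⟩
          · exact hs
      have hgen : ∀ s ∈ insert SP.empty (∅ : Finset (SP A)), s = SP.empty := by simp
      refine (visitAll_total (expandTotal hN N) _ rfl hC (fun p hp => ?_) (by
        have := hN τ hC
        have h0 : 0 < τ.comps.card := by
          obtain ⟨B, hB, -⟩ := hcl.1
          exact Finset.card_pos.2 ⟨B, hB⟩
        omega)).cons fun υ ⟨hυ, hGυ, hcardυ, _⟩ => ?_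
      · simp only [Finset.mem_union, Finset.mem_image, Finset.mem_univ, true_and] at hp
        obtain (((⟨s, hs, rfl⟩ | ⟨s, hs, rfl⟩) | ⟨s, hs, rfl⟩) | ⟨s, hs, rfl⟩) | ⟨a, rfl⟩ := hp
        · rw [hgen s hs, SP.empty_comp]; exact .empty
        · rw [hgen s hs, SP.empty_comp]; exact .empty
        · rw [hgen s hs, SP.empty_comp]; exact .empty
        · rw [hgen s hs, SP.empty_comp]; exact .empty
        · exact .single a
      · have hS : (insert SP.empty (insert SP.empty (∅ : Finset (SP A)))).card = 1 := by simp
        have hcard' : τ.S.card + ({ (initial : Store A) with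
            comps := insert {SP.empty} (∅ : Finset (Finset (SP A))) }).comps.card ≤
              (insert SP.empty (insert SP.empty (∅ : Finset (SP A)))).card + τ.comps.card := hcard
        have hone : (insert {SP.empty} (∅ : Finset (Finset (SP A)))).card = 1 := by simp
        simp only at hcard'
        have hctx : υ.tree.contexts = {Ctx.hole} := by
          refine (hGυ.contexts.trans hG.contexts).trans
            ((DTree.contexts_labelLeaf DTree.initial _ _).trans ?_)
          simp [DTree.initial, DTree.contexts]
        obtain ⟨hD, hD'⟩ := hυ.no_defects (hGυ.full hFτ) (by omega)
          (fun c hc => by rw [hctx] at hc; exact hc)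
        exact (buildHypothesis_total hυ (hGυ.full hFτ) hD hD').mono fun σ' hσ' => hσ'.1

theorem Reachable.good {σ : Store A} (h : Reachable {w | Mod.Accepts w} σ) :
    σ.Good {w | Mod.Accepts w} := by
  induction h with
  | init h => exact (init_total card_comps_le_of_coherent).post h
  | handle _ hH _ hd h ih => exact ((handleCE_total ih hH hd).post h).1

end Learn

end PomsetLearning

end

/-! ### The main theorem. -/

open PomsetLearning in
theorem mainTheorem6 {A : Type*} [Fintype A] {M : Type*} [Finite M] (Mod : Recognizer A M)
    (σ : Store A) (hσ : Reachable {w | Mod.Accepts w} σ)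
    (H : Hypothesis A) (hH : σ.hyp = some H)
    (w : SP A) (hw : w ≠ SP.empty) (hce : ¬ (H.recog.Accepts w ↔ Mod.Accepts w)) :
    AlwaysTerminates {w | Mod.Accepts w} ([Instr.handleCE w], σ) ∧
    ∀ σ' : Store A, Runs {w | Mod.Accepts w} ([Instr.handleCE w], σ) ([], σ') →
      StrictlyRefines σ'.comps σ.comps ∧
      ∃ H' : Hypothesis A, σ'.hyp = some H' ∧ H.numStates < H'.numStates := by
  have hG := hσ.good
  have hT := handleCE_total hG hH hce
  refine ⟨hT.alwaysTerminates, fun σ' hr => ?_⟩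
  obtain ⟨h', href, hcard⟩ := hT.post hr
  obtain ⟨R, -, hR⟩ := hG.hyp
  obtain ⟨R', -, hR'⟩ := h'.hyp
  obtain rfl := Option.some_injective _ (hH.symm.trans hR)
  refine ⟨⟨href.1, href.2, hcard⟩, _, hR', ?_⟩
  simpa only [Hypothesis.numStates, Nat.card_eq_fintype_card, Fintype.card_coe] using hcard
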